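/- A shift space over a finite alphabet $\{1,\dots,p\}$ is a closed subset $X$ of $\{1,\dots,p\}^{\mathbb N}$ (one-sided) or of $\{1,\dots,p\}^{\mathbb Z}$ (two-sided) that is invariant under the shift $\sigma$; its language $\mathcal L$ is the set of all finite words (including the empty word, if $X\ne\emptyset$) that appear in points of $X$. Write $|w|$ for the length of a word $w$. For a collection of words $\mathcal D$, let $\mathcal D_n$ be the set of its words of length $n$ and $h(\mathcal D)=\varlimsup_{n\to\infty}\frac1n\log\#\mathcal D_n\in[-\infty,\infty)$, with $\log 0=-\infty$. Let $X$ be a shift space with language $\mathcal L$, and suppose that $\mathcal L=\mathcal C^p\mathcal G\mathcal C^s$, that is, $\mathcal C^p,\mathcal G,\mathcal C^s\subset\mathcal L$ and every word of $\mathcal L$ can be written as $uvw$ with $u\in\mathcal C^p$, $v\in\mathcal G$, $w\in\mathcal C^s$. For $M\in\mathbb N$ let $\mathcal G(M)$ be the set of words of $\mathcal L$ of the form $uvw$ with $u\in\mathcal C^p$, $v\in\mathcal G$, $w\in\mathcal C^s$, $|u|\le M$, $|w|\le M$. Suppose that: (I) $\mathcal G$ has (S)-specification: there is $t\in\mathbb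 N$ such that for all $m\ge1$ and $w^1,\dots,w^m\in\mathcal G$ there are $v^1,\dots,v^{m-1}\in\mathcal L$ of length $t$ with $x:=w^1v^1w^2v^2\cdots v^{m-1}w^m\in\mathcal L$; (II) $h(\mathcal C^p\cup\mathcal C^s)<h(\mathcal L)$; (III) for every $M\in\mathbb N$ there is $\tau$ such that for every $v\in\mathcal G(M)$ there are words $u,w$ with $|u|\le\tau$, $|w|\le\tau$ and $uvw\in\mathcal G$. Let $\tilde X$ be a subshift factor of $X$, that is, a shift space of the same kind (one-sided or two-sided, respectively), over a possibly different finite alphabet, for which there is a continuous surjection $\pi:X\to\tilde X$ with $\pi\circ\sigma=\sigma\circ\pi$. Suppose that the topological entropy of $\tilde X$ satisfies $h_{\mathrm{top}}(\tilde X,\sigma)>h(\mathcal C^p\cup\mathcal C^s)$. Then $(\tilde X,\sigma)$ is intrinsically ergodic: among the $\sigma$-invariant Borel probability measures on $\tilde X$ there is exactly one whose measure-theoretic (Kolmogorov–Sinai) entropy attains the supremum over all of them (the measure of maximal entropy). If moreover $\mathcal G$ has (Per)-specification, meaning that for some $t\in\mathbb N$ the words $v^i$ in (I) can always be chosen so that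 in addition some $y\in X$ beginning with the word $x$ (at coordinate $1$) satisfies $\sigma^{|x|+t}(y)=y$, then, with $\mathrm{Per}(n)=\{y\in\tilde X:\sigma^k(y)=y\text{ for some }1\le k\le n\}$, the set $\mathrm{Per}(n)$ is finite and nonempty for all large $n$, and the probability measures $\mu_n=\frac1{\#\mathrm{Per}(n)}\sum_{y\in\mathrm{Per}(n)}\delta_y$ converge in the weak* topology to the unique measure of maximal entropy of $(\tilde X,\sigma)$. -/

import Mathlib

open Set Filter Topology MeasureTheory
open scoped ENNReal
open SymbolicDynamics.FullShift (Subshift shift)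

noncomputable section

namespace ShiftSpec

/-! ### Entropy and maximal measures of a measurable self-map -/

section Entropy

variable {Ω : Type*} [MeasurableSpace Ω]

/-- The Shannon entropy of the join `ξ ∨ T⁻¹ξ ∨ ⋯ ∨ T⁻⁽ⁿ⁻¹⁾ξ`, where `ξ` is the partition of `Ω`
into the fibres of `P : Ω → Fin k`; the atoms of the join are the sets of points with a given
`P`-itinerary of length `n`. -/
def joinEntropy (T : Ω → Ω) (μ : Measure Ω) {k : ℕ} (P : Ω → Fin k) (n : ℕ) : ℝ :=
  ∑ a : Fin n → Fin k, Real.negMulLog (μ.real {x | ∀ i : Fin n, P (T^[i] x) = a i})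

/-- The entropy of `T` with respect to the partition into the fibres of `P`. For an invariant
probability measure the `limsup` is a limit. -/
def partitionEntropy (T : Ω → Ω) (μ : Measure Ω) {k : ℕ} (P : Ω → Fin k) : EReal :=
  limsup (fun n : ℕ ↦ ((joinEntropy T μ P n / n : ℝ) : EReal)) atTop

/-- The measure-theoretic (Kolmogorov–Sinai) entropy: the supremum of the entropies with respect to
all finite measurable partitions. -/
def measureEntropy (T : Ω → Ω) (μ : Measure Ω) : EReal :=
  ⨆ (k : ℕ) (P : Ω → Fin k) (_ : Measurable P), partitionEntropy T μ P

/-- `μ` is a measure of maximal entropy: an invariant probability measure whose entropy attains the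
supremum of the entropies of all invariant probability measures. -/
def IsMaxEntropyMeasure (T : Ω → Ω) (μ : ProbabilityMeasure Ω) : Prop :=
  MeasurePreserving T (μ : Measure Ω) (μ : Measure Ω) ∧
    ∀ ν : ProbabilityMeasure Ω, MeasurePreserving T (ν : Measure Ω) (ν : Measure Ω) →
      measureEntropy T (ν : Measure Ω) ≤ measureEntropy T (μ : Measure Ω)

/-- There is exactly one measure of maximal entropy. -/
def IntrinsicallyErgodic (T : Ω → Ω) : Prop :=
  ∃! μ : ProbabilityMeasure Ω, IsMaxEntropyMeasure T μ

/-- The points of period at most `n`. -/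
def Per (T : Ω → Ω) (n : ℕ) : Set Ω :=
  {x | ∃ k : ℕ, 1 ≤ k ∧ k ≤ n ∧ T^[k] x = x}

/-- The uniform distribution on `Per T n`, that is `(1 / #Per T n) ∑_{x ∈ Per T n} δ_x`. It is a
probability measure when `Per T n` is finite and nonempty (and the zero measure otherwise). -/
def perMeasure (T : Ω → Ω) (n : ℕ) : Measure Ω :=
  ((Per T n).encard : ℝ≥0∞)⁻¹ • Measure.sum (fun x : Per T n ↦ Measure.dirac (x : Ω))

/-- The periodic orbit measures are, for all large `n`, well-defined probability measures, and they
converge to `μ` in the weak topology. -/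
def PerMeasuresTendsto [TopologicalSpace Ω] [OpensMeasurableSpace Ω] (T : Ω → Ω)
    (μ : ProbabilityMeasure Ω) : Prop :=
  ∃ ν : ℕ → ProbabilityMeasure Ω,
    (∀ᶠ n in atTop, (ν n : Measure Ω) = perMeasure T n) ∧ Tendsto ν atTop (𝓝 μ)

end Entropy

/-! ### Shift spaces; the index set `I` is `ℕ` (one-sided) or `ℤ` (two-sided) -/

section Shifts

variable {A : Type*} {I : Type*} [AddMonoidWithOne I]

/-- The shift map `σ` of a shift space. -/
def shiftMap [TopologicalSpace A] (X : Subshift A I) : X.carrier → X.carrier :=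
  (X.mapsTo 1).restrict (shift 1) X.carrier X.carrier

/-- The word `w` appears in `x` at position `i`. -/
def AppearsAt (w : List A) (x : I → A) (i : I) : Prop :=
  ∀ (j : ℕ) (hj : j < w.length), x (i + (j : I)) = w[j]

/-- The language of a shift space: all finite words that appear in its points. -/
def language [TopologicalSpace A] (X : Subshift A I) : Set (List A) :=
  {w | ∃ x ∈ X.carrier, ∃ i : I, AppearsAt w x i}

/-- The topological entropy of a shift space over a discrete alphabet `A`. The uniformity on
`X.carrier` is the one induced by the product of the discrete uniformities on `A`. -/
def topEntropy [TopologicalSpace A] [DiscreteTopology A] (X : Subshift A I) : EReal :=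
  letI : UniformSpace A := ⊥
  Dynamics.coverEntropy (shiftMap X) univ

/-- `Y` is a factor of `X`: there is a continuous surjection `X → Y` commuting with the shifts. -/
def IsFactor {B : Type*} [TopologicalSpace A] [TopologicalSpace B]
    (X : Subshift A I) (Y : Subshift B I) : Prop :=
  ∃ π : X.carrier → Y.carrier,
    Continuous π ∧ Function.Surjective π ∧ Function.Semiconj π (shiftMap X) (shiftMap Y)

end Shifts

/-! ### Collections of words -/

section Words

variable {A : Type*}

/-- The growth rate `h(D) = limsup (1/n) log #D_n`, with `log 0 = -∞`. -/
def growthRate (D : Set (List A)) : EReal :=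
  ExpGrowth.expGrowthSup fun n : ℕ ↦ ({w ∈ D | w.length = n}.encard : ℝ≥0∞)

/-- `L = Cᵖ G Cˢ`: every word of `L` is the concatenation of a word of `Cᵖ`, a word of `G` and a
word of `Cˢ`, all three being subsets of `L`. -/
structure IsDecomposition (L Cp G Cs : Set (List A)) : Prop where
  prefix_subset : Cp ⊆ L
  core_subset : G ⊆ L
  suffix_subset : Cs ⊆ L
  exists_eq : ∀ x ∈ L, ∃ u ∈ Cp, ∃ v ∈ G, ∃ w ∈ Cs, x = u ++ v ++ w

/-- `G(M)`: the words `uvw` of `L` with `u ∈ Cᵖ`, `v ∈ G`, `w ∈ Cˢ`, `|u| ≤ M` and `|w| ≤ M`. -/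
def coreUpTo (L Cp G Cs : Set (List A)) (M : ℕ) : Set (List A) :=
  {x ∈ L | ∃ u ∈ Cp, ∃ v ∈ G, ∃ w ∈ Cs, u.length ≤ M ∧ w.length ≤ M ∧ x = u ++ v ++ w}

/-- Condition (III): words of `G(M)` extend to words of `G` by adding boundedly many letters. -/
def Extendable (L Cp G Cs : Set (List A)) : Prop :=
  ∀ M : ℕ, ∃ τ : ℕ, ∀ v ∈ coreUpTo L Cp G Cs M,
    ∃ u w : List A, u.length ≤ τ ∧ w.length ≤ τ ∧ u ++ v ++ w ∈ G

/-- The word `w₀ v₀ w₁ v₁ ⋯ v_{m-1} w_m`. -/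
def glue (w v : ℕ → List A) : ℕ → List A
  | 0 => w 0
  | m + 1 => glue w v m ++ v m ++ w (m + 1)

/-- (S)-specification for `G ⊆ L` with gap size `t`. -/
def SSpecification (L G : Set (List A)) (t : ℕ) : Prop :=
  ∀ (m : ℕ) (w : ℕ → List A), (∀ i ≤ m, w i ∈ G) →
    ∃ v : ℕ → List A, (∀ i < m, v i ∈ L ∧ (v i).length = t) ∧ glue w v m ∈ L

/-- (Per)-specification for a collection `G` of words in the language of `X`, with gap size `t`:
as (S)-specification, and in addition the cylinder of the glued word `x` contains a point `y` with
`σ^(|x| + t) y = y`. -/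
def PerSpecification {I : Type*} [AddMonoidWithOne I] [TopologicalSpace A]
    (X : Subshift A I) (G : Set (List A)) (t : ℕ) : Prop :=
  ∀ (m : ℕ) (w : ℕ → List A), (∀ i ≤ m, w i ∈ G) →
    ∃ v : ℕ → List A, (∀ i < m, v i ∈ language X ∧ (v i).length = t) ∧
      glue w v m ∈ language X ∧
      ∃ y : X.carrier, AppearsAt (glue w v m) (y : I → A) 0 ∧
        Function.IsPeriodicPt (shiftMap X) ((glue w v m).length + t) y

end Words

end ShiftSpec

end

/-! Uniqueness comes from counting words of the factor `Y`, with no ergodic decomposition and no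
Gibbs property. Let `h` be the growth rate of the language of `Y`. It is at least the topological
entropy of `Y`, so some `a < h` exceeds the growth rate of `Cp ∪ Cs`. After a time shift the factor
map is a sliding block code, hence words of `Y` are images of words `uvw` with `u ∈ Cp`, `v ∈ G`, `w
∈ Cs`.

Counting. Specification lets images of words of `G` of length `j` be chosen independently and glued
with gaps `t`, so there are at most `exp ((j + t) h)` such images (`card_image_slide_le`). Summing
over the lengths of `u` and `w` gives a convergent double geometric series in `exp (a - h)`. Hence
`Y` has at most `C exp (n h)` words of length `n` (`exists_card_level_le`). The tail of the series
shows that all but `ε exp (n h)` of them lift to some `G(N)` (`exists_card_sdiff_goodWords_le`), and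
by (III) these glue with bounded gaps (`exists_gluesWithin_goodWords`).

Uniqueness (`IsCoding.eq_of_gluesWithin`). For distinct invariant `μ`, `ν` of entropy `h`, the parts
`μ - ν` and `ν - μ` are invariant, nonzero and mutually singular, so a set `W` of words of some
length almost separates them. Large entropy and the upper count force at least a constant times `exp
(n h)` good words to have few windows outside `W`, and as many to have few windows in `W`. Gluing a
word of the first kind of length `j l` to one of the second kind of length `(K - j) l` gives a word
in which the transition place `j` is visible. The `K` values of `j` thus produce about `K exp (K l
h)` distinct words, too many once `K` is large.

Existence is Misiurewicz' argument: limits of time averages of uniform distributions on `n`-words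
have entropy at least `h`. For periodic points, (Per) turns good words into at least `κ exp (n h)`
points of `Per(n)`. At most `n` of these share an `n`-itinerary, so every limit of their
distributions has entropy at least `h` and is the unique maximal measure. -/

noncomputable section

namespace ShiftSpec

set_option linter.unusedSectionVars false

/-! ### Shannon entropy of finite-valued maps -/

section Shannon

variable {Ω : Type*} [MeasurableSpace Ω] {α β : Type*} [Fintype α] [Fintype β]

/-- The Shannon entropy of the distribution of `ξ` under `μ`. -/
def shannon (μ : Measure Ω) (ξ : Ω → α) : ℝ :=
  ∑ a, Real.negMulLog (μ.real (ξ ⁻¹' {a}))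

/-- This is `log x ≤ x - 1` at `x = q / p`, multiplied by `p`. For `p = 0` only `0 ≤ q` is left, so
`q` need be positive only where `p` is. -/
theorem negMulLog_le_of_cross {p q : ℝ} (hp : 0 ≤ p) (hq : 0 ≤ q) (h : 0 < p → 0 < q) :
    Real.negMulLog p ≤ p * (-Real.log q) + (q - p) := by
  rcases hp.eq_or_lt with rfl | hp'
  · simpa using hq
  · have hq' := h hp'
    have h1 := Real.log_le_sub_one_of_pos (div_pos hq' hp')
    rw [Real.log_div hq'.ne' hp'.ne'] at h1
    have h2 := mul_le_mul_of_nonneg_left h1 hp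
    have h3 : p * (q / p - 1) = q - p := by field_simp
    rw [Real.negMulLog]
    nlinarith

/-- Gibbs' inequality. -/
theorem sum_negMulLog_le {p q : α → ℝ} (hp : ∀ a, 0 ≤ p a) (hq : ∀ a, 0 ≤ q a)
    (h : ∀ a, 0 < p a → 0 < q a) (hs : ∑ a, q a ≤ ∑ a, p a) :
    ∑ a, Real.negMulLog (p a) ≤ ∑ a, p a * (-Real.log (q a)) := by
  have := Finset.sum_le_sum fun a (_ : a ∈ Finset.univ) ↦
    negMulLog_le_of_cross (hp a) (hq a) (h a)
  rw [Finset.sum_add_distrib, Finset.sum_sub_distrib] at this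
  linarith

variable [MeasurableSpace α] [MeasurableSingletonClass α] [MeasurableSpace β]
  [MeasurableSingletonClass β]

theorem sum_real_preimage_of_comp (μ : Measure Ω) [IsFiniteMeasure μ] {ξ : Ω → α}
    (hξ : Measurable ξ) (f : α → β) (b : β) [DecidableEq β] :
    μ.real ((fun x ↦ f (ξ x)) ⁻¹' {b}) = ∑ a with f a = b, μ.real (ξ ⁻¹' {a}) := by
  rw [← measureReal_biUnion_finset]
  · congr 1
    ext x
    simp
  · intro a _ a' _ h
    exact Disjoint.preimage _ (by simpa using h)
  · intro a _
    exact hξ (measurableSet_singleton a)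

theorem sum_real_preimage (μ : Measure Ω) [IsFiniteMeasure μ] {ξ : Ω → α}
    (hξ : Measurable ξ) : ∑ a, μ.real (ξ ⁻¹' {a}) = μ.real univ := by
  have := sum_real_preimage_of_comp μ hξ (fun _ ↦ ()) ()
  simpa using this.symm

theorem sum_real_mul_comp (μ : Measure Ω) [IsFiniteMeasure μ] {ξ : Ω → α}
    (hξ : Measurable ξ) (f : α → β) (g : β → ℝ) :
    ∑ a, μ.real (ξ ⁻¹' {a}) * g (f a) =
      ∑ b, μ.real ((fun x ↦ f (ξ x)) ⁻¹' {b}) * g b := by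
  classical
  simp_rw [sum_real_preimage_of_comp μ hξ f, Finset.sum_mul]
  rw [← Finset.sum_fiberwise (s := Finset.univ) (g := f)]
  refine Finset.sum_congr rfl fun b _ ↦ Finset.sum_congr rfl fun a ha ↦ ?_
  rw [(Finset.mem_filter.1 ha).2]

/-- Written as a sum over the finer atoms, the coarse entropy has the same weights, but each
logarithm is taken of the larger mass of the enclosing coarse atom. -/
theorem shannon_comp_le (μ : Measure Ω) [IsFiniteMeasure μ] {ξ : Ω → α}
    (hξ : Measurable ξ) (f : α → β) : shannon μ (fun x ↦ f (ξ x)) ≤ shannon μ ξ := by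
  classical
  have key := sum_real_mul_comp μ hξ f
    (fun b ↦ -Real.log (μ.real ((fun x ↦ f (ξ x)) ⁻¹' {b})))
  have : shannon μ (fun x ↦ f (ξ x)) = ∑ a, μ.real (ξ ⁻¹' {a}) *
      -Real.log (μ.real ((fun x ↦ f (ξ x)) ⁻¹' {f a})) := by
    rw [key, shannon]
    exact Finset.sum_congr rfl fun b _ ↦ by simp [Real.negMulLog]
  rw [this, shannon]
  refine Finset.sum_le_sum fun a _ ↦ ?_
  rw [Real.negMulLog, neg_mul, mul_neg, neg_le_neg_iff]
  rcases (measureReal_nonneg : 0 ≤ μ.real (ξ ⁻¹' {a})).eq_or_lt with h | h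
  · simp [← h]
  · refine mul_le_mul_of_nonneg_left (Real.log_le_log h ?_) h.le
    refine measureReal_mono ?_
    rintro x rfl
    rfl

theorem shannon_le_cross (μ : Measure Ω) [IsProbabilityMeasure μ] {ξ : Ω → α}
    (hξ : Measurable ξ) {q : α → ℝ} (hq : ∀ a, 0 ≤ q a) (hs : ∑ a, q a ≤ 1)
    (h : ∀ a, 0 < μ.real (ξ ⁻¹' {a}) → 0 < q a) :
    shannon μ ξ ≤ ∑ a, μ.real (ξ ⁻¹' {a}) * (-Real.log (q a)) :=
  sum_negMulLog_le (fun _ ↦ measureReal_nonneg) hq h (by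
    rw [sum_real_preimage μ hξ]; simpa using hs)

theorem shannon_nonneg (μ : Measure Ω) [IsProbabilityMeasure μ] (ξ : Ω → α) :
    0 ≤ shannon μ ξ :=
  Finset.sum_nonneg fun _ _ ↦ Real.negMulLog_nonneg measureReal_nonneg measureReal_le_one

/-- Gibbs' inequality against the product of the marginal distributions. -/
theorem shannon_pi_le {n : ℕ} (μ : Measure Ω) [IsProbabilityMeasure μ] {ξ : Fin n → Ω → α}
    (hξ : ∀ i, Measurable (ξ i)) :
    shannon μ (fun x i ↦ ξ i x) ≤ ∑ i, shannon μ (ξ i) := by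
  classical
  have hm : Measurable (fun x i ↦ ξ i x) := measurable_pi_lambda _ hξ
  have hpos : ∀ a : Fin n → α, 0 < μ.real ((fun x i ↦ ξ i x) ⁻¹' {a}) →
      ∀ i, 0 < μ.real (ξ i ⁻¹' {a i}) := by
    refine fun a ha i ↦ ha.trans_le (measureReal_mono ?_)
    rintro x rfl
    rfl
  refine (shannon_le_cross μ hm (q := fun a ↦ ∏ i, μ.real (ξ i ⁻¹' {a i}))
    (fun a ↦ Finset.prod_nonneg fun _ _ ↦ measureReal_nonneg) ?_
    (fun a ha ↦ Finset.prod_pos fun i _ ↦ hpos a ha i)).trans ?_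
  · rw [← Fintype.prod_sum (fun i b ↦ μ.real (ξ i ⁻¹' {b}))]
    simp [sum_real_preimage μ (hξ _)]
  · have : ∀ a : Fin n → α, μ.real ((fun x i ↦ ξ i x) ⁻¹' {a}) *
        (-Real.log (∏ i, μ.real (ξ i ⁻¹' {a i}))) =
        ∑ i, μ.real ((fun x i ↦ ξ i x) ⁻¹' {a}) * (-Real.log (μ.real (ξ i ⁻¹' {a i}))) := by
      intro a
      rcases (measureReal_nonneg : 0 ≤ μ.real ((fun x i ↦ ξ i x) ⁻¹' {a})).eq_or_lt with h | h
      · simp [← h]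
      · rw [Real.log_prod fun i _ ↦ (hpos a h i).ne', ← Finset.sum_neg_distrib, Finset.mul_sum]
    rw [Finset.sum_congr rfl fun a _ ↦ this a, Finset.sum_comm]
    refine Finset.sum_le_sum fun i _ ↦ le_of_eq ?_
    rw [sum_real_mul_comp μ hm (fun a ↦ a i) (fun b ↦ -Real.log (μ.real (ξ i ⁻¹' {b})))]
    exact Finset.sum_congr rfl fun b _ ↦ by simp [Real.negMulLog]

theorem shannon_prod_le (μ : Measure Ω) [IsProbabilityMeasure μ] {ξ : Ω → α} {η : Ω → β}
    (hξ : Measurable ξ) (hη : Measurable η) :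
    shannon μ (fun x ↦ (ξ x, η x)) ≤ shannon μ ξ + shannon μ η := by
  classical
  have hm : Measurable (fun x ↦ (ξ x, η x)) := hξ.prodMk hη
  have hpos : ∀ a : α × β, 0 < μ.real ((fun x ↦ (ξ x, η x)) ⁻¹' {a}) →
      0 < μ.real (ξ ⁻¹' {a.1}) ∧ 0 < μ.real (η ⁻¹' {a.2}) := by
    refine fun a ha ↦ ⟨ha.trans_le (measureReal_mono ?_), ha.trans_le (measureReal_mono ?_)⟩ <;>
    · rintro x rfl
      rfl
  refine (shannon_le_cross μ hm (q := fun a ↦ μ.real (ξ ⁻¹' {a.1}) * μ.real (η ⁻¹' {a.2}))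
    (fun a ↦ mul_nonneg measureReal_nonneg measureReal_nonneg) ?_
    (fun a ha ↦ mul_pos (hpos a ha).1 (hpos a ha).2)).trans ?_
  · rw [Fintype.sum_prod_type, ← Finset.sum_mul_sum _ _ (fun a ↦ μ.real (ξ ⁻¹' {a}))
      (fun b ↦ μ.real (η ⁻¹' {b}))]
    simp [sum_real_preimage μ hξ, sum_real_preimage μ hη]
  · have : ∀ a : α × β, μ.real ((fun x ↦ (ξ x, η x)) ⁻¹' {a}) *
        (-Real.log (μ.real (ξ ⁻¹' {a.1}) * μ.real (η ⁻¹' {a.2}))) =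
        μ.real ((fun x ↦ (ξ x, η x)) ⁻¹' {a}) * (-Real.log (μ.real (ξ ⁻¹' {a.1}))) +
        μ.real ((fun x ↦ (ξ x, η x)) ⁻¹' {a}) * (-Real.log (μ.real (η ⁻¹' {a.2}))) := by
      intro a
      rcases (measureReal_nonneg :
        0 ≤ μ.real ((fun x ↦ (ξ x, η x)) ⁻¹' {a})).eq_or_lt with h | h
      · simp [← h]
      · rw [Real.log_mul (hpos a h).1.ne' (hpos a h).2.ne']
        ring
    rw [Finset.sum_congr rfl fun a _ ↦ this a, Finset.sum_add_distrib,
      sum_real_mul_comp μ hm Prod.fst (fun b ↦ -Real.log (μ.real (ξ ⁻¹' {b}))),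
      sum_real_mul_comp μ hm Prod.snd (fun b ↦ -Real.log (μ.real (η ⁻¹' {b})))]
    refine le_of_eq ?_
    congr 1 <;> exact Finset.sum_congr rfl fun b _ ↦ by simp [Real.negMulLog]

theorem shannon_le_log_card (μ : Measure Ω) [IsProbabilityMeasure μ] {ξ : Ω → α}
    (hξ : Measurable ξ) (s : Finset α) (hs : ∀ x, ξ x ∈ s) :
    shannon μ ξ ≤ Real.log s.card := by
  classical
  obtain ⟨x⟩ : Nonempty Ω := nonempty_of_isProbabilityMeasure μ
  have hc : 0 < (s.card : ℝ) := by exact_mod_cast Finset.card_pos.2 ⟨_, hs x⟩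
  have h0 : ∀ a ∉ s, μ.real (ξ ⁻¹' {a}) = 0 := by
    intro a ha
    have : ξ ⁻¹' {a} = ∅ := by
      ext y
      simp only [mem_preimage, mem_singleton_iff, mem_empty_iff_false, iff_false]
      rintro rfl
      exact ha (hs y)
    simp [this]
  refine (shannon_le_cross μ hξ (q := fun a ↦ if a ∈ s then (s.card : ℝ)⁻¹ else 0)
    (fun a ↦ by split_ifs <;> positivity) ?_ ?_).trans ?_
  · rw [Finset.sum_ite_mem]
    simp [hc.ne']
  · intro a ha
    by_cases h : a ∈ s
    · simpa [h] using hc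
    · exact absurd ha (by simp [h0 a h])
  · have : ∀ a, μ.real (ξ ⁻¹' {a}) * (-Real.log (if a ∈ s then (s.card : ℝ)⁻¹ else 0)) =
        μ.real (ξ ⁻¹' {a}) * Real.log s.card := by
      intro a
      by_cases h : a ∈ s
      · simp [h]
      · simp [h0 a h]
    rw [Finset.sum_congr rfl fun a _ ↦ this a, ← Finset.sum_mul, sum_real_preimage μ hξ]
    simp

theorem shannon_comp_measurePreserving {T : Ω → Ω} {μ : Measure Ω}
    (hT : MeasurePreserving T μ μ) {ξ : Ω → α} (hξ : Measurable ξ) :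
    shannon μ (fun x ↦ ξ (T x)) = shannon μ ξ := by
  refine Finset.sum_congr rfl fun a _ ↦ ?_
  rw [show (fun x ↦ ξ (T x)) ⁻¹' {a} = T ⁻¹' (ξ ⁻¹' {a}) from rfl, measureReal_def,
    hT.measure_preimage (hξ (measurableSet_singleton a)).nullMeasurableSet, measureReal_def]

theorem shannon_map {T : Ω → Ω} {μ : Measure Ω} (hT : Measurable T) {ξ : Ω → α}
    (hξ : Measurable ξ) : shannon (μ.map T) ξ = shannon μ (fun x ↦ ξ (T x)) := by
  refine Finset.sum_congr rfl fun a _ ↦ ?_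
  rw [measureReal_def, Measure.map_apply hT (hξ (measurableSet_singleton a))]
  rfl

/-- A distribution all of whose atoms have mass at most `c⁻¹` has entropy at least `log c`. -/
theorem log_le_shannon (μ : Measure Ω) [IsProbabilityMeasure μ] {ξ : Ω → α}
    (hξ : Measurable ξ) {c : ℝ} (h : ∀ a, μ.real (ξ ⁻¹' {a}) ≤ c⁻¹) :
    Real.log c ≤ shannon μ ξ := by
  have : Real.log c = ∑ a, μ.real (ξ ⁻¹' {a}) * Real.log c := by
    rw [← Finset.sum_mul, sum_real_preimage μ hξ]
    simp
  rw [this]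
  refine Finset.sum_le_sum fun a _ ↦ ?_
  rcases (measureReal_nonneg : 0 ≤ μ.real (ξ ⁻¹' {a})).eq_or_lt with h0 | h0
  · simp [← h0]
  · rw [Real.negMulLog, neg_mul, ← mul_neg]
    refine mul_le_mul_of_nonneg_left ?_ h0.le
    have := Real.log_le_log h0 (h a)
    rw [Real.log_inv] at this
    linarith

/-- If `ξ` and `η` agree outside a set of small measure, then the discrepancy has small entropy. -/
theorem exists_shannon_option_le {ε : ℝ} (hε : 0 < ε) :
    ∃ δ > 0, ∀ (μ : Measure Ω) [IsProbabilityMeasure μ] (e : Ω → Option α),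
      μ.real {x | e x ≠ none} ≤ δ → MeasurableSet {x | e x ≠ none} → shannon μ e ≤ ε := by
  classical
  set k : ℝ := (Fintype.card (Option α) : ℝ) with hk_def
  have hk : 0 < k := by
    rw [hk_def]
    exact_mod_cast Fintype.card_pos
  -- `negMulLog` is continuous and vanishes at `0` and `1`. The atom `none` has mass near `1` and
  -- every other atom has mass near `0`, so each of the `k` terms is at most `ε / k`.
  have c0 : ∀ᶠ x in 𝓝 (0 : ℝ), Real.negMulLog x < ε / k := by
    refine (Real.continuous_negMulLog.tendsto 0).eventually_lt_const ?_
    simpa using div_pos hε hk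
  have c1 : ∀ᶠ x in 𝓝 (1 : ℝ), Real.negMulLog x < ε / k := by
    refine (Real.continuous_negMulLog.tendsto 1).eventually_lt_const ?_
    simpa using div_pos hε hk
  obtain ⟨δ₀, hδ₀, h0⟩ := Metric.eventually_nhds_iff.1 c0
  obtain ⟨δ₁, hδ₁, h1⟩ := Metric.eventually_nhds_iff.1 c1
  refine ⟨min δ₀ δ₁ / 2, by positivity, fun μ _ e he hme ↦ ?_⟩
  have hlt : μ.real {x | e x ≠ none} < min δ₀ δ₁ :=
    he.trans_lt (half_lt_self (by positivity))
  have : ∀ a, Real.negMulLog (μ.real (e ⁻¹' {a})) ≤ ε / k := by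
    rintro (_ | a)
    · refine (h1 ?_).le
      have : e ⁻¹' {none} = {x | e x ≠ none}ᶜ := by ext; simp
      rw [this, probReal_compl_eq_one_sub hme, Real.dist_eq, abs_lt]
      constructor
      · linarith [hlt.trans_le (min_le_right _ _)]
      · linarith [measureReal_nonneg (μ := μ) (s := {x | e x ≠ none})]
    · refine (h0 ?_).le
      have : μ.real (e ⁻¹' {some a}) ≤ μ.real {x | e x ≠ none} :=
        measureReal_mono fun x hx ↦ by simp_all
      rw [Real.dist_eq, sub_zero, abs_of_nonneg measureReal_nonneg]
      exact this.trans_lt (hlt.trans_le (min_le_left _ _))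
  calc shannon μ e ≤ ∑ _a : Option α, ε / k := Finset.sum_le_sum fun a _ ↦ this a
    _ = ε := by
      rw [Finset.sum_const, nsmul_eq_mul, Finset.card_univ]
      field_simp
      rfl

end Shannon

/-! ### Itineraries and the Kolmogorov–Sinai generator theorem -/

section Itineraries

variable {Ω : Type*} {B : Type*}

/-- The first `n` letters of the itinerary of a point. -/
def itin (T : Ω → Ω) (P : Ω → B) (n : ℕ) (x : Ω) : Fin n → B := fun i ↦ P (T^[i] x)

theorem itin_add (T : Ω → Ω) (P : Ω → B) (m n : ℕ) (x : Ω) :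
    itin T P (m + n) x = Fin.append (itin T P m x) (itin T P n (T^[m] x)) := by
  ext i
  refine Fin.addCases (fun i ↦ ?_) (fun i ↦ ?_) i
  · simp [itin]
  · simp only [itin, Fin.append_right, Fin.val_natAdd]
    rw [← Function.iterate_add_apply]
    congr 2
    simp [add_comm]

variable [MeasurableSpace Ω] [Fintype B] [MeasurableSpace B] [MeasurableSingletonClass B]
  {T : Ω → Ω} {P : Ω → B}

theorem measurable_itin (hT : Measurable T) (hP : Measurable P) (n : ℕ) :
    Measurable (itin T P n) :=
  measurable_pi_lambda _ fun i ↦ hP.comp (hT.iterate i)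

theorem joinEntropy_eq_shannon (T : Ω → Ω) (μ : Measure Ω) {k : ℕ} (P : Ω → Fin k) (n : ℕ) :
    joinEntropy T μ P n = shannon μ (itin T P n) := by
  refine Finset.sum_congr rfl fun a _ ↦ ?_
  congr 2
  ext x
  simp [itin, funext_iff]

theorem shannon_itin_add_le (hT : Measurable T) (hP : Measurable P) (μ : Measure Ω)
    [IsProbabilityMeasure μ] (m n : ℕ) :
    shannon μ (itin T P (m + n)) ≤
      shannon μ (itin T P m) + shannon μ (fun x ↦ itin T P n (T^[m] x)) := by
  have h1 := measurable_itin hT hP m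
  have h2 := (measurable_itin hT hP n).comp (hT.iterate m)
  refine le_trans (le_of_eq ?_) ((shannon_comp_le μ (h1.prodMk h2)
    (fun a : (Fin m → B) × (Fin n → B) ↦ Fin.append a.1 a.2)).trans (shannon_prod_le μ h1 h2))
  congr 1
  ext1 x
  exact itin_add T P m n x

theorem shannon_itin_mono (hT : Measurable T) (hP : Measurable P) (μ : Measure Ω)
    [IsProbabilityMeasure μ] {m n : ℕ} (h : m ≤ n) :
    shannon μ (itin T P m) ≤ shannon μ (itin T P n) :=
  shannon_comp_le μ (measurable_itin hT hP n)
    (fun (a : Fin n → B) (i : Fin m) ↦ a (Fin.castLE h i))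

variable {μ : Measure Ω} [IsProbabilityMeasure μ]

theorem subadditive_shannon_itin (hT : MeasurePreserving T μ μ) (hP : Measurable P) :
    Subadditive fun n ↦ shannon μ (itin T P n) := fun m n ↦ by
  have := shannon_itin_add_le hT.measurable hP μ m n
  rwa [shannon_comp_measurePreserving (hT.iterate m)
    (measurable_itin hT.measurable hP n)] at this

theorem exists_tendsto_shannon_itin (hT : MeasurePreserving T μ μ) (hP : Measurable P) :
    ∃ h : ℝ, Tendsto (fun n : ℕ ↦ shannon μ (itin T P n) / n) atTop (𝓝 h) ∧
      ∀ n : ℕ, n * h ≤ shannon μ (itin T P n) := by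
  have hs := subadditive_shannon_itin hT hP
  have hb : BddBelow (range fun n : ℕ ↦ shannon μ (itin T P n) / n) :=
    ⟨0, by rintro _ ⟨n, rfl⟩; exact div_nonneg (shannon_nonneg _ _) n.cast_nonneg⟩
  refine ⟨hs.lim, hs.tendsto_lim hb, fun n ↦ ?_⟩
  rcases eq_or_ne n 0 with rfl | hn
  · simpa using shannon_nonneg μ (itin T P 0)
  · have hn' : 0 < (n : ℝ) := by exact_mod_cast hn.bot_lt
    have := hs.lim_le_div hb hn
    rw [le_div_iff₀ hn'] at this
    linarith

theorem partitionEntropy_eq_of_tendsto {k : ℕ} {P : Ω → Fin k} {h : ℝ}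
    (hh : Tendsto (fun n : ℕ ↦ shannon μ (itin T P n) / n) atTop (𝓝 h)) :
    partitionEntropy T μ P = h := by
  simp_rw [partitionEntropy, joinEntropy_eq_shannon]
  exact ((continuous_coe_real_ereal.tendsto h).comp hh).limsup_eq

/-- Changing a partition changes the entropy by at most the entropy of the discrepancy. -/
theorem shannon_itin_le_add_discrepancy [DecidableEq B] {Q Q' : Ω → B}
    (hT : MeasurePreserving T μ μ) (hQ' : Measurable Q')
    [MeasurableSpace (Option B)] [MeasurableSingletonClass (Option B)]
    (he : Measurable fun x ↦ if Q x = Q' x then none else some (Q x)) (n : ℕ) :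
    shannon μ (itin T Q n) ≤ shannon μ (itin T Q' n) +
      n * shannon μ (fun x ↦ if Q x = Q' x then none else some (Q x)) := by
  set e : Ω → Option B := fun x ↦ if Q x = Q' x then none else some (Q x) with he_def
  have h1 := measurable_itin hT.measurable hQ' n
  have h2 := measurable_itin hT.measurable he n
  have h3 : shannon μ (itin T e n) ≤ n * shannon μ e := by
    refine (shannon_pi_le μ fun i : Fin n ↦ he.comp (hT.measurable.iterate i)).trans_eq ?_
    have : ∀ i : Fin n, shannon μ (e ∘ T^[i]) = shannon μ e :=
      fun i ↦ shannon_comp_measurePreserving (hT.iterate i) he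
    simp [this]
  have h4 := (shannon_comp_le μ (h1.prodMk h2)
    (fun (a : (Fin n → B) × (Fin n → Option B)) i ↦ (a.2 i).getD (a.1 i))).trans
    (shannon_prod_le μ h1 h2)
  -- The letter `e` stores `Q` exactly where `Q'` is wrong, so the itinerary of `Q` is recovered
  -- from those of `Q'` and `e`.
  have h5 : (fun x i ↦ ((itin T e n x) i).getD (itin T Q' n x i)) = itin T Q n := by
    ext x i
    simp only [itin, he_def]
    split_ifs with h <;> simp [h]
  rw [h5] at h4
  linarith

/-- Invariance lets the itinerary of `Q` start at time `c`. From there its first `n` letters are a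
function of the first `n + m` letters of `P`, and subadditivity splits off the last `m`. -/
theorem shannon_itin_le_of_determined {C : Type*} [Fintype C] [MeasurableSpace C]
    [MeasurableSingletonClass C] {Q : Ω → C} (hT : MeasurePreserving T μ μ) (hP : Measurable P)
    (hQ : Measurable Q) {c m : ℕ} {f : (Fin m → B) → C}
    (h : ∀ x, Q (T^[c] x) = f (itin T P m x)) (n : ℕ) :
    shannon μ (itin T Q n) ≤ shannon μ (itin T P n) + shannon μ (itin T P m) := by
  rw [← shannon_comp_measurePreserving (hT.iterate c) (measurable_itin hT.measurable hQ n)]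
  refine le_trans (le_of_eq ?_) ((shannon_comp_le μ (measurable_itin hT.measurable hP (n + m))
    (fun (a : Fin (n + m) → B) (i : Fin n) ↦ f fun j ↦ a ⟨i + j, by omega⟩)).trans
    (subadditive_shannon_itin hT hP n m))
  congr 1
  ext1 x
  ext1 i
  rw [itin, ← Function.iterate_add_apply, add_comm, Function.iterate_add_apply, h]
  congr 1
  ext1 j
  simp only [itin]
  rw [← Function.iterate_add_apply, add_comm]

end Itineraries

/-! ### Symbolic codings and approximation of partitions by continuous ones. -/

section Coding

variable {Ω : Type*} [TopologicalSpace Ω] {q : ℕ}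

/-- A continuous coding `P` of a continuous map `T` whose itineraries determine, after a
surjective time shift, every continuous finite-valued function. -/
structure IsCoding (T : Ω → Ω) (P : Ω → Fin q) : Prop where
  continuous_map : Continuous T
  continuous_code : Continuous P
  exists_determined : ∀ (k : ℕ) (Q : Ω → Fin k), Continuous Q → ∃ c m : ℕ,
    Function.Surjective T^[c] ∧
      ∀ x y, itin T P m x = itin T P m y → Q (T^[c] x) = Q (T^[c] y)

theorem IsCoding.exists_factor {T : Ω → Ω} {P : Ω → Fin q} (hc : IsCoding T P) {k : ℕ}
    {Q : Ω → Fin k} (hQ : Continuous Q) [Nonempty Ω] : ∃ (c m : ℕ) (f : (Fin m → Fin q) → Fin k),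
    Function.Surjective T^[c] ∧ ∀ x, Q (T^[c] x) = f (itin T P m x) := by
  obtain ⟨c, m, hs, h⟩ := hc.exists_determined k Q hQ
  have : Nonempty (Fin k) := ⟨Q (Classical.arbitrary Ω)⟩
  obtain ⟨f, hf⟩ := (Function.factorsThrough_iff (fun x ↦ Q (T^[c] x))).1
    (fun x y hxy ↦ h x y hxy : Function.FactorsThrough _ (itin T P m))
  exact ⟨c, m, f, hs, fun x ↦ congrFun hf x⟩

variable [CompactSpace Ω] [T2Space Ω] [TotallyDisconnectedSpace Ω] [SecondCountableTopology Ω]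
  [MeasurableSpace Ω] [BorelSpace Ω]

theorem isSetRing_isClopen : IsSetRing {s : Set Ω | IsClopen s} where
  empty_mem := isClopen_empty
  union_mem _ _ h1 h2 := h1.union h2
  sdiff_mem _ _ h1 h2 := IsClopen.diff h1 h2

theorem generateFrom_isClopen :
    ‹MeasurableSpace Ω› = MeasurableSpace.generateFrom {s : Set Ω | IsClopen s} := by
  rw [BorelSpace.measurable_eq (α := Ω)]
  exact isTopologicalBasis_isClopen.borel_eq_generateFrom

theorem exists_isClopen_measure_symmDiff_lt (μ : Measure Ω) [IsFiniteMeasure μ] {s : Set Ω}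
    (hs : MeasurableSet s) {ε : ℝ≥0∞} (hε : 0 < ε) :
    ∃ t, IsClopen t ∧ μ (symmDiff t s) < ε :=
  exists_measure_symmDiff_lt_of_generateFrom_isSetRing isSetRing_isClopen
    ⟨{univ}, countable_singleton _, by simp [isClopen_univ], by simp⟩
    generateFrom_isClopen hs hε

/-- Each fibre of `Q` is approximated by a clopen set up to measure `δ / k`. The approximating map
reads off which of these sets contains the point, and can be wrong only on the `k` symmetric
differences. -/
theorem exists_continuous_approx (μ : Measure Ω) [IsFiniteMeasure μ] {k : ℕ} {Q : Ω → Fin k}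
    (hQ : Measurable Q) {δ : ℝ} (hδ : 0 < δ) :
    ∃ Q' : Ω → Fin k, Continuous Q' ∧ μ.real {x | Q x ≠ Q' x} ≤ δ := by
  classical
  rcases Nat.eq_zero_or_pos k with rfl | hk
  · have : IsEmpty Ω := ⟨fun x ↦ (Q x).elim0⟩
    exact ⟨Q, continuous_def.2 fun s _ ↦ by simp [Set.eq_empty_of_isEmpty], by simp [hδ.le]⟩
  have hpos : 0 < ENNReal.ofReal (δ / k) := by
    rw [ENNReal.ofReal_pos]
    positivity
  choose U hU hUm using fun j : Fin k ↦ exists_isClopen_measure_symmDiff_lt μ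
    (hQ (measurableSet_singleton j)) hpos
  have hne : Nonempty (Fin k) := ⟨⟨0, hk⟩⟩
  let dec : Ω → (Fin k → Prop) := fun x j ↦ x ∈ U j
  -- Points lying in none or in several of the clopen sets receive the default value `0`.
  let g : (Fin k → Prop) → Fin k := fun v ↦
    if h : ∃ j, v j ∧ ∀ i, v i → i = j then h.choose else ⟨0, hk⟩
  refine ⟨fun x ↦ g (dec x), ?_, ?_⟩
  · have hd : IsLocallyConstant dec := by
      rw [IsLocallyConstant.iff_eventually_eq]
      intro x
      have : ∀ j, ∀ᶠ y in 𝓝 x, (y ∈ U j) = (x ∈ U j) := by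
        intro j
        by_cases hx : x ∈ U j
        · filter_upwards [(hU j).isOpen.mem_nhds hx] with y hy
          simp [hx, hy]
        · filter_upwards [(hU j).compl.isOpen.mem_nhds hx] with y hy
          simp only [hx, eq_iff_iff, iff_false]
          exact hy
      filter_upwards [eventually_all.2 this] with y hy
      exact funext hy
    exact (hd.comp g).continuous
  · have hsub : {x | Q x ≠ g (dec x)} ⊆ ⋃ j, symmDiff (U j) (Q ⁻¹' {j}) := by
      intro x hx
      by_contra hcon
      apply hx
      have h1 : ∀ j, dec x j ↔ Q x = j := by
        intro j
        have := fun h ↦ hcon (mem_iUnion.2 ⟨j, h⟩)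
        rw [Set.mem_symmDiff] at this
        simp only [mem_preimage, mem_singleton_iff] at this
        change x ∈ U j ↔ _
        tauto
      have h2 : ∃ j, dec x j ∧ ∀ i, dec x i → i = j :=
        ⟨Q x, (h1 _).2 rfl, fun i hi ↦ ((h1 i).1 hi).symm⟩
      have : g (dec x) = h2.choose := dif_pos h2
      rw [this]
      exact (h1 _).1 h2.choose_spec.1
    calc μ.real {x | Q x ≠ g (dec x)} ≤ μ.real (⋃ j, symmDiff (U j) (Q ⁻¹' {j})) :=
          measureReal_mono hsub
      _ ≤ ∑ j, μ.real (symmDiff (U j) (Q ⁻¹' {j})) := measureReal_iUnion_fintype_le _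
      _ ≤ ∑ _j : Fin k, δ / k := by
          refine Finset.sum_le_sum fun j _ ↦ ?_
          exact ENNReal.toReal_le_of_le_ofReal (by positivity) (hUm j).le
      _ = δ := by
          simp only [Finset.sum_const, Finset.card_univ, Fintype.card_fin, nsmul_eq_mul]
          field_simp

variable {T : Ω → Ω} {P : Ω → Fin q} {μ : Measure Ω} [IsProbabilityMeasure μ]

/-- The Kolmogorov–Sinai theorem: the entropy is attained by the coding partition. -/
theorem IsCoding.partitionEntropy_le (hc : IsCoding T P) (hT : MeasurePreserving T μ μ) {k : ℕ}
    {Q : Ω → Fin k} (hQ : Measurable Q) : partitionEntropy T μ Q ≤ partitionEntropy T μ P := by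
  classical
  have hP := hc.continuous_code.measurable
  have : Nonempty Ω := nonempty_of_isProbabilityMeasure μ
  obtain ⟨a, ha, -⟩ := exists_tendsto_shannon_itin hT hQ
  obtain ⟨b, hb, -⟩ := exists_tendsto_shannon_itin hT hP
  rw [partitionEntropy_eq_of_tendsto ha, partitionEntropy_eq_of_tendsto hb, EReal.coe_le_coe_iff]
  refine le_of_forall_pos_le_add fun ε hε ↦ ?_
  obtain ⟨δ, hδ, hent⟩ := exists_shannon_option_le (Ω := Ω) (α := Fin k) hε
  obtain ⟨Q', hQ'c, hQ'⟩ := exists_continuous_approx μ hQ hδ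
  have hQ'm := hQ'c.measurable
  obtain ⟨c, m, f, -, hf⟩ := hc.exists_factor hQ'c
  let _ : MeasurableSpace (Option (Fin k)) := ⊤
  have he : Measurable fun x ↦ if Q x = Q' x then none else some (Q x) :=
    Measurable.ite (measurableSet_eq_fun hQ hQ'm) measurable_const
      ((measurable_of_countable (some : Fin k → _)).comp hQ)
  have heq : {x | (if Q x = Q' x then none else some (Q x)) ≠ none} = {x | Q x ≠ Q' x} := by
    ext x
    by_cases h : Q x = Q' x <;> simp [h]
  have hsm := hent μ (fun x ↦ if Q x = Q' x then none else some (Q x)) (by rwa [heq])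
    (by rw [heq]; exact (measurableSet_eq_fun hQ hQ'm).compl)
  -- Replacing `Q` by the continuous `Q'` costs `ε` per letter. Replacing `Q'` by `P` costs only the
  -- entropy of `m` boundary letters, which vanishes after division by `n`.
  have key : ∀ n : ℕ, 0 < n → shannon μ (itin T Q n) / n ≤
      shannon μ (itin T P n) / n + shannon μ (itin T P m) / n + ε := by
    intro n hn
    have hn' : 0 < (n : ℝ) := by exact_mod_cast hn
    have h1 := shannon_itin_le_add_discrepancy hT hQ'm he n
    have h2 := shannon_itin_le_of_determined hT hP hQ'm hf n
    have h3 := mul_le_mul_of_nonneg_left hsm hn'.le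
    rw [← add_div, div_add' _ _ _ hn'.ne', div_le_div_iff_of_pos_right hn']
    linarith
  have hlim : Tendsto (fun n : ℕ ↦ shannon μ (itin T P n) / n + shannon μ (itin T P m) / n + ε)
      atTop (𝓝 (b + 0 + ε)) :=
    (hb.add (tendsto_const_div_atTop_nhds_zero_nat _)).add_const ε
  rw [add_zero] at hlim
  exact le_of_tendsto_of_tendsto ha hlim (eventually_atTop.2 ⟨1, fun n hn ↦ key n hn⟩)

theorem IsCoding.measureEntropy_eq (hc : IsCoding T P) (hT : MeasurePreserving T μ μ) :
    measureEntropy T μ = partitionEntropy T μ P :=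
  le_antisymm (iSup_le fun _ ↦ iSup_le fun _ ↦ iSup_le fun hQ ↦ hc.partitionEntropy_le hT hQ)
    (le_iSup_of_le q (le_iSup_of_le P (le_iSup_of_le hc.continuous_code.measurable le_rfl)))

end Coding

/-! ### Time averages of measures and their limits -/

section Average

variable {Ω : Type*} [MeasurableSpace Ω]

/-- The average of the first `n` images of `ν` under `T`. -/
def timeAverage (T : Ω → Ω) (n : ℕ) (ν : Measure Ω) : Measure Ω :=
  (n : ℝ≥0∞)⁻¹ • ∑ i ∈ Finset.range n, ν.map T^[i]

variable {T : Ω → Ω} {ν : Measure Ω}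

theorem timeAverage_real [IsFiniteMeasure ν] (hT : Measurable T) (n : ℕ) {s : Set Ω}
    (hs : MeasurableSet s) :
    (timeAverage T n ν).real s = (n : ℝ)⁻¹ * ∑ i ∈ Finset.range n, ν.real (T^[i] ⁻¹' s) := by
  rw [timeAverage, measureReal_ennreal_smul_apply, ENNReal.toReal_inv, ENNReal.toReal_natCast,
    measureReal_def, Measure.finsetSum_apply, ENNReal.toReal_sum]
  · congr 1
    refine Finset.sum_congr rfl fun i _ ↦ ?_
    rw [Measure.map_apply (hT.iterate i) hs, measureReal_def]
  · intro i _
    exact measure_ne_top _ _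

theorem isProbabilityMeasure_timeAverage [IsProbabilityMeasure ν] (hT : Measurable T) {n : ℕ}
    (hn : n ≠ 0) : IsProbabilityMeasure (timeAverage T n ν) := by
  constructor
  have : ∀ i, ν.map T^[i] univ = 1 := fun i ↦ by
    rw [Measure.map_apply (hT.iterate i) MeasurableSet.univ]; simp
  simp only [timeAverage, Measure.smul_apply, Measure.finsetSum_apply, this, Finset.sum_const,
    Finset.card_range, nsmul_eq_mul, mul_one, smul_eq_mul]
  exact ENNReal.inv_mul_cancel (by exact_mod_cast hn) (ENNReal.natCast_ne_top n)

theorem timeAverage_of_measurePreserving (hT : MeasurePreserving T ν ν) {n : ℕ} (hn : n ≠ 0) :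
    timeAverage T n ν = ν := by
  have : ∀ i, ν.map T^[i] = ν := fun i ↦ (hT.iterate i).map_eq
  simp only [timeAverage, this, Finset.sum_const, Finset.card_range]
  rw [← Nat.cast_smul_eq_nsmul ℝ≥0∞, smul_smul,
    ENNReal.inv_mul_cancel (by exact_mod_cast hn) (ENNReal.natCast_ne_top n), one_smul]

variable {α : Type*} [Fintype α] [MeasurableSpace α] [MeasurableSingletonClass α]

/-- Jensen's inequality for the concave function `negMulLog`, atom by atom. -/
theorem sum_shannon_le_shannon_timeAverage [IsProbabilityMeasure ν] (hT : Measurable T) {n : ℕ}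
    (hn : n ≠ 0) {ξ : Ω → α} (hξ : Measurable ξ) :
    ∑ i ∈ Finset.range n, shannon ν (fun x ↦ ξ (T^[i] x)) ≤
      n * shannon (timeAverage T n ν) ξ := by
  have hn' : 0 < (n : ℝ) := by exact_mod_cast hn.bot_lt
  rw [shannon, Finset.mul_sum]
  simp only [shannon]
  rw [Finset.sum_comm]
  refine Finset.sum_le_sum fun a _ ↦ ?_
  rw [timeAverage_real hT n (hξ (measurableSet_singleton a))]
  have := Real.concaveOn_negMulLog.le_map_sum (t := Finset.range n) (w := fun _ ↦ (n : ℝ)⁻¹)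
    (p := fun i ↦ ν.real (T^[i] ⁻¹' (ξ ⁻¹' {a}))) (fun _ _ ↦ by positivity)
    (by simp [hn'.ne']) (fun _ _ ↦ measureReal_nonneg)
  simp only [smul_eq_mul, ← Finset.mul_sum] at this
  rw [inv_mul_le_iff₀ hn'] at this
  exact this

end Average

theorem sum_range_mul_eq (f : ℕ → ℝ) (r m : ℕ) :
    ∑ i ∈ Finset.range (r * m), f i =
      ∑ b ∈ Finset.range r, ∑ j ∈ Finset.range m, f (j + b * m) := by
  induction r with
  | zero => simp
  | succ r ih =>
    rw [Nat.succ_mul, Finset.sum_range_add, ih, Finset.sum_range_succ]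
    simp only [add_comm]

/-! ### Join entropy of a measure compared with that of its time average. -/

section Misiurewicz

variable {Ω : Type*} [MeasurableSpace Ω] {q : ℕ} {T : Ω → Ω} {P : Ω → Fin q}
  (ν : Measure Ω) [IsProbabilityMeasure ν]

/-- Since `ν` need not be invariant, the shift by `i` cannot be dropped. Subadditivity is applied to
the image of `ν` under `T^[i]`. -/
theorem shannon_itin_iterate_add_le (hT : Measurable T) (hP : Measurable P) (i a b : ℕ) :
    shannon ν (fun x ↦ itin T P (a + b) (T^[i] x)) ≤
      shannon ν (fun x ↦ itin T P a (T^[i] x)) +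
        shannon ν (fun x ↦ itin T P b (T^[a + i] x)) := by
  have hi := hT.iterate i
  have := Measure.isProbabilityMeasure_map (μ := ν) hi.aemeasurable
  have h := shannon_itin_add_le hT hP (ν.map T^[i]) a b
  rw [shannon_map hi (measurable_itin hT hP _), shannon_map hi (measurable_itin hT hP _),
    shannon_map hi (ξ := fun x ↦ itin T P b (T^[a] x))
      ((measurable_itin hT hP _).comp (hT.iterate a))] at h
  simpa only [← Function.iterate_add_apply] using h

theorem shannon_itin_iterate_le (hT : Measurable T) (hP : Measurable P) (i l : ℕ) :
    shannon ν (fun x ↦ itin T P l (T^[i] x)) ≤ l * Real.log q := by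
  refine (shannon_pi_le ν fun j : Fin l ↦ (hP.comp (hT.iterate j)).comp (hT.iterate i)).trans ?_
  have : ∀ j : Fin l, shannon ν ((P ∘ T^[j]) ∘ T^[i]) ≤ Real.log q := fun j ↦ by
    simpa using shannon_le_log_card ν ((hP.comp (hT.iterate j)).comp (hT.iterate i))
      Finset.univ fun _ ↦ Finset.mem_univ _
  refine (Finset.sum_le_sum fun j _ ↦ this j).trans ?_
  simp

theorem shannon_itin_iterate_mul_le (hT : Measurable T) (hP : Measurable P) (i m r : ℕ) :
    shannon ν (fun x ↦ itin T P (r * m) (T^[i] x)) ≤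
      ∑ b ∈ Finset.range r, shannon ν (fun x ↦ itin T P m (T^[i + b * m] x)) := by
  induction r with
  | zero =>
    simpa using shannon_itin_iterate_le ν hT hP i (0 * m)
  | succ r ih =>
    rw [Nat.succ_mul, Finset.sum_range_succ]
    refine (shannon_itin_iterate_add_le ν hT hP i (r * m) m).trans ?_
    rw [add_comm (r * m) i]
    gcongr

/-- The counting estimate behind Misiurewicz' proof of the variational principle. -/
theorem mul_shannon_itin_le (hT : Measurable T) (hP : Measurable P) {n : ℕ} (hn : n ≠ 0) {m : ℕ}
    (hm : m ≠ 0) :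
    m * shannon ν (itin T P n) ≤
      n * shannon (timeAverage T n ν) (itin T P m) + m * (2 * m * Real.log q) := by
  set L := Real.log q
  have hL : 0 ≤ L := Real.log_natCast_nonneg q
  set r := n / m
  have hr : r * m ≤ n := Nat.div_mul_le_self n m
  have hr' : n ≤ r * m + m := by
    have : m * r + n % m = n := Nat.div_add_mod n m
    have := Nat.mod_lt n hm.bot_lt
    have : m * r = r * m := mul_comm _ _
    omega
  -- For each offset `j < m` the time interval is covered by `j` initial letters, `r` blocks of
  -- length `m` and one further block. The two ends cost at most `m * L` each.
  have h1 : ∀ j ∈ Finset.range m, shannon ν (itin T P n) ≤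
      ∑ b ∈ Finset.range r, shannon ν (fun x ↦ itin T P m (T^[j + b * m] x)) + 2 * m * L := by
    intro j hj
    have hj : j < m := Finset.mem_range.1 hj
    have e1 := shannon_itin_mono hT hP ν (show n ≤ j + (r * m + m) by omega)
    have e2 := shannon_itin_iterate_add_le ν hT hP 0 j (r * m + m)
    have e3 := shannon_itin_iterate_add_le ν hT hP j (r * m) m
    have e4 := shannon_itin_iterate_mul_le ν hT hP j m r
    have e5 := shannon_itin_iterate_le ν hT hP 0 j
    have e6 := shannon_itin_iterate_le ν hT hP (r * m + j) m
    simp only [Function.iterate_zero, id_eq, add_zero] at e2 e5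
    have e7 : (j : ℝ) * L ≤ m * L := by gcongr
    have e8 : shannon ν (fun x ↦ itin T P (j + (r * m + m)) x) =
      shannon ν (itin T P (j + (r * m + m))) := rfl
    linarith
  -- Summed over all offsets, the blocks start at each time below `r * m` exactly once.
  have h2 := Finset.sum_le_sum h1
  rw [Finset.sum_add_distrib, Finset.sum_comm,
    ← sum_range_mul_eq (fun i ↦ shannon ν (fun x ↦ itin T P m (T^[i] x)))] at h2
  simp only [Finset.sum_const, Finset.card_range, nsmul_eq_mul] at h2
  have h3 : ∑ i ∈ Finset.range (r * m), shannon ν (fun x ↦ itin T P m (T^[i] x)) ≤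
      ∑ i ∈ Finset.range n, shannon ν (fun x ↦ itin T P m (T^[i] x)) :=
    Finset.sum_le_sum_of_subset_of_nonneg (Finset.range_mono hr)
      fun _ _ _ ↦ shannon_nonneg _ _
  have h4 := sum_shannon_le_shannon_timeAverage (ν := ν) hT hn (measurable_itin hT hP m)
  linarith

end Misiurewicz

/-! ### Weak limits of time averages. -/

section Limit

variable {Ω : Type*} [TopologicalSpace Ω] [CompactSpace Ω] [T2Space Ω]
  [TotallyDisconnectedSpace Ω] [SecondCountableTopology Ω]
  [MeasurableSpace Ω] [BorelSpace Ω] {ι : Type*} {l : Filter ι}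

theorem tendsto_real_of_isClopen {ρ : ι → ProbabilityMeasure Ω} {μ : ProbabilityMeasure Ω}
    (h : Tendsto ρ l (𝓝 μ)) {s : Set Ω} (hs : IsClopen s) :
    Tendsto (fun i ↦ (ρ i : Measure Ω).real s) l (𝓝 ((μ : Measure Ω).real s)) := by
  have := ProbabilityMeasure.tendsto_measure_of_isClopen_of_tendsto h hs
  exact (NNReal.continuous_coe.tendsto _).comp this

/-- Clopen sets form a π-system generating the Borel sets. -/
theorem measurePreserving_of_isClopen {T : Ω → Ω} (hT : Measurable T) {μ : Measure Ω}
    [IsProbabilityMeasure μ] (h : ∀ s, IsClopen s → μ.real (T ⁻¹' s) = μ.real s) :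
    MeasurePreserving T μ μ := by
  refine ⟨hT, ?_⟩
  have := Measure.isProbabilityMeasure_map (μ := μ) hT.aemeasurable
  refine ext_of_generate_finite _ generateFrom_isClopen
    (fun s hs t ht _ ↦ IsClopen.inter hs ht) (fun s hs ↦ ?_) (by simp)
  rw [Measure.map_apply hT ((IsClopen.isOpen hs).measurableSet)]
  exact (measureReal_eq_measureReal_iff).1 (h s hs)

theorem isClopen_itin_preimage {q : ℕ} {T : Ω → Ω} {P : Ω → Fin q} (hc : IsCoding T P) (m : ℕ)
    (s : Set (Fin m → Fin q)) : IsClopen (itin T P m ⁻¹' s) :=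
  (isClopen_discrete s).preimage
    (continuous_pi fun i ↦ hc.continuous_code.comp (hc.continuous_map.iterate i))

/-- Measures of clopen sets, hence entropies of `m`-itineraries, pass to weak limits. Invariance
holds because the defect of an average over `N i` steps telescopes to at most `1 / N i`. The entropy
bound is `mul_shannon_itin_le` divided by `N i`, whose error term tends to zero. -/
theorem IsCoding.of_tendsto_timeAverage [NeBot l] {q : ℕ} {T : Ω → Ω} {P : Ω → Fin q}
    (hc : IsCoding T P) {N : ι → ℕ} (hN : Tendsto N l atTop) {ν ρ : ι → ProbabilityMeasure Ω}
    (hρ : ∀ᶠ i in l, (ρ i : Measure Ω) = timeAverage T (N i) (ν i : Measure Ω))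
    {μ : ProbabilityMeasure Ω} (hlim : Tendsto ρ l (𝓝 μ)) {a : ℝ}
    (ha : ∀ ε > 0, ∀ᶠ i in l, N i * (a - ε) ≤ shannon (ν i : Measure Ω) (itin T P (N i))) :
    MeasurePreserving T (μ : Measure Ω) (μ : Measure Ω) ∧
      ∀ m : ℕ, m * a ≤ shannon (μ : Measure Ω) (itin T P m) := by
  have hT := hc.continuous_map.measurable
  have hP := hc.continuous_code.measurable
  have hN0 : ∀ᶠ i in l, N i ≠ 0 := hN.eventually_ne_atTop 0
  have hinv : ∀ c : ℝ, Tendsto (fun i ↦ c / N i) l (𝓝 0) := fun c ↦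
    (tendsto_const_div_atTop_nhds_zero_nat c).comp hN
  constructor
  · refine measurePreserving_of_isClopen hT fun s hs ↦ ?_
    have h1 := tendsto_real_of_isClopen hlim hs
    have h2 := tendsto_real_of_isClopen hlim (hs.preimage hc.continuous_map)
    have h3 : Tendsto (fun i ↦ (ρ i : Measure Ω).real (T ⁻¹' s) - (ρ i : Measure Ω).real s) l
        (𝓝 0) := by
      refine squeeze_zero_norm' ?_ (hinv 1)
      filter_upwards [hρ, hN0] with i hi hi0
      have hpos : 0 < (N i : ℝ) := by exact_mod_cast hi0.bot_lt
      rw [hi, timeAverage_real hT _ hs.isOpen.measurableSet,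
        timeAverage_real hT _ (hT hs.isOpen.measurableSet), ← mul_sub, ← Finset.sum_sub_distrib]
      have : ∀ j, (ν i : Measure Ω).real (T^[j] ⁻¹' (T ⁻¹' s)) =
          (ν i : Measure Ω).real (T^[j + 1] ⁻¹' s) := fun j ↦ by
        rw [Function.iterate_succ', preimage_comp]
      simp only [this]
      rw [Finset.sum_range_sub (fun j ↦ (ν i : Measure Ω).real (T^[j] ⁻¹' s)), norm_mul,
        div_eq_inv_mul, norm_inv, Real.norm_of_nonneg hpos.le]
      gcongr
      rw [Real.norm_eq_abs, abs_le]
      have e1 := measureReal_nonneg (μ := (ν i : Measure Ω)) (s := T^[N i] ⁻¹' s)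
      have e2 := measureReal_nonneg (μ := (ν i : Measure Ω)) (s := T^[0] ⁻¹' s)
      have e3 := measureReal_le_one (μ := (ν i : Measure Ω)) (s := T^[N i] ⁻¹' s)
      have e4 := measureReal_le_one (μ := (ν i : Measure Ω)) (s := T^[0] ⁻¹' s)
      constructor <;> linarith
    have h4 := tendsto_nhds_unique h3 (h2.sub h1)
    linarith
  · intro m
    rcases eq_or_ne m 0 with rfl | hm
    · simpa using shannon_nonneg (μ : Measure Ω) (itin T P 0)
    have hm' : 0 < (m : ℝ) := by exact_mod_cast hm.bot_lt
    have hs : Tendsto (fun i ↦ shannon (ρ i : Measure Ω) (itin T P m)) l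
        (𝓝 (shannon (μ : Measure Ω) (itin T P m))) :=
      tendsto_finsetSum _ fun a _ ↦ (Real.continuous_negMulLog.tendsto _).comp
        (tendsto_real_of_isClopen hlim (isClopen_itin_preimage hc m {a}))
    refine le_of_forall_pos_le_add fun ε hε ↦ ?_
    have hε' : 0 < ε / m := by positivity
    have hs' : Tendsto (fun i ↦ shannon (ρ i : Measure Ω) (itin T P m) +
        m * (2 * m * Real.log q) / N i) l (𝓝 (shannon (μ : Measure Ω) (itin T P m) + 0)) :=
      hs.add (hinv _)
    rw [add_zero] at hs'
    have : m * (a - ε / m) ≤ shannon (μ : Measure Ω) (itin T P m) := by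
      refine ge_of_tendsto hs' ?_
      filter_upwards [hρ, hN0, ha _ hε'] with i hi hi0 hia
      have hpos : 0 < (N i : ℝ) := by exact_mod_cast hi0.bot_lt
      have key := mul_shannon_itin_le (ν i : Measure Ω) hT hP hi0 hm
      rw [← hi] at key
      rw [add_div' _ _ _ hpos.ne', le_div_iff₀ hpos]
      have := mul_le_mul_of_nonneg_left hia hm'.le
      linarith
    have e : m * (a - ε / m) = m * a - ε := by field_simp
    linarith

end Limit

/-! ### Words of a coding -/

section Levels

variable {B : Type*} [Finite B]

/-- The words of length `n` in a collection of words over a finite alphabet. -/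
def level (D : Set (List B)) (n : ℕ) : Finset (List B) :=
  ((List.finite_length_eq B n).subset (fun _ hw ↦ hw.2 : {w ∈ D | w.length = n} ⊆ _)).toFinset

@[simp]
theorem mem_level {D : Set (List B)} {n : ℕ} {w : List B} :
    w ∈ level D n ↔ w ∈ D ∧ w.length = n := by
  simp [level]

theorem encard_eq_card_level (D : Set (List B)) (n : ℕ) :
    {w ∈ D | w.length = n}.encard = ((level D n).card : ℕ∞) := by
  rw [← Set.encard_coe_eq_coe_finsetCard]
  congr 1
  ext w
  simp

theorem level_mono {D E : Set (List B)} (h : D ⊆ E) (n : ℕ) : level D n ⊆ level E n :=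
  fun _ hw ↦ mem_level.2 ⟨h (mem_level.1 hw).1, (mem_level.1 hw).2⟩

end Levels

/-- The factor of length `n` of the word `w` starting at position `k`. -/
def factorAt {B : Type*} (w : List B) (k n : ℕ) : List B := (w.drop k).take n

theorem length_factorAt {B : Type*} {w : List B} {k n : ℕ} (h : k + n ≤ w.length) :
    (factorAt w k n).length = n := by
  simp [factorAt]
  omega

theorem factorAt_factorAt {B : Type*} (w : List B) {a n k m : ℕ} (h : k + m ≤ n) :
    factorAt (factorAt w a n) k m = factorAt w (a + k) m := by
  simp only [factorAt, List.drop_take, List.drop_drop, List.take_take]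
  congr 1
  omega

section Words

variable {Ω : Type*} {B : Type*}

/-- The first `n` letters of the itinerary of a point, as a word. -/
def word (T : Ω → Ω) (P : Ω → B) (n : ℕ) (x : Ω) : List B := List.ofFn (itin T P n x)

/-- The words that appear in itineraries. -/
def words (T : Ω → Ω) (P : Ω → B) : Set (List B) := {w | ∃ x, word T P w.length x = w}

@[simp]
theorem length_word (T : Ω → Ω) (P : Ω → B) (n : ℕ) (x : Ω) : (word T P n x).length = n := by
  simp [word]

theorem getElem_word (T : Ω → Ω) (P : Ω → B) (n : ℕ) (x : Ω) {i : ℕ}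
    (hi : i < (word T P n x).length) : (word T P n x)[i] = P (T^[i] x) := by
  simp [word, itin]

theorem word_mem_words (T : Ω → Ω) (P : Ω → B) (n : ℕ) (x : Ω) : word T P n x ∈ words T P :=
  ⟨x, by rw [length_word]⟩

theorem factorAt_word (T : Ω → Ω) (P : Ω → B) {n k m : ℕ} (h : k + m ≤ n) (x : Ω) :
    factorAt (word T P n x) k m = word T P m (T^[k] x) := by
  refine List.ext_getElem ?_ fun i h1 h2 ↦ ?_
  · rw [length_factorAt (by simpa using h), length_word]
  · simp only [factorAt, List.getElem_take, List.getElem_drop, getElem_word]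
    rw [← Function.iterate_add_apply, add_comm]

theorem word_eq_word_iff (T : Ω → Ω) (P : Ω → B) (n : ℕ) (x y : Ω) :
    word T P n x = word T P n y ↔ itin T P n x = itin T P n y :=
  List.ofFn_injective.eq_iff

theorem factorAt_mem_words {T : Ω → Ω} {P : Ω → B} {w : List B} (hw : w ∈ words T P) {k m : ℕ}
    (h : k + m ≤ w.length) : factorAt w k m ∈ words T P := by
  obtain ⟨x, hx⟩ := hw
  rw [← hx, factorAt_word T P h]
  exact word_mem_words ..

theorem exists_extension_mem_words {T : Ω → Ω} {P : Ω → B} {w : List B} (hw : w ∈ words T P)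
    {n : ℕ} (h : w.length ≤ n) :
    ∃ z ∈ words T P, z.length = n ∧ factorAt z 0 w.length = w := by
  obtain ⟨x, hx⟩ := hw
  refine ⟨word T P n x, word_mem_words .., length_word .., ?_⟩
  rw [factorAt_word T P (by omega)]
  exact hx

theorem exists_eq_word {T : Ω → Ω} {P : Ω → B} {w : List B} {n : ℕ} (hw : w ∈ words T P)
    (hn : w.length = n) : ∃ x, word T P n x = w := by
  obtain ⟨x, hx⟩ := hw
  exact ⟨x, by rw [← hn, hx]⟩

variable [Finite B] (T : Ω → Ω) (P : Ω → B)

theorem card_level_words_pos [Nonempty Ω] (n : ℕ) : 0 < (level (words T P) n).card :=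
  Finset.card_pos.2 ⟨word T P n (Classical.arbitrary Ω), by simp [word_mem_words]⟩

theorem card_level_words_add_le (m n : ℕ) :
    (level (words T P) (m + n)).card ≤
      (level (words T P) m).card * (level (words T P) n).card := by
  rw [← Finset.card_product]
  refine Finset.card_le_card_of_injOn (fun w ↦ (factorAt w 0 m, factorAt w m n)) ?_ ?_
  · intro w hw
    obtain ⟨hw, hl⟩ := mem_level.1 hw
    simp only [Finset.coe_product, mem_prod, Finset.mem_coe, mem_level]
    exact ⟨⟨factorAt_mem_words hw (by omega), length_factorAt (by omega)⟩,
      factorAt_mem_words hw (by omega), length_factorAt (by omega)⟩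
  · have key : ∀ w ∈ level (words T P) (m + n), w = factorAt w 0 m ++ factorAt w m n := by
      intro w hw
      have hl := (mem_level.1 hw).2
      simp only [factorAt, List.drop_zero]
      rw [List.take_of_length_le (l := w.drop m) (by simp [hl]), List.take_append_drop]
    intro w hw w' hw' h
    simp only [Prod.mk.injEq] at h
    rw [key w hw, key w' hw', h.1, h.2]

/-- Exponential growth of the number of words; the growth rate is also the infimum. -/
theorem exists_tendsto_log_card_level [Nonempty Ω] :
    ∃ h : ℝ, Tendsto (fun n : ℕ ↦ Real.log (level (words T P) n).card / n) atTop (𝓝 h) ∧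
      ∀ n : ℕ, n * h ≤ Real.log (level (words T P) n).card := by
  have hpos : ∀ n, 0 < ((level (words T P) n).card : ℝ) := fun n ↦ by
    exact_mod_cast card_level_words_pos T P n
  have hs : Subadditive fun n ↦ Real.log (level (words T P) n).card := fun m n ↦ by
    rw [← Real.log_mul (hpos m).ne' (hpos n).ne']
    exact Real.log_le_log (hpos _) (by exact_mod_cast card_level_words_add_le T P m n)
  have h0 : ∀ n, 0 ≤ Real.log (level (words T P) n).card := fun n ↦ Real.log_natCast_nonneg _
  have hb : BddBelow (range fun n : ℕ ↦ Real.log (level (words T P) n).card / n) :=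
    ⟨0, by rintro _ ⟨n, rfl⟩; exact div_nonneg (h0 n) n.cast_nonneg⟩
  refine ⟨hs.lim, hs.tendsto_lim hb, fun n ↦ ?_⟩
  rcases eq_or_ne n 0 with rfl | hn
  · simpa using h0 0
  · have hn' : 0 < (n : ℝ) := by exact_mod_cast hn.bot_lt
    have := hs.lim_le_div hb hn
    rw [le_div_iff₀ hn'] at this
    linarith

theorem growthRate_words_eq [Nonempty Ω] {h : ℝ}
    (hh : Tendsto (fun n : ℕ ↦ Real.log (level (words T P) n).card / n) atTop (𝓝 h)) :
    growthRate (words T P) = h := by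
  rw [growthRate, ExpGrowth.expGrowthSup_def]
  refine Tendsto.limsup_eq ?_
  refine ((continuous_coe_real_ereal.tendsto h).comp hh).congr fun n ↦ ?_
  have hpos : 0 < ((level (words T P) n).card : ℝ) := by
    exact_mod_cast card_level_words_pos T P n
  have key : ENNReal.log ({w ∈ words T P | w.length = n}.encard : ℝ≥0∞) =
      (Real.log (level (words T P) n).card : EReal) := by
    rw [encard_eq_card_level, ENNReal.log_pos_real' (by simpa using hpos)]
    simp
  simp only [Function.comp_apply, key]
  rfl

end Words

/-! ### Entropy against the number of words. -/

section Counting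

variable {Ω : Type*} [MeasurableSpace Ω]

/-- Gibbs' inequality against a reference weight that spreads mass `1 / 2` uniformly over `E` and
gives `(2 * K)⁻¹` to each element of `S \ E`. -/
theorem shannon_le_split {α : Type*} [Fintype α] [MeasurableSpace α] [MeasurableSingletonClass α]
    (μ : Measure Ω) [IsProbabilityMeasure μ] {ξ : Ω → α} (hξ : Measurable ξ) {S E : Finset α}
    (hS : ∀ x, ξ x ∈ S) (hE : E.Nonempty) {K : ℝ} (hK : S.card ≤ K) :
    shannon μ ξ ≤ μ.real (ξ ⁻¹' E) * Real.log (2 * E.card) +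
      (1 - μ.real (ξ ⁻¹' E)) * Real.log (2 * K) := by
  classical
  obtain ⟨x⟩ : Nonempty Ω := nonempty_of_isProbabilityMeasure μ
  have hE0 : 0 < (E.card : ℝ) := by exact_mod_cast hE.card_pos
  have hS0 : 0 < (S.card : ℝ) := by exact_mod_cast Finset.card_pos.2 ⟨_, hS x⟩
  have hK0 : 0 < K := hS0.trans_le hK
  have h0 : ∀ a ∉ S, μ.real (ξ ⁻¹' {a}) = 0 := by
    intro a ha
    have : ξ ⁻¹' {a} = ∅ := by
      ext y
      simp only [mem_preimage, mem_singleton_iff, mem_empty_iff_false, iff_false]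
      rintro rfl
      exact ha (hS y)
    simp [this]
  set q : α → ℝ := fun a ↦ (if a ∈ E then (2 * (E.card : ℝ))⁻¹ else 0) +
    (if a ∈ S \ E then (2 * K)⁻¹ else 0) with hq
  have hm : μ.real (ξ ⁻¹' E) = ∑ a, if a ∈ E then μ.real (ξ ⁻¹' {a}) else 0 := by
    rw [Finset.sum_ite_mem, Finset.univ_inter, ← measureReal_biUnion_finset]
    · congr 1
      ext y
      simp
    · intro a _ a' _ h
      exact Disjoint.preimage _ (by simpa using h)
    · intro a _
      exact hξ (measurableSet_singleton a)
  refine (shannon_le_cross μ hξ (q := q) (fun a ↦ by simp only [hq]; positivity) ?_ ?_).trans ?_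
  · rw [hq, Finset.sum_add_distrib, Finset.sum_ite_mem, Finset.sum_ite_mem]
    simp only [Finset.univ_inter, Finset.sum_const, nsmul_eq_mul]
    have h1 : ((S \ E).card : ℝ) ≤ K :=
      le_trans (by exact_mod_cast Finset.card_le_card Finset.sdiff_subset) hK
    have h2 : (E.card : ℝ) * (2 * (E.card : ℝ))⁻¹ = 1 / 2 := by field_simp
    have h3 : ((S \ E).card : ℝ) * (2 * K)⁻¹ ≤ K * (2 * K)⁻¹ := by gcongr
    have h4 : K * (2 * K)⁻¹ = 1 / 2 := by field_simp
    linarith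
  · intro a ha
    by_cases h : a ∈ E
    · simp only [hq, h, if_true, Finset.mem_sdiff, not_true, and_false, if_false, add_zero]
      positivity
    · by_cases h' : a ∈ S
      · simp only [hq, h, if_false, Finset.mem_sdiff, h', not_false_iff, and_true, if_true,
          zero_add]
        positivity
      · exact absurd ha (by simp [h0 a h'])
  · have hterm : ∀ a, μ.real (ξ ⁻¹' {a}) * (-Real.log (q a)) =
        (if a ∈ E then μ.real (ξ ⁻¹' {a}) else 0) * Real.log (2 * E.card) +
        (μ.real (ξ ⁻¹' {a}) - if a ∈ E then μ.real (ξ ⁻¹' {a}) else 0) * Real.log (2 * K) := by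
      intro a
      by_cases h : a ∈ E
      · simp [hq, h, -mul_inv_rev, Real.log_inv]
      · by_cases h' : a ∈ S
        · simp [hq, h, h', -mul_inv_rev, Real.log_inv]
        · simp [h0 a h']
    rw [Finset.sum_congr rfl fun a _ ↦ hterm a, Finset.sum_add_distrib, ← Finset.sum_mul,
      ← Finset.sum_mul, Finset.sum_sub_distrib, ← hm, sum_real_preimage μ hξ]
    simp

variable {q : ℕ} {T : Ω → Ω} {P : Ω → Fin q}

theorem card_filter_ofFn {E : Finset (List (Fin q))} {n : ℕ} (hE : ∀ w ∈ E, w.length = n)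
    [DecidablePred fun a : Fin n → Fin q ↦ List.ofFn a ∈ E] :
    (Finset.univ.filter fun a : Fin n → Fin q ↦ List.ofFn a ∈ E).card = E.card := by
  refine Finset.card_nbij (fun a ↦ List.ofFn a) (fun a ha ↦ (Finset.mem_filter.1 ha).2)
    (fun a _ b _ h ↦ List.ofFn_injective h) fun w hw ↦ ?_
  obtain rfl := hE w hw
  exact ⟨w.get, by simpa using hw, List.ofFn_get w⟩

theorem shannon_itin_le_log_card (hT : Measurable T) (hP : Measurable P) (μ : Measure Ω)
    [IsProbabilityMeasure μ] (n : ℕ) :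
    shannon μ (itin T P n) ≤ Real.log (level (words T P) n).card := by
  classical
  have := shannon_le_log_card μ (measurable_itin hT hP n)
    (Finset.univ.filter fun a : Fin n → Fin q ↦ List.ofFn a ∈ level (words T P) n)
    (fun x ↦ by
      simp only [Finset.mem_filter, Finset.mem_univ, true_and]
      exact mem_level.2 ⟨word_mem_words T P n x, length_word ..⟩)
  rwa [card_filter_ofFn fun w hw ↦ (mem_level.1 hw).2] at this

/-- For a measure of large entropy, sets of words of positive measure have large cardinality. -/
theorem le_card_of_le_measure (hT : Measurable T) (hP : Measurable P) {C h c : ℝ} (hc : 0 < c)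
    (hC : ∀ n : ℕ, (level (words T P) n).card ≤ C * Real.exp (n * h)) :
    ∃ γ > 0, ∀ (μ : Measure Ω) [IsProbabilityMeasure μ] (n : ℕ) (E : Finset (List (Fin q))),
      n * h ≤ shannon μ (itin T P n) → (∀ w ∈ E, w.length = n) →
      c ≤ μ.real {x | word T P n x ∈ E} → γ * Real.exp (n * h) ≤ E.card := by
  classical
  -- With `p` the mass of `E`, the split bound reads `n h ≤ p log (2 #E) + (1 - p) (log (2 C) + n
  -- h)`. Hence `log (2 #E) - n h ≥ -|log (2 C)| / p`, and `p ≥ c` gives the constant.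
  refine ⟨Real.exp (-(|Real.log (2 * C)| / c)) / 2, by positivity, fun μ _ n E hμ hE hcE ↦ ?_⟩
  set E' := Finset.univ.filter fun a : Fin n → Fin q ↦ List.ofFn a ∈ E with hE'
  have hcard : E'.card = E.card := card_filter_ofFn hE
  have hpre : itin T P n ⁻¹' E' = {x | word T P n x ∈ E} := by
    ext x
    simp [hE', word]
  obtain ⟨x, hx⟩ : {x | word T P n x ∈ E}.Nonempty := by
    by_contra hne
    rw [not_nonempty_iff_eq_empty] at hne
    rw [hne] at hcE
    simp at hcE
    linarith
  have hne : E'.Nonempty := ⟨itin T P n x, by simpa [hE', word] using hx⟩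
  have hEpos : 0 < (E.card : ℝ) := by
    rw [← hcard]
    exact_mod_cast hne.card_pos
  have hCpos : 0 < C := by
    have h1 : 0 < ((level (words T P) n).card : ℝ) := by
      exact_mod_cast Finset.card_pos.2 ⟨word T P n x, by simp [word_mem_words]⟩
    exact pos_of_mul_pos_left (h1.trans_le (hC n)) (Real.exp_pos _).le
  have key := shannon_le_split μ (measurable_itin hT hP n)
    (S := Finset.univ.filter fun a : Fin n → Fin q ↦ List.ofFn a ∈ level (words T P) n)
    (fun x ↦ by
      simp only [Finset.mem_filter, Finset.mem_univ, true_and]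
      exact mem_level.2 ⟨word_mem_words T P n x, length_word ..⟩) hne
    (K := C * Real.exp (n * h))
    (by rw [card_filter_ofFn fun w hw ↦ (mem_level.1 hw).2]; exact hC n)
  rw [hpre, hcard, ← mul_assoc 2 C, Real.log_mul (by positivity) (Real.exp_pos _).ne',
    Real.log_exp] at key
  set p := μ.real {x | word T P n x ∈ E}
  have hp1 : p ≤ 1 := measureReal_le_one
  have hp0 : 0 < p := hc.trans_le hcE
  set A := |Real.log (2 * C)|
  have hA : Real.log (2 * C) ≤ A := le_abs_self _
  have hA0 : 0 ≤ A := abs_nonneg _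
  have h1 : -A ≤ p * (Real.log (2 * E.card) - n * h) := by
    have : (1 - p) * Real.log (2 * C) ≤ A :=
      (mul_le_mul_of_nonneg_left hA (by linarith)).trans (by nlinarith)
    nlinarith
  have h2 : -(A / c) ≤ Real.log (2 * E.card) - n * h := by
    have : -(A / c) ≤ -(A / p) := by
      rw [neg_le_neg_iff]
      gcongr
    refine this.trans ?_
    rw [← neg_div, div_le_iff₀ hp0]
    linarith
  have h3 : Real.exp (-(A / c)) * Real.exp (n * h) ≤ 2 * E.card := by
    rw [← Real.exp_add, ← Real.le_log_iff_exp_le (by positivity)]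
    linarith
  linarith

/-- Markov's inequality for the number of visits to a finite family of sets. -/
theorem mul_measureReal_le_sum (η : Measure Ω) [IsFiniteMeasure η] (R : Finset ℕ) {A : ℕ → Set Ω}
    (hA : ∀ k, MeasurableSet (A k)) (t : ℝ) [∀ x, DecidablePred fun k ↦ x ∈ A k] :
    t * η.real {x | t ≤ ((R.filter fun k ↦ x ∈ A k).card : ℝ)} ≤ ∑ k ∈ R, η.real (A k) := by
  have heq : ∀ x, ((R.filter fun k ↦ x ∈ A k).card : ℝ) =
      ∑ k ∈ R, (A k).indicator (fun _ ↦ (1 : ℝ)) x := by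
    intro x
    rw [Finset.card_filter]
    push_cast
    refine Finset.sum_congr rfl fun k _ ↦ ?_
    by_cases h : x ∈ A k <;> simp [h]
  have hint : ∀ k ∈ R, Integrable ((A k).indicator fun _ ↦ (1 : ℝ)) η := fun k _ ↦
    (integrable_const 1).indicator (hA k)
  have := mul_meas_ge_le_integral_of_nonneg (μ := η)
    (f := fun x ↦ ∑ k ∈ R, (A k).indicator (fun _ ↦ (1 : ℝ)) x)
    (Eventually.of_forall fun x ↦ Finset.sum_nonneg fun k _ ↦
      indicator_nonneg (fun _ _ ↦ zero_le_one) x) (integrable_finsetSum _ hint) t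
  rw [integral_finsetSum _ hint] at this
  simp only [heq]
  refine this.trans (le_of_eq (Finset.sum_congr rfl fun k _ ↦ ?_))
  rw [integral_indicator_const _ (hA k)]
  simp

end Counting

/-! ### Existence of measures of large entropy -/

section Uniform

variable {Ω : Type*} [MeasurableSpace Ω]

/-- The uniform distribution on a finite set of points. -/
def uniformOn (S : Finset Ω) : Measure Ω :=
  (S.card : ℝ≥0∞)⁻¹ • ∑ x ∈ S, Measure.dirac x

theorem isProbabilityMeasure_uniformOn {S : Finset Ω} (hS : S.Nonempty) :
    IsProbabilityMeasure (uniformOn S) := by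
  constructor
  simp only [uniformOn, Measure.smul_apply, Measure.finsetSum_apply, Measure.dirac_apply_of_mem,
    mem_univ, Finset.sum_const, nsmul_eq_mul, mul_one, smul_eq_mul]
  exact ENNReal.inv_mul_cancel (by exact_mod_cast hS.card_pos.ne') (ENNReal.natCast_ne_top _)

theorem uniformOn_real (S : Finset Ω) {s : Set Ω} (hs : MeasurableSet s)
    [DecidablePred (· ∈ s)] :
    (uniformOn S).real s = ((S.filter (· ∈ s)).card : ℝ) / S.card := by
  rw [uniformOn, measureReal_ennreal_smul_apply, ENNReal.toReal_inv, ENNReal.toReal_natCast,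
    measureReal_def, Measure.finsetSum_apply, div_eq_inv_mul]
  congr 1
  simp only [Measure.dirac_apply' _ hs]
  rw [Finset.card_filter, ENNReal.toReal_sum (by
    intro x _
    by_cases h : x ∈ s <;> simp [h])]
  push_cast
  refine Finset.sum_congr rfl fun x _ ↦ ?_
  by_cases h : x ∈ s <;> simp [h]

theorem log_div_le_shannon_uniformOn {α : Type*} [Fintype α] [DecidableEq α] [MeasurableSpace α]
    [MeasurableSingletonClass α] {S : Finset Ω} (hS : S.Nonempty) {ξ : Ω → α}
    (hξ : Measurable ξ) {k : ℕ} (h : ∀ a, (S.filter (ξ · = a)).card ≤ k) :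
    Real.log (S.card / k) ≤ shannon (uniformOn S) ξ := by
  have := isProbabilityMeasure_uniformOn hS
  refine log_le_shannon _ hξ fun a ↦ ?_
  have hd : DecidablePred (· ∈ ξ ⁻¹' {a}) := fun x ↦ inferInstanceAs (Decidable (ξ x = a))
  rw [uniformOn_real S (hξ (measurableSet_singleton a)), inv_div]
  gcongr
  refine le_trans (le_of_eq ?_) (h a)
  congr 1
  ext x
  simp

theorem measurePreserving_uniformOn {T : Ω → Ω} (hT : Measurable T) {S : Finset Ω}
    (hS : BijOn T S S) : MeasurePreserving T (uniformOn S) (uniformOn S) := by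
  refine ⟨hT, ?_⟩
  rw [uniformOn, Measure.map_smul, Measure.map_finset_sum hT.aemeasurable]
  congr 1
  simp only [Measure.map_dirac' hT]
  exact Finset.sum_nbij T (fun x hx ↦ hS.mapsTo hx) hS.injOn hS.surjOn fun _ _ ↦ rfl

end Uniform

section Existence

variable {Ω : Type*} [TopologicalSpace Ω] [CompactSpace Ω] [T2Space Ω]
  [TotallyDisconnectedSpace Ω] [SecondCountableTopology Ω]
  [MeasurableSpace Ω] [BorelSpace Ω] {q : ℕ} {T : Ω → Ω} {P : Ω → Fin q}

/-- The uniform distribution on one representative per word of length `n` has join entropy `log #L_n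
≥ n h`. A weak limit of the time averages keeps the rate `h`. -/
theorem IsCoding.exists_large_entropy [Nonempty Ω] (hc : IsCoding T P) {h : ℝ}
    (hh : ∀ n : ℕ, n * h ≤ Real.log (level (words T P) n).card) :
    ∃ μ : ProbabilityMeasure Ω, MeasurePreserving T (μ : Measure Ω) (μ : Measure Ω) ∧
      ∀ m : ℕ, m * h ≤ shannon (μ : Measure Ω) (itin T P m) := by
  classical
  have hT := hc.continuous_map.measurable
  have hP := hc.continuous_code.measurable
  have hrep : ∀ n : ℕ, ∃ S : Finset Ω, S.Nonempty ∧
      S.card = (level (words T P) n).card ∧ InjOn (itin T P n) S := by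
    intro n
    choose! f hf using fun w (hw : w ∈ level (words T P) n) ↦
      exists_eq_word (mem_level.1 hw).1 (mem_level.1 hw).2
    have hinj : InjOn f (level (words T P) n) := by
      intro w hw w' hw' e
      rw [← hf w hw, ← hf w' hw', e]
    refine ⟨(level (words T P) n).image f, ?_, Finset.card_image_of_injOn hinj, ?_⟩
    · exact (Finset.card_pos.1 (card_level_words_pos T P n)).image f
    · intro x hx y hy e
      obtain ⟨w, hw, rfl⟩ := Finset.mem_image.1 hx
      obtain ⟨w', hw', rfl⟩ := Finset.mem_image.1 hy
      rw [← word_eq_word_iff, hf w hw, hf w' hw'] at e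
      rw [e]
  choose S hSne hScard hSinj using hrep
  let ν : ℕ → ProbabilityMeasure Ω := fun n ↦ ⟨uniformOn (S n), isProbabilityMeasure_uniformOn (hSne n)⟩
  have hent : ∀ n : ℕ, n * h ≤ shannon (ν n : Measure Ω) (itin T P n) := by
    intro n
    have := log_div_le_shannon_uniformOn (hSne n) (measurable_itin hT hP n) (k := 1) (fun a ↦ by
      rw [Finset.card_le_one]
      intro x hx y hy
      rw [Finset.mem_filter] at hx hy
      exact hSinj n hx.1 hy.1 (hx.2.trans hy.2.symm))
    rw [hScard, Nat.cast_one, div_one] at this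
    exact (hh n).trans this
  -- Lengths are shifted to `n + 1` so that every average is over a positive number of steps;
  -- compactness yields a limit along an ultrafilter.
  let ρ : ℕ → ProbabilityMeasure Ω := fun n ↦
    ⟨timeAverage T (n + 1) (ν (n + 1)), isProbabilityMeasure_timeAverage hT n.succ_ne_zero⟩
  let l : Ultrafilter ℕ := Ultrafilter.of atTop
  obtain ⟨μ, hμ⟩ : ∃ μ, Tendsto ρ l (𝓝 μ) := by
    obtain ⟨μ, -, hμ⟩ := isCompact_univ.ultrafilter_le_nhds (l.map ρ) (by simp)
    exact ⟨μ, hμ⟩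
  refine ⟨μ, hc.of_tendsto_timeAverage (l := (l : Filter ℕ)) (N := fun n ↦ n + 1)
    (ν := fun n ↦ ν (n + 1)) ((tendsto_add_atTop_nat 1).mono_left (Ultrafilter.of_le _))
    (Eventually.of_forall fun n ↦ rfl) hμ fun ε hε ↦ Eventually.of_forall fun n ↦ ?_⟩
  refine le_trans ?_ (hent (n + 1))
  gcongr
  linarith

end Existence

/-! ### Uniqueness of measures of large entropy -/

section Difference

variable {Ω : Type*} [MeasurableSpace Ω]

/-- Pushing `μ ≤ (μ - ν) + ν` forward bounds `μ - ν` by its own image. The two have the same total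
mass, so they are equal. -/
theorem measurePreserving_sub {T : Ω → Ω} {μ ν : Measure Ω} [IsFiniteMeasure μ]
    [IsFiniteMeasure ν] (hμ : MeasurePreserving T μ μ) (hν : MeasurePreserving T ν ν) :
    MeasurePreserving T (μ - ν) (μ - ν) := by
  refine ⟨hμ.measurable, (Measure.eq_of_le_of_measure_univ_eq ?_ ?_).symm⟩
  · refine Measure.sub_le_of_le_add ?_
    calc μ = μ.map T := hμ.map_eq.symm
      _ ≤ (μ - ν + ν).map T :=
        Measure.map_mono (Measure.sub_le_iff_le_add.1 le_rfl) hμ.measurable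
      _ = (μ - ν).map T + ν := by rw [Measure.map_add _ _ hμ.measurable, hν.map_eq]
  · rw [Measure.map_apply hμ.measurable MeasurableSet.univ, preimage_univ]

theorem sub_ne_zero_of_ne {μ ν : Measure Ω} [IsProbabilityMeasure μ] [IsProbabilityMeasure ν]
    (h : μ ≠ ν) : μ - ν ≠ 0 := fun h0 ↦
  h (Measure.eq_of_le_of_isProbabilityMeasure (by
    have : μ ≤ μ - ν + ν := Measure.sub_le_iff_le_add.1 le_rfl
    rwa [h0, zero_add] at this))

theorem exists_sub_apply_eq_zero (μ ν : Measure Ω) [IsFiniteMeasure μ] [IsFiniteMeasure ν] :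
    ∃ s, MeasurableSet s ∧ (μ - ν) sᶜ = 0 ∧ (ν - μ) s = 0 := by
  obtain ⟨s, hs, h1, h2⟩ := hahn_decomposition μ ν
  refine ⟨s, hs, Measure.sub_apply_eq_zero_of_restrict_le_restrict ?_ hs.compl,
    Measure.sub_apply_eq_zero_of_restrict_le_restrict ?_ hs⟩
  · refine Measure.le_iff.2 fun t ht ↦ ?_
    rw [Measure.restrict_apply ht, Measure.restrict_apply ht]
    exact h2 _ (ht.inter hs.compl) inter_subset_right
  · refine Measure.le_iff.2 fun t ht ↦ ?_
    rw [Measure.restrict_apply ht, Measure.restrict_apply ht]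
    exact h1 _ (ht.inter hs) inter_subset_right

end Difference

theorem IsCoding.exists_determined_isClopen {Ω : Type*} [TopologicalSpace Ω] {q : ℕ} {T : Ω → Ω}
    {P : Ω → Fin q} (hc : IsCoding T P) {U : Set Ω} (hU : IsClopen U) :
    ∃ c m : ℕ, Function.Surjective T^[c] ∧
      ∀ x y, itin T P m x = itin T P m y → (T^[c] x ∈ U ↔ T^[c] y ∈ U) := by
  classical
  let Q : Ω → Fin 2 := fun x ↦ if x ∈ U then 1 else 0
  have hQ : Continuous Q := (IsLocallyConstant.iff_continuous _).1 (by
    rw [IsLocallyConstant.iff_eventually_eq]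
    intro x
    by_cases hx : x ∈ U
    · filter_upwards [hU.isOpen.mem_nhds hx] with y hy
      simp [Q, hx, hy]
    · filter_upwards [hU.compl.isOpen.mem_nhds hx] with y hy
      have hy : y ∉ U := hy
      simp [Q, hx, hy])
  obtain ⟨c, m, hs, hcm⟩ := hc.exists_determined 2 Q hQ
  refine ⟨c, m, hs, fun x y hxy ↦ ?_⟩
  have := hcm x y hxy
  by_cases h1 : T^[c] x ∈ U <;> by_cases h2 : T^[c] y ∈ U <;> simp_all [Q]

/-! ### Separating singular invariant measures by words. -/

section Separation

variable {Ω : Type*} [TopologicalSpace Ω] [CompactSpace Ω] [T2Space Ω]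
  [TotallyDisconnectedSpace Ω] [SecondCountableTopology Ω]
  [MeasurableSpace Ω] [BorelSpace Ω] {q : ℕ} {T : Ω → Ω} {P : Ω → Fin q}

/-- Mutually singular invariant measures are almost separated by a set of words. -/
theorem IsCoding.exists_separating_words (hc : IsCoding T P) {η₁ η₂ : Measure Ω}
    [IsFiniteMeasure η₁] [IsFiniteMeasure η₂] (h₁ : MeasurePreserving T η₁ η₁)
    (h₂ : MeasurePreserving T η₂ η₂) {s : Set Ω} (hs : MeasurableSet s) (hs₁ : η₁ sᶜ = 0)
    (hs₂ : η₂ s = 0) {ε : ℝ} (hε : 0 < ε) :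
    ∃ (m : ℕ) (W : Set (List (Fin q))), η₁.real {x | word T P m x ∉ W} ≤ ε ∧
      η₂.real {x | word T P m x ∈ W} ≤ ε := by
  classical
  -- Approximating `s` with respect to the sum `η₁ + η₂` controls both errors at once.
  obtain ⟨U, hU, hUs⟩ := exists_isClopen_measure_symmDiff_lt (η₁ + η₂) hs
    (ENNReal.ofReal_pos.2 hε)
  rw [Measure.add_apply] at hUs
  have b₁ : η₁ Uᶜ ≤ ENNReal.ofReal ε := by
    have : Uᶜ ⊆ symmDiff U s ∪ sᶜ := fun x hx ↦ by
      by_cases hxs : x ∈ s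
      · exact Or.inl (Or.inr ⟨hxs, hx⟩)
      · exact Or.inr hxs
    calc η₁ Uᶜ ≤ η₁ (symmDiff U s) + η₁ sᶜ := (measure_mono this).trans (measure_union_le _ _)
      _ ≤ _ := by rw [hs₁, add_zero]; exact le_self_add.trans hUs.le
  have b₂ : η₂ U ≤ ENNReal.ofReal ε := by
    have : U ⊆ symmDiff U s ∪ s := fun x hx ↦ by
      by_cases hxs : x ∈ s
      · exact Or.inr hxs
      · exact Or.inl (Or.inl ⟨hx, hxs⟩)
    calc η₂ U ≤ η₂ (symmDiff U s) + η₂ s := (measure_mono this).trans (measure_union_le _ _)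
      _ ≤ _ := by rw [hs₂, add_zero]; exact le_add_self.trans hUs.le
  obtain ⟨c, m, -, hQU⟩ := hc.exists_determined_isClopen hU
  let W : Set (List (Fin q)) := {w | ∃ x, T^[c] x ∈ U ∧ word T P m x = w}
  have hW : ∀ x, word T P m x ∈ W ↔ T^[c] x ∈ U := fun x ↦
    ⟨fun ⟨y, hy, hyx⟩ ↦ (hQU y x ((word_eq_word_iff ..).1 hyx)).1 hy, fun hx ↦ ⟨x, hx, rfl⟩⟩
  refine ⟨m, W, ?_, ?_⟩
  · have e : {x | word T P m x ∉ W} = T^[c] ⁻¹' Uᶜ := by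
      ext x
      simp [hW]
    rw [e, measureReal_def,
      (h₁.iterate c).measure_preimage hU.compl.isOpen.measurableSet.nullMeasurableSet]
    exact ENNReal.toReal_le_of_le_ofReal hε.le b₁
  · have e : {x | word T P m x ∈ W} = T^[c] ⁻¹' U := by
      ext x
      simp [hW]
    rw [e, measureReal_def,
      (h₂.iterate c).measure_preimage hU.isOpen.measurableSet.nullMeasurableSet]
    exact ENNReal.toReal_le_of_le_ofReal hε.le b₂

theorem measurableSet_word (hc : IsCoding T P) (n : ℕ) (p : List (Fin q) → Prop) :
    MeasurableSet {x | p (word T P n x)} :=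
  (isClopen_itin_preimage hc n {a | p (List.ofFn a)}).isOpen.measurableSet

/-- Most words have few windows in a set of small measure. -/
theorem le_measure_few_windows (hc : IsCoding T P) {η : Measure Ω} [IsFiniteMeasure η]
    (hη : MeasurePreserving T η η) {m : ℕ} {V : Set (List (Fin q))} [DecidablePred (· ∈ V)]
    {ε : ℝ} (hV : η.real {x | word T P m x ∈ V} ≤ ε) (n : ℕ) {t : ℝ} (ht : 0 < t) {c : ℝ}
    (hct : (n + 1) * ε ≤ t * c) :
    η.real univ - c ≤ η.real {x | ((((Finset.range (n + 1 - m)).filter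
      fun k ↦ factorAt (word T P n x) k m ∈ V).card : ℕ) : ℝ) < t} := by
  have hε : 0 ≤ ε := measureReal_nonneg.trans hV
  have key := mul_measureReal_le_sum η (Finset.range (n + 1 - m))
    (A := fun k ↦ {x | factorAt (word T P n x) k m ∈ V})
    (fun k ↦ measurableSet_word hc n fun w ↦ factorAt w k m ∈ V) t
  have hsum : ∑ k ∈ Finset.range (n + 1 - m), η.real {x | factorAt (word T P n x) k m ∈ V} ≤
      (n + 1) * ε := by
    have : ∀ k ∈ Finset.range (n + 1 - m),
        η.real {x | factorAt (word T P n x) k m ∈ V} ≤ ε := by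
      intro k hk
      have hk := Finset.mem_range.1 hk
      simp only [factorAt_word T P (show k + m ≤ n by omega)]
      rw [show {x | word T P m (T^[k] x) ∈ V} = T^[k] ⁻¹' {x | word T P m x ∈ V} from rfl,
        measureReal_def, (hη.iterate k).measure_preimage
          (measurableSet_word hc m (· ∈ V)).nullMeasurableSet]
      exact hV
    refine (Finset.sum_le_sum this).trans ?_
    rw [Finset.sum_const, Finset.card_range, nsmul_eq_mul]
    gcongr
    have : n + 1 - m ≤ n + 1 := Nat.sub_le _ _
    exact_mod_cast this
  have h1 : η.real {x | t ≤ ((((Finset.range (n + 1 - m)).filter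
      fun k ↦ factorAt (word T P n x) k m ∈ V).card : ℕ) : ℝ)} ≤ c := by
    have := key.trans (hsum.trans hct)
    exact le_of_mul_le_mul_left this ht
  have h2 := measureReal_compl (μ := η) (measurableSet_word hc n fun w ↦ t ≤
    ((((Finset.range (n + 1 - m)).filter fun k ↦ factorAt w k m ∈ V).card : ℕ) : ℝ))
  have h3 : {x | t ≤ ((((Finset.range (n + 1 - m)).filter
      fun k ↦ factorAt (word T P n x) k m ∈ V).card : ℕ) : ℝ)}ᶜ = {x | ((((Finset.range
      (n + 1 - m)).filter fun k ↦ factorAt (word T P n x) k m ∈ V).card : ℕ) : ℝ) < t} := by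
    ext x
    simp
  rw [← h3, h2]
  linarith

end Separation

/-! ### Counting glued words by their place of transition. -/

section Gluing

variable {B : Type*}

/-- Any two words of `G` occur one after the other in a word of `L`, with gaps bounded by `d`. -/
def GluesWithin (L G : Set (List B)) (d : ℕ) : Prop :=
  ∀ y₁ ∈ G, ∀ y₂ ∈ G, ∃ z ∈ L, z.length = y₁.length + y₂.length + d ∧ ∃ a ≤ d, ∃ o ≤ d,
    factorAt z a y₁.length = y₁ ∧ factorAt z (y₁.length + o) y₂.length = y₂

/-- The number of windows of length `m` in `y` that belong to `V`. -/
def windowCount (V : Set (List B)) [DecidablePred (· ∈ V)] (m : ℕ) (y : List B) : ℕ :=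
  ((Finset.range (y.length + 1 - m)).filter fun k ↦ factorAt y k m ∈ V).card

/-- Windows of `z` inside an occurrence of `y` at `a` are windows of `y`, and translation by `a` is
injective. -/
theorem card_filter_factorAt_le {V : Set (List B)} [DecidablePred (· ∈ V)] {m a : ℕ}
    {y z : List B} (hy : factorAt z a y.length = y) {I : Finset ℕ}
    (hI : ∀ k ∈ I, a ≤ k ∧ k - a + m ≤ y.length) :
    (I.filter fun k ↦ factorAt z k m ∈ V).card ≤ windowCount V m y := by
  refine Finset.card_le_card_of_injOn (fun k ↦ k - a) (fun k hk ↦ ?_) fun k hk k' hk' e ↦ ?_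
  · obtain ⟨hkI, hk⟩ := Finset.mem_filter.1 hk
    obtain ⟨h1, h2⟩ := hI k hkI
    have e : factorAt y (k - a) m = factorAt z k m := by
      conv_lhs => rw [← hy]
      rw [factorAt_factorAt _ h2, Nat.add_sub_cancel' h1]
    simp only [Finset.coe_filter, Finset.mem_range, mem_ofPred_eq, e]
    exact ⟨by omega, hk⟩
  · have h1 := (hI k (Finset.mem_filter.1 hk).1).1
    have h2 := (hI k' (Finset.mem_filter.1 hk').1).1
    simp only at e
    omega

/-- Words that glue a word mostly made of windows in `W` to a word mostly made of windows outside
`W` determine the place of the transition. -/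
theorem sum_card_mul_card_le [Finite B] {L G : Set (List B)} {d : ℕ} (hG : GluesWithin L G d)
    {m : ℕ} {W : Set (List B)} [DecidablePred (· ∈ W)] [DecidablePred (· ∈ Wᶜ)] {K l : ℕ}
    (hl : 2 * (m + d) ≤ l) {E F : ℕ → Finset (List B)}
    (hE : ∀ j < K, ∀ y ∈ E j, y ∈ G ∧ y.length = j * l ∧ 4 * windowCount Wᶜ m y < l)
    (hF : ∀ j < K, ∀ y ∈ F j, y ∈ G ∧ y.length = (K - j) * l ∧ 4 * windowCount W m y < l) :
    ∑ j ∈ Finset.range K, (E j).card * (F j).card ≤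
      (level L (K * l + d)).card * ((d + 1) * (d + 1)) := by
  classical
  choose! z hzL hzlen a had o hod hz1 hz2 using hG
  -- If one `z` arose from `j < j'`, the windows starting in `I` would lie both in the second word
  -- for `j` and in the first word for `j'`. Fewer than `l / 4` of them would be in `W` and fewer
  -- than `l / 4` outside it, whereas `I` has more than `l / 2` elements because `2 * (m + d) ≤ l`.
  -- Starting `I` at `j * l + d` clears all offsets `a, o ≤ d`.
  have hsep : ∀ j j' : ℕ, j < j' → j' < K → ∀ y₁ ∈ E j, ∀ y₂ ∈ F j, ∀ y₁' ∈ E j', ∀ y₂' ∈ F j',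
      z y₁ y₂ = z y₁' y₂' → False := by
    intro j j' hjj' hj' y₁ h1 y₂ h2 y₁' h1' y₂' h2' e
    have hj : j < K := hjj'.trans hj'
    obtain ⟨g1, l1, -⟩ := hE j hj y₁ h1
    obtain ⟨g2, l2, c2⟩ := hF j hj y₂ h2
    obtain ⟨g1', l1', c1'⟩ := hE j' hj' y₁' h1'
    obtain ⟨g2', l2', -⟩ := hF j' hj' y₂' h2'
    set I := Finset.Ico (j * l + d) ((j + 1) * l + 1 - m)
    have m1 : (j + 1) * l = j * l + l := Nat.succ_mul j l
    have m2 : (j + 1) * l ≤ j' * l := Nat.mul_le_mul_right l hjj'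
    have m3 : 1 * l ≤ (K - j) * l := Nat.mul_le_mul_right l (by omega)
    have ha := had y₁' g1' y₂' g2'
    have ho := hod y₁ g1 y₂ g2
    have hI1 := card_filter_factorAt_le (V := Wᶜ) (m := m) (hz1 y₁' g1' y₂' g2') (I := I)
      (fun k hk ↦ by
        have := Finset.mem_Ico.1 hk
        omega)
    have hI2 := card_filter_factorAt_le (V := W) (m := m) (hz2 y₁ g1 y₂ g2) (I := I)
      (fun k hk ↦ by
        have := Finset.mem_Ico.1 hk
        omega)
    have hcard := Finset.card_filter_add_card_filter_not (s := I) (fun k ↦ factorAt (z y₁ y₂) k m ∈ W)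
    have hI3 : (I.filter fun k ↦ ¬ factorAt (z y₁ y₂) k m ∈ W).card =
        (I.filter fun k ↦ factorAt (z y₁' y₂') k m ∈ Wᶜ).card := by
      congr 1
      ext k
      rw [← e]
      simp
    have hIc : I.card = (j + 1) * l + 1 - m - (j * l + d) := Nat.card_Ico _ _
    rw [hI3] at hcard
    omega
  have hDcard : ((Finset.range K).sigma fun j ↦ E j ×ˢ F j).card =
      ∑ j ∈ Finset.range K, (E j).card * (F j).card := by
    rw [Finset.card_sigma]
    simp only [Finset.card_product]
  have hTcard : (level L (K * l + d) ×ˢ (Finset.range (d + 1) ×ˢ Finset.range (d + 1))).card =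
      (level L (K * l + d)).card * ((d + 1) * (d + 1)) := by
    simp only [Finset.card_product, Finset.card_range]
  rw [← hDcard, ← hTcard]
  -- The word `z` determines `j`, hence both lengths; the offsets then locate the two words inside
  -- `z`.
  refine Finset.card_le_card_of_injOn
    (fun p ↦ (z p.2.1 p.2.2, a p.2.1 p.2.2, o p.2.1 p.2.2)) ?_ ?_
  · rintro ⟨j, y₁, y₂⟩ hp
    simp only [Finset.coe_sigma, Finset.coe_range, mem_sigma_iff, mem_Iio, Finset.coe_product,
      mem_prod, Finset.mem_coe] at hp
    obtain ⟨hj, h1, h2⟩ := hp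
    obtain ⟨g1, l1, -⟩ := hE j hj y₁ h1
    obtain ⟨g2, l2, -⟩ := hF j hj y₂ h2
    have hlen : j * l + (K - j) * l = K * l := by
      rw [← Nat.add_mul, Nat.add_sub_cancel' hj.le]
    simp only [Finset.coe_product, mem_prod, Finset.mem_coe, mem_level, Finset.mem_range]
    refine ⟨⟨hzL y₁ g1 y₂ g2, ?_⟩, ?_, ?_⟩
    · rw [hzlen y₁ g1 y₂ g2, l1, l2, hlen]
    · exact Nat.lt_succ_of_le (had y₁ g1 y₂ g2)
    · exact Nat.lt_succ_of_le (hod y₁ g1 y₂ g2)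
  · rintro ⟨j, y₁, y₂⟩ hp ⟨j', y₁', y₂'⟩ hp' e
    simp only [Finset.coe_sigma, Finset.coe_range, mem_sigma_iff, mem_Iio, Finset.coe_product,
      mem_prod, Finset.mem_coe] at hp hp'
    obtain ⟨hj, h1, h2⟩ := hp
    obtain ⟨hj', h1', h2'⟩ := hp'
    simp only [Prod.mk.injEq] at e
    obtain ⟨ez, ea, eo⟩ := e
    obtain rfl : j = j' := by
      rcases lt_trichotomy j j' with h | h | h
      · exact (hsep j j' h hj' y₁ h1 y₂ h2 y₁' h1' y₂' h2' ez).elim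
      · exact h
      · exact (hsep j' j h hj y₁' h1' y₂' h2' y₁ h1 y₂ h2 ez.symm).elim
    obtain ⟨g1, l1, -⟩ := hE j hj y₁ h1
    obtain ⟨g2, l2, -⟩ := hF j hj y₂ h2
    obtain ⟨g1', l1', -⟩ := hE j hj y₁' h1'
    obtain ⟨g2', l2', -⟩ := hF j hj y₂' h2'
    have e1 : y₁ = y₁' := by
      rw [← hz1 y₁ g1 y₂ g2, ← hz1 y₁' g1' y₂' g2', ez, ea, l1, l1']
    have e2 : y₂ = y₂' := by
      rw [← hz2 y₁ g1 y₂ g2, ← hz2 y₁' g1' y₂' g2', ez, eo, l1, l1', l2, l2']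
    rw [e1, e2]

end Gluing

/-! ### Uniqueness from gluing. -/

section Uniqueness

variable {Ω : Type*} [TopologicalSpace Ω] [CompactSpace Ω] [T2Space Ω]
  [TotallyDisconnectedSpace Ω] [SecondCountableTopology Ω]
  [MeasurableSpace Ω] [BorelSpace Ω] {q : ℕ} {T : Ω → Ω} {P : Ω → Fin q}

/-- By Markov's inequality, words with few windows in `V` carry `η`-mass, hence `μ`-mass, at least
`c / 2`. The entropy of `μ` makes them at least `γ exp (n h)` in number, and discarding those
outside `G` loses at most half of that. -/
theorem le_card_filter_windowCount (hc : IsCoding T P) {h γ c ε : ℝ} {η μ : Measure Ω}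
    [IsProbabilityMeasure μ] (hημ : η ≤ μ) (hη : MeasurePreserving T η η)
    (hμ : ∀ n : ℕ, n * h ≤ shannon μ (itin T P n)) (hcη : c ≤ η.real univ)
    (hγ : ∀ (μ : Measure Ω) [IsProbabilityMeasure μ] (n : ℕ) (E : Finset (List (Fin q))),
      n * h ≤ shannon μ (itin T P n) → (∀ w ∈ E, w.length = n) →
      c / 2 ≤ μ.real {x | word T P n x ∈ E} → γ * Real.exp (n * h) ≤ E.card)
    {G : Set (List (Fin q))} [DecidablePred (· ∈ G)]
    (hG : ∀ n : ℕ, (level (words T P \ G) n).card ≤ γ / 2 * Real.exp (n * h))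
    {V : Set (List (Fin q))} [DecidablePred (· ∈ V)] {m : ℕ}
    (hV : η.real {x | word T P m x ∈ V} ≤ ε) {n l : ℕ} (hl : 0 < l)
    (hn : (n + 1) * ε ≤ l / 4 * (c / 2)) :
    γ / 2 * Real.exp (n * h) ≤
      ((level (words T P) n).filter fun y ↦ y ∈ G ∧ 4 * windowCount V m y < l).card := by
  have hfin : IsFiniteMeasure η := isFiniteMeasure_of_le μ hημ
  set E₀ := (level (words T P) n).filter fun y ↦ 4 * windowCount V m y < l with hE₀
  have h1 := le_measure_few_windows hc hη hV n (t := l / 4) (by positivity) hn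
  have hset : {x | ((((Finset.range (n + 1 - m)).filter
      fun k ↦ factorAt (word T P n x) k m ∈ V).card : ℕ) : ℝ) < (l : ℝ) / 4} ⊆
      {x | word T P n x ∈ E₀} := by
    intro x hx
    simp only [mem_ofPred_eq] at hx
    change word T P n x ∈ E₀
    rw [hE₀, Finset.mem_filter, mem_level, windowCount, length_word]
    refine ⟨⟨word_mem_words .., rfl⟩, ?_⟩
    rw [lt_div_iff₀ (by norm_num)] at hx
    have : (((Finset.range (n + 1 - m)).filter
      fun k ↦ factorAt (word T P n x) k m ∈ V).card : ℕ) * 4 < l := by exact_mod_cast hx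
    omega
  have h2 : c / 2 ≤ μ.real {x | word T P n x ∈ E₀} := by
    have e1 : η.real {x | word T P n x ∈ E₀} ≤ μ.real {x | word T P n x ∈ E₀} :=
      ENNReal.toReal_mono (measure_ne_top _ _) (hημ _)
    have e2 := measureReal_mono (μ := η) hset
    linarith
  have h3 := hγ μ n E₀ (hμ n) (fun w hw ↦ (mem_level.1 (Finset.mem_filter.1 hw).1).2) h2
  have h4 : E₀ ⊆ ((level (words T P) n).filter fun y ↦ y ∈ G ∧ 4 * windowCount V m y < l) ∪
      level (words T P \ G) n := by
    intro y hy
    simp only [hE₀, Finset.mem_filter, mem_level] at hy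
    simp only [Finset.mem_union, Finset.mem_filter, mem_level, Set.mem_sdiff]
    tauto
  have h5 := (Finset.card_le_card h4).trans (Finset.card_union_le _ _)
  have h6 : (E₀.card : ℝ) ≤
      ((level (words T P) n).filter fun y ↦ y ∈ G ∧ 4 * windowCount V m y < l).card +
        (level (words T P \ G) n).card := by exact_mod_cast h5
  have h7 := hG n
  linarith

/-- If most words can be glued with bounded gaps, there is at most one measure of large entropy. -/
theorem IsCoding.eq_of_gluesWithin (hc : IsCoding T P) {h C : ℝ}
    (hC : ∀ n : ℕ, (level (words T P) n).card ≤ C * Real.exp (n * h))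
    (hglue : ∀ ε > 0, ∃ (G : Set (List (Fin q))) (d : ℕ),
      (∀ n : ℕ, (level (words T P \ G) n).card ≤ ε * Real.exp (n * h)) ∧
        GluesWithin (words T P) G d)
    {μ ν : Measure Ω} [IsProbabilityMeasure μ] [IsProbabilityMeasure ν]
    (hμ : MeasurePreserving T μ μ) (hν : MeasurePreserving T ν ν)
    (hμh : ∀ n : ℕ, n * h ≤ shannon μ (itin T P n))
    (hνh : ∀ n : ℕ, n * h ≤ shannon ν (itin T P n)) : μ = ν := by
  classical
  by_contra hne
  -- These are the two parts of the Jordan decomposition: invariant, nonzero and carried by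
  -- complementary sets.
  set η₁ := μ - ν
  set η₂ := ν - μ
  have i₁ : MeasurePreserving T η₁ η₁ := measurePreserving_sub hμ hν
  have i₂ : MeasurePreserving T η₂ η₂ := measurePreserving_sub hν hμ
  have n₁ : NeZero η₁ := ⟨sub_ne_zero_of_ne hne⟩
  have n₂ : NeZero η₂ := ⟨sub_ne_zero_of_ne (Ne.symm hne)⟩
  have p₁ : 0 < η₁.real univ := measureReal_univ_pos
  have p₂ : 0 < η₂.real univ := measureReal_univ_pos
  obtain ⟨s, hs, hs₁, hs₂⟩ := exists_sub_apply_eq_zero μ ν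
  set c := min (η₁.real univ) (η₂.real univ)
  have hc0 : 0 < c := lt_min p₁ p₂
  obtain ⟨γ, hγ0, hγ⟩ := le_card_of_le_measure hc.continuous_map.measurable
    hc.continuous_code.measurable (half_pos hc0) hC
  obtain ⟨G, d, hG, hGd⟩ := hglue (γ / 2) (half_pos hγ0)
  -- There are at most `A exp (K l h)` triples of a glued word and two offsets, against at least `K
  -- (γ / 2)² exp (K l h)` pairs. Since `A` depends on neither `m` nor `l`, `K` can be fixed before
  -- `W` is chosen with an accuracy depending on `K`.
  set A := C * Real.exp (d * h) * ((d + 1) * (d + 1))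
  obtain ⟨K, hK⟩ := exists_nat_gt (max (A / (γ / 2 * (γ / 2))) 0)
  have hK0 : (0 : ℝ) < K := (le_max_right _ _).trans_lt hK
  have hKA : A < K * (γ / 2 * (γ / 2)) :=
    (div_lt_iff₀ (by positivity)).1 ((le_max_left _ _).trans_lt hK)
  -- The accuracy `c / (16 * K)` is what Markov's inequality requires for all lengths up to `K * l`,
  -- using `n + 1 ≤ 2 * (K * l)`.
  obtain ⟨m, W, hW₁, hW₂⟩ := hc.exists_separating_words i₁ i₂ hs hs₁ hs₂
    (ε := c / (16 * K)) (by positivity)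
  set l := 2 * (m + d) + 1 with hl
  have hKn : 0 < K := by exact_mod_cast hK0
  have hbound : ∀ n : ℕ, n ≤ K * l → ((n : ℝ) + 1) * (c / (16 * K)) ≤ l / 4 * (c / 2) := by
    intro n hn
    have h1 : n + 1 ≤ 2 * (K * l) := by
      have : 1 ≤ K * l := Nat.mul_pos hKn (by omega)
      omega
    have h2 : ((n : ℝ) + 1) ≤ 2 * (K * l) := by exact_mod_cast h1
    calc ((n : ℝ) + 1) * (c / (16 * K)) ≤ 2 * (K * l) * (c / (16 * K)) := by gcongr
      _ = l / 4 * (c / 2) := by field_simp; ring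
  let E : ℕ → Finset (List (Fin q)) := fun j ↦
    (level (words T P) (j * l)).filter fun y ↦ y ∈ G ∧ 4 * windowCount Wᶜ m y < l
  let F : ℕ → Finset (List (Fin q)) := fun j ↦
    (level (words T P) ((K - j) * l)).filter fun y ↦ y ∈ G ∧ 4 * windowCount W m y < l
  have hEc : ∀ j < K, γ / 2 * Real.exp ((j * l : ℕ) * h) ≤ (E j).card := fun j hj ↦
    le_card_filter_windowCount hc Measure.sub_le i₁ hμh (min_le_left _ _) hγ hG (V := Wᶜ) hW₁
      (by omega) (hbound _ (Nat.mul_le_mul_right l hj.le))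
  have hFc : ∀ j < K, γ / 2 * Real.exp (((K - j) * l : ℕ) * h) ≤ (F j).card := fun j hj ↦
    le_card_filter_windowCount hc Measure.sub_le i₂ hνh (min_le_right _ _) hγ hG (V := W) hW₂
      (by omega) (hbound _ (Nat.mul_le_mul_right l (Nat.sub_le K j)))
  have key := sum_card_mul_card_le hGd (m := m) (W := W) (K := K) (l := l) (by omega)
    (E := E) (F := F)
    (fun j _ y hy ↦ ⟨(Finset.mem_filter.1 hy).2.1, (mem_level.1 (Finset.mem_filter.1 hy).1).2,
      (Finset.mem_filter.1 hy).2.2⟩)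
    (fun j _ y hy ↦ ⟨(Finset.mem_filter.1 hy).2.1, (mem_level.1 (Finset.mem_filter.1 hy).1).2,
      (Finset.mem_filter.1 hy).2.2⟩)
  have hlow : ∀ j ∈ Finset.range K, γ / 2 * (γ / 2) * Real.exp ((K * l : ℕ) * h) ≤
      ((E j).card * (F j).card : ℝ) := by
    intro j hj
    have hj := Finset.mem_range.1 hj
    have hlen : j * l + (K - j) * l = K * l := by
      rw [← Nat.add_mul, Nat.add_sub_cancel' hj.le]
    calc γ / 2 * (γ / 2) * Real.exp ((K * l : ℕ) * h)
        = γ / 2 * Real.exp ((j * l : ℕ) * h) * (γ / 2 * Real.exp (((K - j) * l : ℕ) * h)) := by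
          rw [← hlen, Nat.cast_add, add_mul, Real.exp_add]
          ring
      _ ≤ _ := mul_le_mul (hEc j hj) (hFc j hj) (by positivity) (by positivity)
  have hsum := Finset.sum_le_sum hlow
  rw [Finset.sum_const, Finset.card_range, nsmul_eq_mul] at hsum
  have key' : (∑ j ∈ Finset.range K, ((E j).card * (F j).card : ℝ)) ≤
      (level (words T P) (K * l + d)).card * ((d + 1) * (d + 1)) := by exact_mod_cast key
  have hfinal : K * (γ / 2 * (γ / 2) * Real.exp ((K * l : ℕ) * h)) ≤
      A * Real.exp ((K * l : ℕ) * h) := by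
    refine (hsum.trans key').trans ?_
    calc ((level (words T P) (K * l + d)).card : ℝ) * ((d + 1) * (d + 1))
        ≤ C * Real.exp ((K * l + d : ℕ) * h) * ((d + 1) * (d + 1)) := by
          gcongr
          exact hC _
      _ = _ := by
          rw [Nat.cast_add, add_mul, Real.exp_add]
          simp only [A]
          ring
  rw [← mul_assoc] at hfinal
  exact absurd (le_of_mul_le_mul_right hfinal (Real.exp_pos _)) (not_le.2 hKA)

end Uniqueness

/-! ### Sliding block codes on words -/

section Slide

variable {A B : Type*} (R : ℕ) (φ : List A → B)

/-- The sliding block code with window length `R + 1`. -/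
def slide (w : List A) : List B :=
  (List.range (w.length - R)).map fun i ↦ φ (factorAt w i (R + 1))

@[simp]
theorem length_slide (w : List A) : (slide R φ w).length = w.length - R := by
  simp [slide]

theorem getElem_slide (w : List A) {i : ℕ} (hi : i < (slide R φ w).length) :
    (slide R φ w)[i] = φ (factorAt w i (R + 1)) := by
  simp [slide]

theorem factorAt_slide (w : List A) {k n : ℕ} (h : k + n ≤ w.length) :
    factorAt (slide R φ w) k (n - R) = slide R φ (factorAt w k n) := by
  refine List.ext_getElem ?_ fun i h1 h2 ↦ ?_
  · simp only [factorAt, List.length_take, List.length_drop, length_slide]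
    omega
  · have h3 : i < n - R := by
      simp only [factorAt, List.length_take] at h1
      omega
    rw [getElem_slide, factorAt_factorAt _ (by omega)]
    simp only [factorAt, List.getElem_take, List.getElem_drop]
    rw [getElem_slide]
    rfl

theorem slide_of_length_le {w : List A} (h : w.length ≤ R) : slide R φ w = [] :=
  List.eq_nil_of_length_eq_zero (by simp [h])

/-- A window starting in `u` reaches at most `R` letters into `v`. -/
theorem slide_append (u v : List A) :
    slide R φ (u ++ v) = slide R φ (u ++ v.take R) ++ slide R φ v := by
  refine List.ext_getElem ?_ fun i h1 h2 ↦ ?_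
  · simp only [length_slide, List.length_append, List.length_take]
    omega
  · simp only [length_slide, List.length_append] at h1
    rw [getElem_slide, List.getElem_append]
    split_ifs with h3
    · rw [getElem_slide]
      congr 1
      simp only [length_slide, List.length_append, List.length_take] at h3
      have : u ++ v.take R = factorAt (u ++ v) 0 (u.length + R) := by
        simp [factorAt, List.take_append]
      rw [this, factorAt, factorAt, factorAt]
      simp only [List.drop_zero, List.drop_take, List.take_take]
      congr 1
      omega
    · rw [getElem_slide]
      congr 1
      simp only [length_slide, List.length_append, List.length_take, not_lt] at h3
      have e : i - (slide R φ (u ++ v.take R)).length = i - u.length := by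
        simp only [length_slide, List.length_append, List.length_take]
        omega
      rw [e, factorAt, factorAt, List.drop_append, List.drop_of_length_le (by omega),
        List.nil_append]

/-- Given `u` and `w`, the image of `u ++ v ++ w` depends on `v` only through its image and two
words of at most `R` letters. So images of core words can be counted instead of the core words
themselves. -/
theorem slide_append_append (u v w : List A) :
    slide R φ (u ++ v ++ w) = slide R φ (u ++ (v ++ w).take R) ++ slide R φ v ++
      slide R φ (v.drop (v.length - R) ++ w) := by
  have h : slide R φ (v ++ w) = slide R φ v ++ slide R φ (v.drop (v.length - R) ++ w) := by
    rcases le_total v.length R with hv | hv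
    · rw [slide_of_length_le R φ hv, Nat.sub_eq_zero_of_le hv]
      simp
    · have hl : (v.drop (v.length - R)).length = R := by
        simp
        omega
      conv_lhs => rw [← List.take_append_drop (v.length - R) v, List.append_assoc, slide_append]
      rw [List.take_append_of_le_length hl.ge, List.take_of_length_le hl.le,
        List.take_append_drop]
  rw [List.append_assoc, slide_append, h, List.append_assoc]

end Slide

/-! ### Counting images of words under specification -/

section Glue

variable {A : Type*}

theorem length_glue {w v : ℕ → List A} {j t m : ℕ} (hw : ∀ i ≤ m, (w i).length = j)
    (hv : ∀ i < m, (v i).length = t) : (glue w v m).length = m * (j + t) + j := by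
  induction m with
  | zero => simpa [glue] using hw 0 le_rfl
  | succ m ih =>
    rw [glue, List.length_append, List.length_append, hw _ le_rfl, hv _ m.lt_succ_self,
      ih (fun i hi ↦ hw i (by omega)) (fun i hi ↦ hv i (by omega))]
    ring

theorem factorAt_append_of_le {x y : List A} {k n : ℕ} (h : k + n ≤ x.length) :
    factorAt (x ++ y) k n = factorAt x k n := by
  rw [factorAt, factorAt, List.drop_append_of_le_length (by omega),
    List.take_append_of_le_length (by simp; omega)]

theorem factorAt_append_append (x y z : List A) :
    factorAt (x ++ y ++ z) x.length y.length = y := by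
  simp [factorAt]

theorem factorAt_glue {w v : ℕ → List A} {j t m : ℕ} (hw : ∀ i ≤ m, (w i).length = j)
    (hv : ∀ i < m, (v i).length = t) {i : ℕ} (hi : i ≤ m) :
    factorAt (glue w v m) (i * (j + t)) j = w i := by
  induction m with
  | zero =>
    obtain rfl : i = 0 := by omega
    simp [glue, factorAt, hw 0 le_rfl]
  | succ m ih =>
    have hlen := length_glue (m := m) (w := w) (v := v) (fun i hi ↦ hw i (by omega))
      (fun i hi ↦ hv i (by omega))
    rcases hi.eq_or_lt with rfl | hi
    · have h1 : (glue w v m ++ v m).length = (m + 1) * (j + t) := by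
        rw [List.length_append, hlen, hv _ m.lt_succ_self]
        ring
      have := factorAt_append_append (glue w v m ++ v m) (w (m + 1)) []
      rwa [List.append_nil, h1, hw _ le_rfl] at this
    · have : i * (j + t) ≤ m * (j + t) := Nat.mul_le_mul_right _ (by omega)
      rw [glue, List.append_assoc, factorAt_append_of_le (by omega)]
      exact ih (fun i hi ↦ hw i (by omega)) (fun i hi ↦ hv i (by omega)) (by omega)

end Glue

/-! ### Counting and gluing words of the factor. -/

section Counting

variable {A B : Type*} {R : ℕ} {φ : List A → B} {L : Set (List A)}
  {M : Set (List B)}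

/-- The words of `M` are the images of the words of `L` under a sliding block code, and they can be
extended to the right. -/
structure IsSlideImage (R : ℕ) (φ : List A → B) (L : Set (List A)) (M : Set (List B)) : Prop where
  slide_mem : ∀ x ∈ L, slide R φ x ∈ M
  exists_lift : ∀ y ∈ M, ∃ x ∈ L, x.length = y.length + R ∧ slide R φ x = y
  exists_extension : ∀ y ∈ M, ∀ n, y.length ≤ n → ∃ z ∈ M, z.length = n ∧
    factorAt z 0 y.length = y

/-- The alternative `n = 0` serves words of length at most `R`, whose images are empty. -/
theorem factorAt_of_extension {y z : List B} (hz : factorAt z 0 y.length = y) {k n : ℕ}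
    (h : k + n ≤ y.length ∨ n = 0) : factorAt y k n = factorAt z k n := by
  rcases h with h | rfl
  · conv_lhs => rw [← hz]
    rw [factorAt_factorAt _ h, zero_add]
  · simp [factorAt]

variable [Finite A] [Finite B]

-- Fix a lift in `G` for each image. Any `m + 1` lifts can be glued with gaps `t`, and the chosen
-- images reappear at the places `i * (j + t)` of the glued image, so distinct choices give distinct
-- words. Extending to the right only normalises the length.
open Classical in
theorem card_image_slide_pow_le (hM : IsSlideImage R φ L M) {G : Set (List A)} {t : ℕ}
    (hspec : SSpecification L G t) (j m : ℕ) :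
    ((level G j).image (slide R φ)).card ^ (m + 1) ≤ (level M ((m + 1) * (j + t))).card := by
  set S := (level G j).image (slide R φ) with hS
  have hlift : ∀ s : S, ∃ x, x ∈ G ∧ x.length = j ∧ slide R φ x = s := by
    rintro ⟨s, hs⟩
    obtain ⟨x, hx, rfl⟩ := Finset.mem_image.1 hs
    exact ⟨x, (mem_level.1 hx).1, (mem_level.1 hx).2, rfl⟩
  choose g hgG hgl hgs using hlift
  have hglue : ∀ c : Fin (m + 1) → S, ∃ z ∈ M, z.length = (m + 1) * (j + t) ∧
      ∀ i : Fin (m + 1), factorAt z (i * (j + t)) (j - R) = c i := by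
    intro c
    let w : ℕ → List A := fun i ↦ g (c (Fin.ofNat (m + 1) i))
    have hwl : ∀ i ≤ m, (w i).length = j := fun i _ ↦ hgl _
    obtain ⟨v, hv, hL⟩ := hspec m w (fun i _ ↦ hgG _)
    have hvl : ∀ i < m, (v i).length = t := fun i hi ↦ (hv i hi).2
    have hlen := length_glue hwl hvl
    have e0 : (m + 1) * (j + t) = m * (j + t) + j + t := by ring
    obtain ⟨z, hz, hzl, hzy⟩ := hM.exists_extension _ (hM.slide_mem _ hL) ((m + 1) * (j + t)) (by
      rw [length_slide, hlen, e0]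
      omega)
    refine ⟨z, hz, hzl, fun i ↦ ?_⟩
    have hi : (i : ℕ) ≤ m := by omega
    have hi' : (i : ℕ) * (j + t) ≤ m * (j + t) := Nat.mul_le_mul_right _ hi
    rw [← factorAt_of_extension hzy (by
      rw [length_slide, hlen]
      omega), factorAt_slide R φ _ (by omega), factorAt_glue hwl hvl hi]
    simp only [w, hgs]
    congr 2
    ext
    simp
  choose z hzM hzl hz using hglue
  have hcard : Fintype.card (Fin (m + 1) → S) = S.card ^ (m + 1) := by simp
  rw [← hcard, ← Finset.card_univ]
  refine Finset.card_le_card_of_injOn z (fun c _ ↦ mem_level.2 ⟨hzM c, hzl c⟩)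
    fun c _ c' _ e ↦ ?_
  funext i
  rw [Subtype.ext_iff, ← hz c i, ← hz c' i, e]

-- Take the `(m + 1)`-th root in `card_image_slide_pow_le` and let `m` grow.
open Classical in
theorem card_image_slide_le (hM : IsSlideImage R φ L M) {G : Set (List A)} {t : ℕ}
    (hspec : SSpecification L G t) {h : ℝ}
    (hup : ∀ ε > 0, ∀ᶠ n : ℕ in atTop, ((level M n).card : ℝ) ≤ Real.exp (n * (h + ε))) (j : ℕ) :
    (((level G j).image (slide R φ)).card : ℝ) ≤ Real.exp ((j + t : ℕ) * h) := by
  set S := (level G j).image (slide R φ) with hS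
  rcases Nat.eq_zero_or_pos S.card with h0 | h0
  · rw [h0]
    simpa using (Real.exp_pos _).le
  have h0' : 0 < (S.card : ℝ) := by exact_mod_cast h0
  -- If `j + t = 0` the lengths `(m + 1) * (j + t)` do not grow, but then the only possible image is
  -- the empty word.
  rcases Nat.eq_zero_or_pos (j + t) with hjt | hjt
  · have hj : j = 0 := by omega
    rw [hjt]
    simp only [Nat.cast_zero, zero_mul, Real.exp_zero]
    have : S.card ≤ 1 := by
      rw [Finset.card_le_one]
      intro a ha b hb
      obtain ⟨x, hx, rfl⟩ := Finset.mem_image.1 ha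
      obtain ⟨y, hy, rfl⟩ := Finset.mem_image.1 hb
      rw [slide_of_length_le R φ (by rw [(mem_level.1 hx).2]; omega),
        slide_of_length_le R φ (by rw [(mem_level.1 hy).2]; omega)]
    exact_mod_cast this
  have hjt' : 0 < ((j + t : ℕ) : ℝ) := by exact_mod_cast hjt
  rw [← Real.log_le_iff_le_exp h0']
  refine le_of_forall_pos_le_add fun ε hε ↦ ?_
  have hten : Tendsto (fun m : ℕ ↦ (m + 1) * (j + t)) atTop atTop :=
    (tendsto_add_atTop_nat 1).atTop_mul_const' hjt
  obtain ⟨m, hm⟩ := (hten.eventually (hup (ε / (j + t : ℕ)) (by positivity))).exists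
  have hpow : ((S.card : ℝ)) ^ (m + 1) ≤ (level M ((m + 1) * (j + t))).card := by
    exact_mod_cast card_image_slide_pow_le hM hspec j m
  have hlog := Real.log_le_log (by positivity) (hpow.trans hm)
  rw [Real.log_pow, Real.log_exp] at hlog
  have hm' : (0 : ℝ) < (m + 1 : ℕ) := by positivity
  refine le_of_mul_le_mul_left (hlog.trans (le_of_eq ?_)) hm'
  push_cast at hjt' ⊢
  field_simp

/-- Words of `M` with a lift whose prefix and suffix have lengths in `Z`. -/
def liftsWith (R : ℕ) (φ : List A → B) (Cp G Cs : Set (List A)) (Z : Set (ℕ × ℕ)) :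
    Set (List B) :=
  {y | ∃ u ∈ Cp, ∃ v ∈ G, ∃ w ∈ Cs, (u ++ v ++ w).length = y.length + R ∧
    slide R φ (u ++ v ++ w) = y ∧ (u.length, w.length) ∈ Z}

open Classical in
/-- The number of words with a lift whose prefix and suffix have lengths in `Z`. -/
theorem exists_card_liftsWith_le (hM : IsSlideImage R φ L M) {Cp G Cs : Set (List A)} {t : ℕ}
    (hspec : SSpecification L G t) {h a C₀ : ℝ}
    (hup : ∀ ε > 0, ∀ᶠ n : ℕ in atTop, ((level M n).card : ℝ) ≤ Real.exp (n * (h + ε)))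
    (hCs : ∀ n : ℕ, ((level (Cp ∪ Cs) n).card : ℝ) ≤ C₀ * Real.exp (n * a)) :
    ∃ K > 0, ∀ (Z : Set (ℕ × ℕ)) (n : ℕ),
      ((level (liftsWith R φ Cp G Cs Z) n).card : ℝ) ≤ K * Real.exp (n * h) *
        ∑ p ∈ (Finset.range (n + R + 1) ×ˢ Finset.range (n + R + 1)).filter (· ∈ Z),
          Real.exp (a - h) ^ p.1 * Real.exp (a - h) ^ p.2 := by
  have hC₀ : 0 ≤ C₀ := by
    have := (Nat.cast_nonneg (α := ℝ) _).trans (hCs 0)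
    simpa using this
  have hfin : {s : List A | s.length ≤ R}.Finite := List.finite_length_le A R
  set Sh := hfin.toFinset
  have hCp' : ∀ n : ℕ, ((level Cp n).card : ℝ) ≤ C₀ * Real.exp (n * a) := fun n ↦
    le_trans (by exact_mod_cast Finset.card_le_card (level_mono subset_union_left n)) (hCs n)
  have hCs' : ∀ n : ℕ, ((level Cs n).card : ℝ) ≤ C₀ * Real.exp (n * a) := fun n ↦
    le_trans (by exact_mod_cast Finset.card_le_card (level_mono subset_union_right n)) (hCs n)
  -- The factors count the two short connecting words, the constants for prefix and suffix, and the
  -- excess `R + t` in the exponent of the core bound.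
  set D : ℝ := (Sh.card * Sh.card : ℝ) * (C₀ * C₀) * Real.exp ((R + t : ℕ) * h)
  refine ⟨D + 1, by positivity, fun Z n ↦ ?_⟩
  let I := ((Finset.range (n + R + 1) ×ˢ Finset.range (n + R + 1)).filter (· ∈ Z)).filter
    fun p ↦ p.1 + p.2 ≤ n + R
  let dom : ℕ × ℕ → Finset ((List A × List A) × (List A × (List B × List A))) := fun p ↦
    (Sh ×ˢ Sh) ×ˢ (level Cp p.1 ×ˢ
      ((level G (n + R - p.1 - p.2)).image (slide R φ) ×ˢ level Cs p.2))
  let f : (List A × List A) × (List A × (List B × List A)) → List B := fun d ↦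
    slide R φ (d.2.1 ++ d.1.1) ++ d.2.2.1 ++ slide R φ (d.1.2 ++ d.2.2.2)
  -- A word is rebuilt by `f` from its prefix, the image of its core, its suffix and the two
  -- connecting words of `slide_append_append`.
  have hsub : level (liftsWith R φ Cp G Cs Z) n ⊆ I.biUnion fun p ↦ (dom p).image f := by
    intro y hy
    obtain ⟨⟨u, hu, v, hv, w, hw, hl, hs, hZ⟩, hyn⟩ := mem_level.1 hy
    rw [hyn] at hl
    simp only [List.length_append] at hl
    refine Finset.mem_biUnion.2 ⟨(u.length, w.length), ?_, ?_⟩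
    · simp only [I, Finset.mem_filter, Finset.mem_product, Finset.mem_range]
      exact ⟨⟨⟨by omega, by omega⟩, hZ⟩, by omega⟩
    · refine Finset.mem_image.2 ⟨(((v ++ w).take R, v.drop (v.length - R)),
        (u, (slide R φ v, w))), ?_, ?_⟩
      · simp only [dom, Finset.mem_product, mem_level, Finset.mem_image, Sh,
          Set.Finite.mem_toFinset]
        refine ⟨⟨?_, ?_⟩, ⟨hu, trivial⟩, ⟨v, ⟨hv, by omega⟩, rfl⟩, hw, trivial⟩
        · exact List.length_take_le _ _
        · change (v.drop (v.length - R)).length ≤ R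
          simp
          omega
      · simp only [f]
        rw [← slide_append_append, hs]
  have hterm : ∀ p ∈ I, (((dom p).image f).card : ℝ) ≤ D * Real.exp (n * h) *
      (Real.exp (a - h) ^ p.1 * Real.exp (a - h) ^ p.2) := by
    rintro ⟨i, k⟩ hp
    have hik : i + k ≤ n + R := (Finset.mem_filter.1 hp).2
    have h1 : (((dom (i, k)).image f).card : ℝ) ≤ (dom (i, k)).card := by
      exact_mod_cast Finset.card_image_le
    refine h1.trans ?_
    have h2 := card_image_slide_le hM hspec hup (n + R - i - k)
    have e : ((n + R - i - k + t : ℕ) : ℝ) = n + R - i - k + t := by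
      have : n + R - i - k + t + i + k = n + R + t := by omega
      have : ((n + R - i - k + t + i + k : ℕ) : ℝ) = ((n + R + t : ℕ) : ℝ) := by rw [this]
      push_cast at this ⊢
      linarith
    rw [e] at h2
    simp only [dom, Finset.card_product, Nat.cast_mul]
    calc (Sh.card * Sh.card : ℝ) * ((level Cp i).card *
          (((level G (n + R - i - k)).image (slide R φ)).card * (level Cs k).card))
        ≤ (Sh.card * Sh.card : ℝ) * ((C₀ * Real.exp (i * a)) *
          (Real.exp ((n + R - i - k + t) * h) * (C₀ * Real.exp (k * a)))) := by
          gcongr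
          · exact hCp' i
          · exact hCs' k
      _ = (Sh.card * Sh.card : ℝ) * (C₀ * C₀) * (Real.exp (i * a) *
          (Real.exp ((n + R - i - k + t) * h) * Real.exp (k * a))) := by ring
      _ = D * Real.exp (n * h) * (Real.exp (a - h) ^ i * Real.exp (a - h) ^ k) := by
          simp only [D, ← Real.exp_nat_mul, mul_assoc, ← Real.exp_add]
          congr 5
          push_cast
          ring
  calc ((level (liftsWith R φ Cp G Cs Z) n).card : ℝ)
      ≤ (I.biUnion fun p ↦ (dom p).image f).card := by
        exact_mod_cast Finset.card_le_card hsub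
    _ ≤ ∑ p ∈ I, (((dom p).image f).card : ℝ) := by exact_mod_cast Finset.card_biUnion_le
    _ ≤ ∑ p ∈ I, D * Real.exp (n * h) * (Real.exp (a - h) ^ p.1 * Real.exp (a - h) ^ p.2) :=
        Finset.sum_le_sum hterm
    _ ≤ ∑ p ∈ (Finset.range (n + R + 1) ×ˢ Finset.range (n + R + 1)).filter (· ∈ Z),
          D * Real.exp (n * h) * (Real.exp (a - h) ^ p.1 * Real.exp (a - h) ^ p.2) :=
        Finset.sum_le_sum_of_subset_of_nonneg (Finset.filter_subset _ _)
          fun _ _ _ ↦ by positivity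
    _ = D * Real.exp (n * h) * _ := by rw [← Finset.mul_sum]
    _ ≤ _ := by
        gcongr
        linarith

/-- The words with a lift in `G(N)`. -/
def goodWords (R : ℕ) (φ : List A → B) (L Cp G Cs : Set (List A)) (N : ℕ) : Set (List B) :=
  {y | ∃ x ∈ coreUpTo L Cp G Cs N, x.length = y.length + R ∧ slide R φ x = y}

theorem summable_exp_pow_mul {a h : ℝ} (hah : a < h) :
    Summable fun p : ℕ × ℕ ↦ Real.exp (a - h) ^ p.1 * Real.exp (a - h) ^ p.2 := by
  have h1 : Summable fun n : ℕ ↦ Real.exp (a - h) ^ n :=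
    summable_geometric_of_lt_one (Real.exp_pos _).le (by rw [Real.exp_lt_one_iff]; linarith)
  exact h1.mul_of_nonneg h1 (fun _ ↦ by positivity) (fun _ ↦ by positivity)

/-- Every word has some lift, and the sum over all prefix and suffix lengths is bounded by a
convergent series because `a < h`. -/
theorem exists_card_level_le (hM : IsSlideImage R φ L M) {Cp G Cs : Set (List A)}
    (hD : IsDecomposition L Cp G Cs) {t : ℕ}
    (hspec : SSpecification L G t) {h a C₀ : ℝ} (hah : a < h)
    (hup : ∀ ε > 0, ∀ᶠ n : ℕ in atTop, ((level M n).card : ℝ) ≤ Real.exp (n * (h + ε)))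
    (hCs : ∀ n : ℕ, ((level (Cp ∪ Cs) n).card : ℝ) ≤ C₀ * Real.exp (n * a)) :
    ∃ C : ℝ, ∀ n : ℕ, ((level M n).card : ℝ) ≤ C * Real.exp (n * h) := by
  obtain ⟨K, hK, hb⟩ := exists_card_liftsWith_le hM hspec hup hCs
  have hsum := summable_exp_pow_mul hah
  refine ⟨K * ∑' p : ℕ × ℕ, Real.exp (a - h) ^ p.1 * Real.exp (a - h) ^ p.2, fun n ↦ ?_⟩
  have hsub : level M n ⊆ level (liftsWith R φ Cp G Cs univ) n := by
    intro y hy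
    obtain ⟨hyM, hyn⟩ := mem_level.1 hy
    obtain ⟨x, hx, hxl, hxs⟩ := hM.exists_lift y hyM
    obtain ⟨u, hu, v, hv, w, hw, rfl⟩ := hD.exists_eq x hx
    exact mem_level.2 ⟨⟨u, hu, v, hv, w, hw, hxl, hxs, mem_univ _⟩, hyn⟩
  calc ((level M n).card : ℝ) ≤ (level (liftsWith R φ Cp G Cs univ) n).card := by
        exact_mod_cast Finset.card_le_card hsub
    _ ≤ _ := hb univ n
    _ ≤ K * Real.exp (n * h) * ∑' p : ℕ × ℕ, Real.exp (a - h) ^ p.1 * Real.exp (a - h) ^ p.2 := by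
        gcongr
        exact hsum.sum_le_tsum _ fun _ _ ↦ by positivity
    _ = _ := by ring

/-- A word that is not good has a lift whose prefix or suffix is longer than `N`. Such words are
counted by a tail of the convergent series. -/
theorem exists_card_sdiff_goodWords_le (hM : IsSlideImage R φ L M) {Cp G Cs : Set (List A)}
    (hD : IsDecomposition L Cp G Cs) {t : ℕ}
    (hspec : SSpecification L G t) {h a C₀ : ℝ} (hah : a < h)
    (hup : ∀ ε > 0, ∀ᶠ n : ℕ in atTop, ((level M n).card : ℝ) ≤ Real.exp (n * (h + ε)))
    (hCs : ∀ n : ℕ, ((level (Cp ∪ Cs) n).card : ℝ) ≤ C₀ * Real.exp (n * a)) {ε : ℝ}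
    (hε : 0 < ε) :
    ∃ N : ℕ, ∀ n : ℕ,
      ((level (M \ goodWords R φ L Cp G Cs N) n).card : ℝ) ≤ ε * Real.exp (n * h) := by
  classical
  obtain ⟨K, hK, hb⟩ := exists_card_liftsWith_le hM hspec hup hCs
  obtain ⟨s, hs⟩ := summable_iff_vanishing_norm.1 (summable_exp_pow_mul hah) (ε / K) (by positivity)
  refine ⟨s.sup (fun p ↦ max p.1 p.2), fun n ↦ ?_⟩
  set N := s.sup (fun p ↦ max p.1 p.2)
  have hsub : level (M \ goodWords R φ L Cp G Cs N) n ⊆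
      level (liftsWith R φ Cp G Cs {p | N < max p.1 p.2}) n := by
    intro y hy
    obtain ⟨⟨hyM, hyG⟩, hyn⟩ := mem_level.1 hy
    obtain ⟨x, hx, hxl, hxs⟩ := hM.exists_lift y hyM
    obtain ⟨u, hu, v, hv, w, hw, rfl⟩ := hD.exists_eq x hx
    refine mem_level.2 ⟨⟨u, hu, v, hv, w, hw, hxl, hxs, ?_⟩, hyn⟩
    change N < max u.length w.length
    by_contra hcon
    rw [not_lt, max_le_iff] at hcon
    exact hyG ⟨_, ⟨hx, u, hu, v, hv, w, hw, hcon.1, hcon.2, rfl⟩, hxl, hxs⟩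
  have hle : ∑ p ∈ (Finset.range (n + R + 1) ×ˢ Finset.range (n + R + 1)).filter
      (· ∈ {p : ℕ × ℕ | N < max p.1 p.2}),
      Real.exp (a - h) ^ p.1 * Real.exp (a - h) ^ p.2 ≤ ε / K := by
    refine (le_abs_self _).trans (hs _ ?_).le
    rw [Finset.disjoint_left]
    intro p hp hps
    have h1 : N < max p.1 p.2 := (Finset.mem_filter.1 hp).2
    exact absurd (Finset.le_sup (f := fun p : ℕ × ℕ ↦ max p.1 p.2) hps) (not_le.2 h1)
  calc ((level (M \ goodWords R φ L Cp G Cs N) n).card : ℝ)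
      ≤ (level (liftsWith R φ Cp G Cs {p | N < max p.1 p.2}) n).card := by
        exact_mod_cast Finset.card_le_card hsub
    _ ≤ _ := hb _ n
    _ ≤ K * Real.exp (n * h) * (ε / K) := by
        refine mul_le_mul_of_nonneg_left (le_trans (le_of_eq ?_) hle) (by positivity)
        congr! 1
        ext
        simp
    _ = _ := by field_simp

theorem exists_gluesWithin_goodWords (hM : IsSlideImage R φ L M) {Cp G Cs : Set (List A)} {t : ℕ}
    (hspec : SSpecification L G t) (hext : Extendable L Cp G Cs) (N : ℕ) :
    ∃ d, GluesWithin M (goodWords R φ L Cp G Cs N) d := by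
  obtain ⟨τ, hτ⟩ := hext N
  -- The gap consists of the `t` letters from specification, up to `τ` letters at each of the four
  -- ends extended by (III), and `R` because the image of `x₁` is `R` letters shorter than `x₁`.
  refine ⟨R + t + 4 * τ, ?_⟩
  rintro y₁ ⟨x₁, hx₁, hl₁, rfl⟩ y₂ ⟨x₂, hx₂, hl₂, rfl⟩
  obtain ⟨a, b, ha, hb, hG₁⟩ := hτ x₁ hx₁
  obtain ⟨a', b', ha', hb', hG₂⟩ := hτ x₂ hx₂
  obtain ⟨v, hv, hL⟩ := hspec 1 (fun i ↦ if i = 0 then a ++ x₁ ++ b else a' ++ x₂ ++ b')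
    (fun i _ ↦ by split_ifs <;> assumption)
  simp only [glue, if_true, zero_add, one_ne_zero, if_false] at hL
  have hv0 := (hv 0 one_pos).2
  rw [length_slide] at hl₁ hl₂
  set X := a ++ x₁ ++ b ++ v 0 ++ (a' ++ x₂ ++ b') with hX
  have hXl : X.length = a.length + x₁.length + b.length + t + (a'.length + x₂.length + b'.length) := by
    simp only [hX, List.length_append, hv0]
  obtain ⟨z, hzM, hzl, hz⟩ := hM.exists_extension _ (hM.slide_mem _ hL)
    ((x₁.length - R) + (x₂.length - R) + (R + t + 4 * τ)) (by
      rw [length_slide, hXl]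
      omega)
  have e1 : factorAt X a.length x₁.length = x₁ := by
    have := factorAt_append_append a x₁ (b ++ v 0 ++ (a' ++ x₂ ++ b'))
    simpa only [hX, List.append_assoc] using this
  have e2 : factorAt X (a.length + x₁.length + b.length + t + a'.length) x₂.length = x₂ := by
    have := factorAt_append_append (a ++ x₁ ++ b ++ v 0 ++ a') x₂ b'
    simpa only [hX, List.append_assoc, List.length_append, hv0, add_assoc] using this
  refine ⟨z, hzM, by simpa using hzl, a.length, by omega,
    R + a.length + b.length + t + a'.length, by omega, ?_, ?_⟩
  · rw [length_slide, ← factorAt_of_extension hz (by rw [length_slide]; omega),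
      factorAt_slide R φ _ (by omega), e1]
  · rw [length_slide, length_slide, ← factorAt_of_extension hz (by rw [length_slide]; omega),
      show x₁.length - R + (R + a.length + b.length + t + a'.length) =
        a.length + x₁.length + b.length + t + a'.length by omega,
      factorAt_slide R φ _ (by omega), e2]

end Counting

/-! ### Factors are given by sliding block codes -/

section Factor

variable {Ω Ω' : Type*} [TopologicalSpace Ω] [TopologicalSpace Ω'] {p q : ℕ} {T : Ω → Ω}
  {P : Ω → Fin p} {T' : Ω' → Ω'} {P' : Ω' → Fin q}

/-- The letter of `π` depends on finitely many itinerary letters once time is shifted by `c`.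
Replacing `π` by `π ∘ T^[c]` keeps surjectivity, as `T^[c]` is onto, and commutes with the dynamics.
-/
theorem IsCoding.exists_slide_code [Nonempty Ω] (hX : IsCoding T P) (hP' : Continuous P')
    {π : Ω → Ω'} (hπ : Continuous π) (hsurj : Function.Surjective π)
    (hsemi : Function.Semiconj π T T') :
    ∃ (R : ℕ) (φ : List (Fin p) → Fin q) (ψ : Ω → Ω'), Function.Surjective ψ ∧
      Function.Semiconj ψ T T' ∧
      ∀ n x, word T' P' n (ψ x) = slide R φ (word T P (n + R) x) := by
  classical
  obtain ⟨c, m, hs, hcm⟩ := hX.exists_determined q (P' ∘ π) (hP'.comp hπ)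
  have : Nonempty (Fin q) := ⟨P' (π (Classical.arbitrary Ω))⟩
  set ψ : Ω → Ω' := fun x ↦ π (T^[c] x)
  have hψ : Function.Semiconj ψ T T' := fun x ↦ by
    simp only [ψ]
    rw [← hsemi, ← Function.iterate_succ_apply, Function.iterate_succ_apply']
  -- The value on words that never occur is arbitrary. Windows of length `m + 1`, one more than
  -- needed, match the convention `R + 1` with `R = m`.
  let φ : List (Fin p) → Fin q := fun w ↦
    if h : ∃ x, word T P (m + 1) x = w then P' (ψ h.choose) else Classical.arbitrary _
  have hφ : ∀ x, P' (ψ x) = φ (word T P (m + 1) x) := by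
    intro x
    have h : ∃ y, word T P (m + 1) y = word T P (m + 1) x := ⟨x, rfl⟩
    have e : φ (word T P (m + 1) x) = P' (ψ h.choose) := dif_pos h
    rw [e]
    refine hcm _ _ ((word_eq_word_iff ..).1 ?_)
    have := congrArg (fun w ↦ factorAt w 0 m) h.choose_spec
    simpa [factorAt_word T P (show 0 + m ≤ m + 1 by omega)] using this.symm
  refine ⟨m, φ, ψ, hsurj.comp hs, hψ, fun n x ↦ List.ext_getElem (by simp) fun i h1 h2 ↦ ?_⟩
  rw [length_word] at h1
  rw [getElem_word, getElem_slide, factorAt_word T P (by omega), ← hφ, (hψ.iterate_right i) x]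

theorem isSlideImage_words [Nonempty Ω] {R : ℕ} {φ : List (Fin p) → Fin q} {ψ : Ω → Ω'}
    (hψ : Function.Surjective ψ)
    (h : ∀ n x, word T' P' n (ψ x) = slide R φ (word T P (n + R) x)) :
    IsSlideImage R φ (words T P) (words T' P') where
  slide_mem := by
    rintro w ⟨x, hx⟩
    rcases le_total w.length R with hl | hl
    · rw [slide_of_length_le R φ hl]
      exact ⟨ψ x, rfl⟩
    · rw [← hx, ← Nat.sub_add_cancel hl, ← h]
      exact word_mem_words ..
  exists_lift := by
    rintro y ⟨x', hx'⟩
    obtain ⟨x, rfl⟩ := hψ x'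
    exact ⟨word T P (y.length + R) x, word_mem_words .., length_word .., by rw [← h, hx']⟩
  exists_extension := fun y hy n hn ↦ exists_extension_mem_words hy hn

end Factor

/-! ### Periodic points -/

section Periodic

variable {Ω : Type*} {T : Ω → Ω}

theorem bijOn_Per (T : Ω → Ω) (n : ℕ) : BijOn T (Per T n) (Per T n) := by
  refine ⟨?_, ?_, ?_⟩
  · rintro x ⟨k, h1, h2, hk⟩
    exact ⟨k, h1, h2, by rw [← Function.iterate_succ_apply, Function.iterate_succ_apply', hk]⟩
  · rintro x ⟨k, h1, -, hk⟩ y ⟨l, h1', -, hl⟩ e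
    have hpos : 0 < k * l := Nat.mul_pos h1 h1'
    have hx : T^[k * l] x = x := Function.IsPeriodicPt.mul_const (m := k) hk l
    have hy : T^[k * l] y = y := Function.IsPeriodicPt.const_mul (m := l) hl k
    obtain ⟨r, hr⟩ := Nat.exists_eq_succ_of_ne_zero hpos.ne'
    rw [← hx, ← hy, hr, Function.iterate_succ_apply, Function.iterate_succ_apply, e]
  · rintro x ⟨k, h1, h2, hk⟩
    obtain ⟨r, rfl⟩ := Nat.exists_eq_succ_of_ne_zero (Nat.one_le_iff_ne_zero.1 h1)
    have e : T (T^[r] x) = x := by rw [← Function.iterate_succ_apply' T, hk]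
    refine ⟨T^[r] x, ⟨r + 1, h1, h2, ?_⟩, e⟩
    rw [Function.iterate_succ_apply, e]

theorem perMeasure_eq_uniformOn [MeasurableSpace Ω] {n : ℕ} {S : Finset Ω}
    (hS : (S : Set Ω) = Per T n) : perMeasure T n = uniformOn S := by
  rw [perMeasure, ← hS, uniformOn, Set.encard_coe_eq_coe_finsetCard]
  congr 1
  rw [Measure.sum_fintype]
  exact Finset.sum_coe_sort S fun x ↦ Measure.dirac x

variable [TopologicalSpace Ω] [CompactSpace Ω] [T2Space Ω] [TotallyDisconnectedSpace Ω]
  {q : ℕ} {P : Ω → Fin q}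

/-- Itineraries decide membership in a clopen set only after a shift by `c`. A periodic point is
`T^[c]` of its own image `T^[c * (k - 1)]`, so the shift is harmless. -/
theorem IsCoding.eq_of_forall_itin_eq (hc : IsCoding T P) {k : ℕ} (hk : 1 ≤ k) {x y : Ω}
    (hx : T^[k] x = x) (hy : T^[k] y = y) (h : ∀ n, itin T P n x = itin T P n y) : x = y := by
  by_contra hne
  obtain ⟨U, hU, hxU, hyU⟩ := exists_isClopen_of_totally_separated hne
  obtain ⟨c, m, -, hcm⟩ := hc.exists_determined_isClopen hU
  have hlift : ∀ z : Ω, T^[k] z = z → T^[c] (T^[c * (k - 1)] z) = z := by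
    intro z hz
    rw [← Function.iterate_add_apply]
    have : c + c * (k - 1) = c * k := by
      obtain ⟨r, rfl⟩ := Nat.exists_eq_add_of_le' hk
      simp
      ring
    rw [this]
    exact Function.IsPeriodicPt.const_mul (m := k) hz c
  have key := hcm (T^[c * (k - 1)] x) (T^[c * (k - 1)] y) (by
    ext1 i
    have := congrFun (h (c * (k - 1) + m)) (Fin.natAdd _ i)
    rw [itin_add, itin_add, Fin.append_right, Fin.append_right] at this
    exact this)
  rw [hlift x hx, hlift y hy] at key
  exact hyU (key.1 hxU)

theorem IsCoding.eq_of_itin_eq (hc : IsCoding T P) {k n : ℕ} (hk : 1 ≤ k) (hkn : k ≤ n) {x y : Ω}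
    (hx : T^[k] x = x) (hy : T^[k] y = y) (h : itin T P n x = itin T P n y) : x = y := by
  refine hc.eq_of_forall_itin_eq hk hx hy fun l ↦ ?_
  ext1 i
  have h1 : ∀ z : Ω, T^[k] z = z → T^[(i : ℕ)] z = T^[(i : ℕ) % k] z := fun z hz ↦
    (Function.IsPeriodicPt.iterate_mod_apply hz _).symm
  have h2 : (i : ℕ) % k < n := (Nat.mod_lt _ hk).trans_le hkn
  simp only [itin]
  rw [h1 x hx, h1 y hy]
  exact congrFun h ⟨_, h2⟩

theorem IsCoding.finite_Per (hc : IsCoding T P) (n : ℕ) : (Per T n).Finite := by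
  classical
  choose! k hk1 hkn hk using fun x (hx : x ∈ Per T n) ↦ hx
  refine Set.Finite.of_finite_image (f := fun x ↦ (k x, itin T P n x)) ?_ ?_
  · refine ((Set.finite_Iic n).prod (Set.finite_univ (α := Fin n → Fin q))).subset ?_
    rintro _ ⟨x, hx, rfl⟩
    exact ⟨hkn x hx, mem_univ _⟩
  · intro x hx y hy e
    simp only [Prod.mk.injEq] at e
    exact hc.eq_of_itin_eq (hk1 x hx) (hkn x hx) (hk x hx) (e.1 ▸ hk y hy) e.2

/-- Two points with the same `n`-itinerary and a common period `k ≤ n` coincide. Hence a choice of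
periods in `[1, n]` is injective on the points with a given itinerary. -/
theorem IsCoding.card_filter_itin_le (hc : IsCoding T P) {n : ℕ} {S : Finset Ω}
    (hS : (S : Set Ω) = Per T n) (a : Fin n → Fin q) :
    (S.filter (itin T P n · = a)).card ≤ n := by
  classical
  choose! k hk1 hkn hk using fun x (hx : x ∈ Per T n) ↦ hx
  have hmem : ∀ x ∈ S.filter (itin T P n · = a), x ∈ Per T n ∧ itin T P n x = a := by
    intro x hx
    rw [Finset.mem_filter] at hx
    exact ⟨hS ▸ hx.1, hx.2⟩
  have : (Finset.Icc 1 n).card = n := by simp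
  conv_rhs => rw [← this]
  refine Finset.card_le_card_of_injOn k (fun x hx ↦ ?_) fun x hx y hy e ↦ ?_
  · have := (hmem x hx).1
    exact Finset.mem_coe.2 (Finset.mem_Icc.2 ⟨hk1 x this, hkn x this⟩)
  · obtain ⟨px, ex⟩ := hmem x hx
    obtain ⟨py, ey⟩ := hmem y hy
    exact hc.eq_of_itin_eq (hk1 x px) (hkn x px) (hk x px) (e ▸ hk y py) (ex.trans ey.symm)

end Periodic

/-! ### Maximal measures in terms of the growth of words -/

section Maximal

variable {Ω : Type*} [TopologicalSpace Ω] [CompactSpace Ω] [T2Space Ω]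
  [TotallyDisconnectedSpace Ω] [SecondCountableTopology Ω]
  [MeasurableSpace Ω] [BorelSpace Ω] {q : ℕ} {T : Ω → Ω} {P : Ω → Fin q}

theorem IsCoding.measureEntropy_le (hc : IsCoding T P) {h : ℝ}
    (hh : Tendsto (fun n : ℕ ↦ Real.log (level (words T P) n).card / n) atTop (𝓝 h))
    {μ : Measure Ω} [IsProbabilityMeasure μ] (hμ : MeasurePreserving T μ μ) :
    measureEntropy T μ ≤ h := by
  have hP := hc.continuous_code.measurable
  obtain ⟨b, hb, -⟩ := exists_tendsto_shannon_itin hμ hP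
  rw [hc.measureEntropy_eq hμ, partitionEntropy_eq_of_tendsto hb, EReal.coe_le_coe_iff]
  refine le_of_tendsto_of_tendsto' hb hh fun n ↦ ?_
  gcongr
  exact shannon_itin_le_log_card hμ.measurable hP μ n

/-- By subadditivity the entropy is the infimum of the normalised join entropies, so a lower bound
on it holds at every finite stage. -/
theorem IsCoding.le_measureEntropy_iff (hc : IsCoding T P) {h : ℝ}
    {μ : Measure Ω} [IsProbabilityMeasure μ] (hμ : MeasurePreserving T μ μ) :
    h ≤ measureEntropy T μ ↔ ∀ n : ℕ, n * h ≤ shannon μ (itin T P n) := by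
  have hP := hc.continuous_code.measurable
  obtain ⟨b, hb, hbn⟩ := exists_tendsto_shannon_itin hμ hP
  rw [hc.measureEntropy_eq hμ, partitionEntropy_eq_of_tendsto hb, EReal.coe_le_coe_iff]
  constructor
  · intro hle n
    exact (mul_le_mul_of_nonneg_left hle n.cast_nonneg).trans (hbn n)
  · intro hn
    refine ge_of_tendsto hb (eventually_atTop.2 ⟨1, fun n h1 ↦ ?_⟩)
    have h1 : (0 : ℝ) < n := by exact_mod_cast h1
    rw [le_div_iff₀ h1]
    linarith [hn n]

/-- The maximal value is `h`: counting words bounds every entropy by `h`, and `exists_large_entropy`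
attains it. -/
theorem IsCoding.isMaxEntropyMeasure_iff [Nonempty Ω] (hc : IsCoding T P) {h : ℝ}
    (hh : Tendsto (fun n : ℕ ↦ Real.log (level (words T P) n).card / n) atTop (𝓝 h))
    (hhn : ∀ n : ℕ, n * h ≤ Real.log (level (words T P) n).card) (μ : ProbabilityMeasure Ω) :
    IsMaxEntropyMeasure T μ ↔ MeasurePreserving T (μ : Measure Ω) (μ : Measure Ω) ∧
      ∀ n : ℕ, n * h ≤ shannon (μ : Measure Ω) (itin T P n) := by
  constructor
  · rintro ⟨hμ, hmax⟩
    obtain ⟨μ₀, hμ₀, h₀⟩ := hc.exists_large_entropy hhn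
    exact ⟨hμ, (hc.le_measureEntropy_iff hμ).1
      (((hc.le_measureEntropy_iff hμ₀).2 h₀).trans (hmax μ₀ hμ₀))⟩
  · rintro ⟨hμ, hn⟩
    exact ⟨hμ, fun ν hν ↦ (hc.measureEntropy_le hh hν).trans
      ((hc.le_measureEntropy_iff hμ).2 hn)⟩

/-- If there are exponentially many periodic points, then their distributions converge to the
unique measure of maximal entropy. -/
theorem IsCoding.perMeasuresTendsto [Nonempty Ω] (hc : IsCoding T P) {h : ℝ}
    {μ : ProbabilityMeasure Ω}
    (huniq : ∀ ν : ProbabilityMeasure Ω, MeasurePreserving T (ν : Measure Ω) (ν : Measure Ω) →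
      (∀ n : ℕ, n * h ≤ shannon (ν : Measure Ω) (itin T P n)) → ν = μ) {κ : ℝ} (hκ : 0 < κ)
    (hper : ∀ᶠ n : ℕ in atTop, κ * Real.exp (n * h) ≤ ((Per T n).ncard : ℝ)) :
    PerMeasuresTendsto T μ := by
  classical
  have hT := hc.continuous_map.measurable
  have hP := hc.continuous_code.measurable
  choose S hS using fun n ↦ (hc.finite_Per n).exists_finset_coe
  have hScard : ∀ n, (Per T n).ncard = (S n).card := fun n ↦ by
    rw [← hS, Set.ncard_coe_finset]
  have hne : ∀ᶠ n in atTop, (S n).Nonempty := by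
    filter_upwards [hper] with n hn
    rw [hScard] at hn
    have : (0 : ℝ) < (S n).card := lt_of_lt_of_le (by positivity) hn
    exact Finset.card_pos.1 (by exact_mod_cast this)
  let ν : ℕ → ProbabilityMeasure Ω := fun n ↦
    if h : (S n).Nonempty then ⟨uniformOn (S n), isProbabilityMeasure_uniformOn h⟩ else μ
  have hν : ∀ n, (S n).Nonempty → (ν n : Measure Ω) = uniformOn (S n) := fun n h ↦ by
    simp [ν, h]
  refine ⟨ν, ?_, ?_⟩
  · filter_upwards [hne] with n hn
    rw [hν n hn, perMeasure_eq_uniformOn (hS n)]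
  -- By compactness every ultrafilter yields some limit, so it suffices that each such limit has
  -- entropy at least `h`.
  rw [tendsto_iff_ultrafilter]
  intro g hg
  obtain ⟨μ', -, hμ'⟩ := isCompact_univ.ultrafilter_le_nhds (g.map ν) (by simp)
  have hμ' : Tendsto ν g (𝓝 μ') := hμ'
  -- The loss from up to `n` periodic points per itinerary and from `κ` is subexponential.
  have hlog : ∀ ε > 0, ∀ᶠ n : ℕ in atTop, Real.log n - Real.log κ ≤ n * ε := by
    intro ε hε
    have h1 : Tendsto (fun n : ℕ ↦ Real.log n / n - Real.log κ / n) atTop (𝓝 (0 - 0)) := by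
      refine Tendsto.sub ?_ (tendsto_const_div_atTop_nhds_zero_nat _)
      have := Real.isLittleO_log_id_atTop.tendsto_div_nhds_zero
      exact this.comp tendsto_natCast_atTop_atTop
    rw [sub_zero] at h1
    filter_upwards [h1.eventually_lt_const hε, eventually_gt_atTop 0] with n hn hn0
    have hn0 : (0 : ℝ) < n := by exact_mod_cast hn0
    rw [← sub_div, div_lt_iff₀ hn0] at hn
    linarith
  -- The map permutes `Per T n`, so the uniform distribution is invariant and equals its own time
  -- average.
  obtain ⟨hinv, hent⟩ := hc.of_tendsto_timeAverage (l := (g : Filter ℕ)) (N := fun n ↦ n)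
    (ν := ν) (ρ := ν) (a := h) (tendsto_id.mono_left hg) (by
      filter_upwards [hg hne, hg (eventually_ne_atTop 0)] with n hn hn0
      refine (timeAverage_of_measurePreserving ?_ hn0).symm
      rw [hν n hn]
      exact measurePreserving_uniformOn hT (by rw [hS]; exact bijOn_Per T n)) hμ' (by
      intro ε hε
      filter_upwards [hg hne, hg (eventually_gt_atTop 0), hg hper, hg (hlog ε hε)] with
        n hn hn0 hnp hnl
      have hn0' : (0 : ℝ) < n := by exact_mod_cast hn0
      have h1 := log_div_le_shannon_uniformOn hn (measurable_itin hT hP n)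
        (fun a ↦ hc.card_filter_itin_le (hS n) a)
      rw [hν n hn]
      refine le_trans ?_ h1
      rw [hScard] at hnp
      have h2 := Real.log_le_log (by positivity) hnp
      rw [Real.log_mul hκ.ne' (Real.exp_pos _).ne', Real.log_exp] at h2
      rw [Real.log_div (by exact_mod_cast hn.card_pos.ne') hn0'.ne']
      linarith)
  rwa [huniq μ' hinv hent] at hμ'

end Maximal

/-! ### Growth rates -/

section Growth

variable {B : Type*} [Finite B]

theorem eventually_card_level_le {D : Set (List B)} {a : ℝ} (h : growthRate D < a) :
    ∀ᶠ n : ℕ in atTop, ((level D n).card : ℝ) ≤ Real.exp (n * a) := by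
  filter_upwards [ExpGrowth.eventually_le_exp h] with n hn
  rw [encard_eq_card_level] at hn
  have e : ((a : EReal) * (n : EReal)) = ((n * a : ℝ) : EReal) := by
    rw [EReal.coe_mul, mul_comm]
    rfl
  rw [e, EReal.exp_coe] at hn
  have := ENNReal.toReal_mono ENNReal.ofReal_ne_top hn
  rw [ENNReal.toReal_ofReal (Real.exp_pos _).le] at this
  simpa using this

/-- The finitely many lengths before the eventual bound are absorbed into `C`. -/
theorem exists_card_level_le_of_growthRate_lt {D : Set (List B)} {a : ℝ} (h : growthRate D < a) :
    ∃ C : ℝ, ∀ n : ℕ, ((level D n).card : ℝ) ≤ C * Real.exp (n * a) := by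
  obtain ⟨N, hN⟩ := eventually_atTop.1 (eventually_card_level_le h)
  refine ⟨1 + ∑ k ∈ Finset.range N, (level D k).card / Real.exp (k * a), fun n ↦ ?_⟩
  have hnn : ∀ k ∈ Finset.range N, 0 ≤ ((level D k).card : ℝ) / Real.exp (k * a) :=
    fun k _ ↦ by positivity
  rcases le_or_gt N n with hn | hn
  · refine (hN n hn).trans ?_
    have := Finset.sum_nonneg hnn
    exact le_mul_of_one_le_left (Real.exp_pos _).le (by linarith)
  · have := Finset.single_le_sum hnn (Finset.mem_range.2 hn)
    rw [← div_le_iff₀ (Real.exp_pos _)]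
    linarith

theorem eventually_card_level_le_of_tendsto {D : Set (List B)} {h : ℝ}
    (hD : ∀ n, 0 < (level D n).card)
    (hh : Tendsto (fun n : ℕ ↦ Real.log (level D n).card / n) atTop (𝓝 h)) {ε : ℝ} (hε : 0 < ε) :
    ∀ᶠ n : ℕ in atTop, ((level D n).card : ℝ) ≤ Real.exp (n * (h + ε)) := by
  filter_upwards [hh.eventually_lt_const (lt_add_of_pos_right h hε), eventually_gt_atTop 0]
    with n hn hn0
  have hn0 : (0 : ℝ) < n := by exact_mod_cast hn0
  rw [div_lt_iff₀ hn0] at hn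
  rw [← Real.log_le_iff_le_exp (by exact_mod_cast hD n)]
  linarith

end Growth

/-! ### Intrinsic ergodicity of factors -/

section Main

variable {Ω Ω' : Type*} [TopologicalSpace Ω] [TopologicalSpace Ω'] [CompactSpace Ω'] [T2Space Ω']
  [TotallyDisconnectedSpace Ω'] [SecondCountableTopology Ω'] [MeasurableSpace Ω'] [BorelSpace Ω']
  {p q : ℕ} {T : Ω → Ω} {P : Ω → Fin p} {T' : Ω' → Ω'} {P' : Ω' → Fin q}

/-- A good word lifts to `x` in `G(N)`, extends to `u ++ x ++ w` in `G`, and thereby occurs at place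
`|u| ≤ τ` in the image of a periodic point. At most `τ + 1` good words of a given length are
obtained from one such point. -/
theorem eventually_le_ncard_Per {R : ℕ} {φ : List (Fin p) → Fin q} {ψ : Ω → Ω'}
    (hc : IsCoding T' P') (hψ : Function.Semiconj ψ T T')
    (hφ : ∀ n x, word T' P' n (ψ x) = slide R φ (word T P (n + R) x))
    {Cp G Cs : Set (List (Fin p))} {N τ t : ℕ}
    (hτ : ∀ v ∈ coreUpTo (words T P) Cp G Cs N, ∃ u w : List (Fin p),
      u.length ≤ τ ∧ w.length ≤ τ ∧ u ++ v ++ w ∈ G)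
    (hper : ∀ w ∈ G, ∃ x, word T P w.length x = w ∧ T^[w.length + t] x = x) {h : ℝ}
    (hlow : ∀ n : ℕ, n * h ≤ Real.log (level (words T' P') n).card) [Nonempty Ω']
    (hgood : ∀ n : ℕ, ((level (words T' P' \ goodWords R φ (words T P) Cp G Cs N) n).card : ℝ) ≤
      1 / 2 * Real.exp (n * h)) :
    ∃ κ > 0, ∀ᶠ n : ℕ in atTop, κ * Real.exp (n * h) ≤ ((Per T' n).ncard : ℝ) := by
  classical
  set d := R + 2 * τ + t
  -- The period `|u ++ x ++ w| + t` is at most `n + d`, and `1 ≤ n` makes it positive.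
  have key : ∀ n : ℕ, 1 ≤ n →
      (level (goodWords R φ (words T P) Cp G Cs N) n).card ≤ (τ + 1) * (Per T' (n + d)).ncard := by
    intro n hn
    have hex : ∀ y ∈ level (goodWords R φ (words T P) Cp G Cs N) n,
        ∃ k ≤ τ, ∃ z ∈ Per T' (n + d), word T' P' n (T'^[k] z) = y := by
      intro y hy
      obtain ⟨⟨x, hx, hxl, rfl⟩, hyn⟩ := mem_level.1 hy
      obtain ⟨u, w, hu, hw, huw⟩ := hτ x hx
      obtain ⟨z, hz, hzp⟩ := hper _ huw
      rw [hyn] at hxl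
      set l := (u ++ x ++ w).length with hl
      have hl' : l = u.length + (n + R) + w.length := by
        simp only [hl, List.length_append, hxl]
      refine ⟨u.length, hu, ψ z, ⟨l + t, by omega, by omega, ?_⟩, ?_⟩
      · rw [← (hψ.iterate_right (l + t)) z, hzp]
      · rw [← (hψ.iterate_right u.length) z, hφ]
        congr 1
        have e := factorAt_append_append u x w
        rw [← hz, factorAt_word T P (by omega), hxl] at e
        exact e
    choose! k hk z hz hkz using hex
    set S := (hc.finite_Per (n + d)).toFinset
    have hS : (Per T' (n + d)).ncard = S.card := Set.ncard_eq_toFinset_card _ _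
    rw [hS, ← Finset.card_range (τ + 1), ← Finset.card_product]
    refine Finset.card_le_card_of_injOn (fun y ↦ (k y, z y)) (fun y hy ↦ ?_) fun y hy y' hy' e ↦ ?_
    · simp only [Finset.coe_product, mem_prod, Finset.mem_coe, Finset.mem_range, S,
        Set.Finite.mem_toFinset]
      exact ⟨Nat.lt_succ_of_le (hk y hy), hz y hy⟩
    · simp only [Prod.mk.injEq] at e
      rw [← hkz y hy, ← hkz y' hy', e.1, e.2]
  refine ⟨Real.exp (-(d * h)) / (2 * (τ + 1)), by positivity,
    eventually_atTop.2 ⟨d + 1, fun n hn ↦ ?_⟩⟩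
  obtain ⟨r, rfl⟩ := Nat.exists_eq_add_of_le' (show d ≤ n by omega)
  have h1 := key r (by omega)
  have h2 : (level (words T' P') r).card ≤ (level (goodWords R φ (words T P) Cp G Cs N) r).card +
      (level (words T' P' \ goodWords R φ (words T P) Cp G Cs N) r).card := by
    refine (Finset.card_le_card fun y hy ↦ ?_).trans (Finset.card_union_le _ _)
    simp only [Finset.mem_union, mem_level, Set.mem_sdiff] at hy ⊢
    tauto
  have h3 : Real.exp (r * h) ≤ (level (words T' P') r).card :=
    (Real.le_log_iff_exp_le (by exact_mod_cast card_level_words_pos T' P' r)).1 (hlow r)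
  have h4 := hgood r
  have h5 : ((level (words T' P') r).card : ℝ) ≤
      (level (goodWords R φ (words T P) Cp G Cs N) r).card +
      (level (words T' P' \ goodWords R φ (words T P) Cp G Cs N) r).card := by exact_mod_cast h2
  have h6 : ((level (goodWords R φ (words T P) Cp G Cs N) r).card : ℝ) ≤
      (τ + 1) * (Per T' (r + d)).ncard := by exact_mod_cast h1
  have h7 : Real.exp (-(d * h)) * Real.exp ((r + d : ℕ) * h) = Real.exp (r * h) := by
    rw [← Real.exp_add]
    congr 1
    push_cast
    ring
  rw [div_mul_eq_mul_div, h7, div_le_iff₀ (by positivity)]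
  linarith

/-- A factor of large entropy of a system with a decomposed language is intrinsically ergodic. -/
theorem IsCoding.intrinsicallyErgodic_of_factor [Nonempty Ω] [Nonempty Ω'] (hX : IsCoding T P)
    (hY : IsCoding T' P') {π : Ω → Ω'} (hπ : Continuous π) (hsurj : Function.Surjective π)
    (hsemi : Function.Semiconj π T T') {Cp G Cs : Set (List (Fin p))}
    (hD : IsDecomposition (words T P) Cp G Cs) {t : ℕ} (hspec : SSpecification (words T P) G t)
    (hext : Extendable (words T P) Cp G Cs)
    (hgr : growthRate (Cp ∪ Cs) < growthRate (words T' P')) :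
    IntrinsicallyErgodic T' ∧
      ((∃ t : ℕ, ∀ w ∈ G, ∃ x, word T P w.length x = w ∧ T^[w.length + t] x = x) →
        ∀ μ : ProbabilityMeasure Ω', IsMaxEntropyMeasure T' μ → PerMeasuresTendsto T' μ) := by
  obtain ⟨h, hh, hlow⟩ := exists_tendsto_log_card_level T' P'
  rw [growthRate_words_eq T' P' hh] at hgr
  -- A real rate strictly in between bounds the prefixes and suffixes by `C₀ exp (n a)` for every
  -- `n`, and makes `exp (a - h) < 1`.
  obtain ⟨a, ha, hah⟩ := EReal.lt_iff_exists_real_btwn.1 hgr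
  rw [EReal.coe_lt_coe_iff] at hah
  obtain ⟨C₀, hC₀⟩ := exists_card_level_le_of_growthRate_lt ha
  have hup : ∀ ε > 0, ∀ᶠ n : ℕ in atTop,
      ((level (words T' P') n).card : ℝ) ≤ Real.exp (n * (h + ε)) := fun ε hε ↦
    eventually_card_level_le_of_tendsto (card_level_words_pos T' P') hh hε
  obtain ⟨R, φ, ψ, hψs, hψ, hφ⟩ := hX.exists_slide_code hY.continuous_code hπ hsurj hsemi
  have hM := isSlideImage_words hψs hφ
  obtain ⟨C, hC⟩ := exists_card_level_le hM hD hspec hah hup hC₀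
  have hiff := hY.isMaxEntropyMeasure_iff hh hlow
  have huniq : ∀ μ ν : ProbabilityMeasure Ω', IsMaxEntropyMeasure T' μ →
      IsMaxEntropyMeasure T' ν → μ = ν := by
    intro μ ν hμ hν
    obtain ⟨hμ, hμh⟩ := (hiff μ).1 hμ
    obtain ⟨hν, hνh⟩ := (hiff ν).1 hν
    have key : (μ : Measure Ω') = (ν : Measure Ω') :=
      hY.eq_of_gluesWithin (μ := (μ : Measure Ω')) (ν := (ν : Measure Ω')) hC (fun ε hε ↦ by
        obtain ⟨N, hN⟩ := exists_card_sdiff_goodWords_le hM hD hspec hah hup hC₀ hε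
        obtain ⟨d, hd⟩ := exists_gluesWithin_goodWords hM hspec hext N
        exact ⟨_, d, hN, hd⟩) hμ hν hμh hνh
    exact Subtype.ext key
  refine ⟨?_, ?_⟩
  · obtain ⟨μ, hμ⟩ := hY.exists_large_entropy hlow
    exact ⟨μ, (hiff μ).2 hμ, fun ν hν ↦ huniq ν μ hν ((hiff μ).2 hμ)⟩
  · rintro ⟨t', ht'⟩ μ hμ
    obtain ⟨N, hN⟩ := exists_card_sdiff_goodWords_le hM hD hspec hah hup hC₀ one_half_pos
    obtain ⟨τ, hτ⟩ := hext N
    obtain ⟨κ, hκ, hper⟩ := eventually_le_ncard_Per hY hψ hφ hτ ht' hlow hN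
    exact hY.perMeasuresTendsto (fun ν h1 h2 ↦ huniq ν μ ((hiff ν).2 ⟨h1, h2⟩) hμ) hκ hper

end Main

/-! ### Shift spaces -/

section Subshifts

variable {I : Type*} [AddMonoidWithOne I] {q : ℕ}

/-- Finite sets of times can be moved to the natural numbers by an invertible translation by a
natural number. -/
def HasForwardWindows (I : Type*) [AddMonoidWithOne I] : Prop :=
  ∀ F : Finset I, ∃ c m : ℕ, (∃ d : I, d + (c : I) = 0) ∧
    ∀ i ∈ F, ∃ j < m, (c : I) + i = (j : I)

theorem hasForwardWindows_nat : HasForwardWindows ℕ := fun F ↦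
  ⟨0, F.sup id + 1, ⟨0, by simp⟩, fun i hi ↦
    ⟨i, Nat.lt_succ_of_le (Finset.le_sup (f := id) hi), by simp⟩⟩

theorem hasForwardWindows_int : HasForwardWindows ℤ := fun F ↦ by
  set c := F.sup Int.natAbs
  refine ⟨c, 2 * c + 1, ⟨-c, by simp⟩, fun i hi ↦ ?_⟩
  have h : i.natAbs ≤ c := Finset.le_sup (f := Int.natAbs) hi
  refine ⟨((c : ℤ) + i).toNat, by omega, ?_⟩
  omega

/-- The letter at time zero. -/
def letterZero (Y : Subshift (Fin q) I) (y : Y.carrier) : Fin q := (y : I → Fin q) 0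

theorem shiftMap_iterate_apply (Y : Subshift (Fin q) I) (n : ℕ) (y : Y.carrier) (i : I) :
    ((shiftMap Y)^[n] y : I → Fin q) i = (y : I → Fin q) (n + i) := by
  induction n generalizing i with
  | zero => simp
  | succ n ih =>
    rw [Function.iterate_succ_apply']
    change ((shiftMap Y)^[n] y : I → Fin q) (1 + i) = _
    rw [ih, Nat.cast_succ, add_assoc]

theorem letterZero_iterate (Y : Subshift (Fin q) I) (n : ℕ) (y : Y.carrier) :
    letterZero Y ((shiftMap Y)^[n] y) = (y : I → Fin q) n := by
  rw [letterZero, shiftMap_iterate_apply, add_zero]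

theorem appearsAt_zero_iff (Y : Subshift (Fin q) I) (w : List (Fin q)) (y : Y.carrier) :
    AppearsAt w (y : I → Fin q) 0 ↔ word (shiftMap Y) (letterZero Y) w.length y = w := by
  constructor
  · intro h
    refine List.ext_getElem (by simp) fun j h1 h2 ↦ ?_
    rw [getElem_word, letterZero_iterate, ← h j h2, zero_add]
  · intro h j hj
    rw [zero_add, ← letterZero_iterate]
    conv_rhs => rw [← List.getElem_of_eq h (by simpa using hj)]
    rw [getElem_word]

/-- The point shifted by `i` carries at `0` the word found at `i`, and it stays in the shift space
for every `i : I`. -/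
theorem language_eq_words (Y : Subshift (Fin q) I) :
    language Y = words (shiftMap Y) (letterZero Y) := by
  ext w
  constructor
  · rintro ⟨x, hx, i, h⟩
    refine ⟨⟨shift i x, Y.mapsTo i hx⟩, (appearsAt_zero_iff Y w _).1 fun j hj ↦ ?_⟩
    rw [← h j hj, zero_add]
    rfl
  · rintro ⟨y, hy⟩
    exact ⟨y, y.2, 0, (appearsAt_zero_iff Y w y).2 hy⟩

theorem surjective_shiftMap_iterate (Y : Subshift (Fin q) I) {c : ℕ} {d : I} (h : d + (c : I) = 0) :
    Function.Surjective (shiftMap Y)^[c] := by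
  intro y
  refine ⟨⟨shift d y, Y.mapsTo d y.2⟩, Subtype.ext (funext fun i ↦ ?_)⟩
  rw [shiftMap_iterate_apply]
  change (y : I → Fin q) (d + (c + i)) = _
  rw [← add_assoc, h, zero_add]

theorem exists_determined_window (hI : HasForwardWindows I) (Y : Subshift (Fin q) I)
    (F : Finset I) : ∃ c m : ℕ, Function.Surjective (shiftMap Y)^[c] ∧
      ∀ x y, itin (shiftMap Y) (letterZero Y) m x = itin (shiftMap Y) (letterZero Y) m y →
        ∀ i ∈ F, ((shiftMap Y)^[c] x : I → Fin q) i = ((shiftMap Y)^[c] y : I → Fin q) i := by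
  obtain ⟨c, m, ⟨d, hd⟩, hF⟩ := hI F
  refine ⟨c, m, surjective_shiftMap_iterate Y hd, fun x y hxy i hi ↦ ?_⟩
  obtain ⟨j, hj, hcj⟩ := hF i hi
  rw [shiftMap_iterate_apply, shiftMap_iterate_apply, hcj]
  have := congrFun hxy ⟨j, hj⟩
  simpa only [itin, letterZero_iterate] using this

theorem exists_finset_of_mem_uniformity (Y : Subshift (Fin q) I) :
    letI : UniformSpace (Fin q) := ⊥
    ∀ V ∈ uniformity Y.carrier, ∃ F : Finset I, ∀ x y : Y.carrier,
      (∀ i ∈ F, (x : I → Fin q) i = (y : I → Fin q) i) → (x, y) ∈ V := by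
  let _ : UniformSpace (Fin q) := ⊥
  intro V hV
  rw [uniformity_subtype, mem_comap] at hV
  obtain ⟨W, hW, hWV⟩ := hV
  rw [Pi.uniformity, Filter.mem_iInf_finite] at hW
  obtain ⟨F, hF⟩ := hW
  refine ⟨F, fun x y h ↦ hWV ?_⟩
  have hle : 𝓟 {((x : I → Fin q), (y : I → Fin q))} ≤
      ⨅ i ∈ F, comap (fun a : (I → Fin q) × (I → Fin q) ↦ (a.1 i, a.2 i)) (uniformity (Fin q)) := by
    refine le_iInf₂ fun i hi ↦ ?_
    rw [← map_le_iff_le_comap, map_principal, image_singleton]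
    refine le_trans (principal_mono.2 ?_) refl_le_uniformity
    rintro _ rfl
    exact h i hi
  exact hle hF rfl

theorem compactSpace_carrier (Y : Subshift (Fin q) I) : CompactSpace Y.carrier :=
  isCompact_iff_compactSpace.1 Y.isClosed.isCompact

/-- On a compact space a continuous finite-valued function is uniformly continuous, so it depends on
finitely many coordinates. A time shift moves these to nonnegative times. -/
theorem isCoding_shiftMap (hI : HasForwardWindows I) (Y : Subshift (Fin q) I) :
    IsCoding (shiftMap Y) (letterZero Y) where
  continuous_map := (SymbolicDynamics.FullShift.continuous_shift (1 : I)).restrict (Y.mapsTo 1)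
  continuous_code := (continuous_apply 0).comp continuous_subtype_val
  exists_determined := by
    intro k Q hQ
    have hF : ∃ F : Finset I, ∀ x y : Y.carrier,
        (∀ i ∈ F, (x : I → Fin q) i = (y : I → Fin q) i) → Q x = Q y := by
      let _ : UniformSpace (Fin q) := ⊥
      let _ : UniformSpace (Fin k) := ⊥
      have := compactSpace_carrier Y
      have hu : UniformContinuous Q := CompactSpace.uniformContinuous_of_continuous hQ
      obtain ⟨F, hF⟩ := exists_finset_of_mem_uniformity Y _
        (hu (show SetRel.id ∈ uniformity (Fin k) from mem_principal_self _))
      exact ⟨F, fun x y h ↦ hF x y h⟩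
    obtain ⟨F, hF⟩ := hF
    obtain ⟨c, m, hs, h⟩ := exists_determined_window hI Y F
    exact ⟨c, m, hs, fun x y hxy ↦ hF _ _ (h x y hxy)⟩

/-- The topological entropy is at most the growth rate of the language. -/
theorem topEntropy_le_growthRate (hI : HasForwardWindows I) (Y : Subshift (Fin q) I) :
    topEntropy Y ≤ growthRate (words (shiftMap Y) (letterZero Y)) := by
  classical
  let _ : UniformSpace (Fin q) := ⊥
  change Dynamics.coverEntropy (shiftMap Y) univ ≤ _
  refine iSup₂_le fun V hV ↦ ?_
  obtain ⟨F, hF⟩ := exists_finset_of_mem_uniformity Y V hV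
  obtain ⟨c, m, hs, h⟩ := exists_determined_window hI Y F
  set T := shiftMap Y
  set P := letterZero Y
  -- One point per word of length `n + m`, moved by `T^[c]`, forms a dynamical cover: the first `n +
  -- m` letters fix the window `F` at all times below `n`.
  have hcov : ∀ n, Dynamics.coverMincard T univ V n ≤ ((level (words T P) (n + m)).card : ℕ∞) := by
    intro n
    rcases isEmpty_or_nonempty Y.carrier with he | he
    · rw [univ_eq_empty_iff.2 he, Dynamics.coverMincard_empty]
      exact zero_le
    choose! f hf using fun w (hw : w ∈ level (words T P) (n + m)) ↦
      exists_eq_word (mem_level.1 hw).1 (mem_level.1 hw).2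
    have : Dynamics.IsDynCoverOf T univ V n
        (((level (words T P) (n + m)).image fun w ↦ T^[c] (f w) : Finset Y.carrier) :
          Set Y.carrier) := by
      intro y _
      obtain ⟨z, rfl⟩ := hs y
      have hz : word T P (n + m) z ∈ level (words T P) (n + m) :=
        mem_level.2 ⟨word_mem_words .., length_word ..⟩
      refine ⟨T^[c] (f (word T P (n + m) z)), Finset.mem_coe.2 (Finset.mem_image_of_mem _ hz), ?_⟩
      rw [Dynamics.mem_dynEntourage]
      intro k hk
      have e := congrArg (fun w ↦ factorAt w k m) (hf _ hz)
      simp only [factorAt_word T P (show k + m ≤ n + m by omega)] at e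
      refine hF _ _ fun i hi ↦ ?_
      have := h _ _ ((word_eq_word_iff ..).1 e.symm) i hi
      rwa [← Function.iterate_add_apply, ← Function.iterate_add_apply, add_comm c k,
        Function.iterate_add_apply, Function.iterate_add_apply] at this
    exact this.coverMincard_le_card.trans (by exact_mod_cast Finset.card_image_le)
  -- The `m` extra letters cost a constant factor, which does not change the growth rate.
  refine ExpGrowth.expGrowthSup_le_of_eventually_le (b := ((level (words T P) m).card : ℝ≥0∞))
    (ENNReal.natCast_ne_top _) (Eventually.of_forall fun n ↦ ?_)
  rw [encard_eq_card_level]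
  refine (ENat.toENNReal_mono (hcov n)).trans ?_
  have := card_level_words_add_le T P m n
  rw [add_comm m n] at this
  simp only [ENat.toENNReal_coe]
  exact_mod_cast this

theorem topEntropy_eq_bot (Y : Subshift (Fin q) I) (hY : IsEmpty Y.carrier) :
    topEntropy Y = ⊥ := by
  let _ : UniformSpace (Fin q) := ⊥
  change Dynamics.coverEntropy (shiftMap Y) univ = ⊥
  rw [univ_eq_empty_iff.2 hY]
  exact Dynamics.coverEntropy_empty

theorem intrinsicallyErgodic_of_isFactor [Countable I] (hI : HasForwardWindows I) {p q : ℕ}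
    (X : Subshift (Fin p) I) (Y : Subshift (Fin q) I) (Cp G Cs : Set (List (Fin p)))
    (hD : IsDecomposition (language X) Cp G Cs) (hS : ∃ t : ℕ, SSpecification (language X) G t)
    (hE : Extendable (language X) Cp G Cs) (hXY : IsFactor X Y)
    (hgr : growthRate (Cp ∪ Cs) < topEntropy Y) :
    IntrinsicallyErgodic (shiftMap Y) ∧
      ((∃ t : ℕ, PerSpecification X G t) →
        ∀ μ : ProbabilityMeasure Y.carrier,
          IsMaxEntropyMeasure (shiftMap Y) μ → PerMeasuresTendsto (shiftMap Y) μ) := by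
  obtain ⟨π, hπ, hsurj, hsemi⟩ := hXY
  obtain ⟨t, ht⟩ := hS
  -- An empty factor has entropy `⊥`, which cannot strictly exceed a growth rate.
  have hY : Nonempty Y.carrier := by
    by_contra hne
    rw [topEntropy_eq_bot Y (not_nonempty_iff.1 hne)] at hgr
    exact not_lt_bot hgr
  have hX : Nonempty X.carrier := hsurj.nonempty
  have := compactSpace_carrier Y
  rw [language_eq_words] at hD ht hE
  obtain ⟨h1, h2⟩ := (isCoding_shiftMap hI X).intrinsicallyErgodic_of_factor
    (isCoding_shiftMap hI Y) hπ hsurj hsemi hD ht hE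
    (hgr.trans_le (topEntropy_le_growthRate hI Y))
  refine ⟨h1, fun ⟨s, hs⟩ ↦ h2 ⟨s, fun w hw ↦ ?_⟩⟩
  -- Only the case `m = 0` of (Per)-specification is used: each single word of `G` begins a periodic
  -- point.
  obtain ⟨_, _, _, y, hy, hyp⟩ := hs 0 (fun _ ↦ w) fun _ _ ↦ hw
  exact ⟨y, (appearsAt_zero_iff X w y).1 hy, hyp⟩

end Subshifts

end ShiftSpec

end

theorem mainTheorem5 (p q : ℕ) :
    -- one-sided shift spaces
    (∀ (X : Subshift (Fin p) ℕ) (Y : Subshift (Fin q) ℕ) (Cp G Cs : Set (List (Fin p))),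
      ShiftSpec.IsDecomposition (ShiftSpec.language X) Cp G Cs →
      (∃ t : ℕ, ShiftSpec.SSpecification (ShiftSpec.language X) G t) →
      ShiftSpec.growthRate (Cp ∪ Cs) < ShiftSpec.growthRate (ShiftSpec.language X) →
      ShiftSpec.Extendable (ShiftSpec.language X) Cp G Cs →
      ShiftSpec.IsFactor X Y →
      ShiftSpec.growthRate (Cp ∪ Cs) < ShiftSpec.topEntropy Y →
        ShiftSpec.IntrinsicallyErgodic (ShiftSpec.shiftMap Y) ∧
        ((∃ t : ℕ, ShiftSpec.PerSpecification X G t) →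
          ∀ μ : ProbabilityMeasure Y.carrier,
            ShiftSpec.IsMaxEntropyMeasure (ShiftSpec.shiftMap Y) μ →
              ShiftSpec.PerMeasuresTendsto (ShiftSpec.shiftMap Y) μ)) ∧
    -- two-sided shift spaces
    (∀ (X : Subshift (Fin p) ℤ) (Y : Subshift (Fin q) ℤ) (Cp G Cs : Set (List (Fin p))),
      ShiftSpec.IsDecomposition (ShiftSpec.language X) Cp G Cs →
      (∃ t : ℕ, ShiftSpec.SSpecification (ShiftSpec.language X) G t) →
      ShiftSpec.growthRate (Cp ∪ Cs) < ShiftSpec.growthRate (ShiftSpec.language X) →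
      ShiftSpec.Extendable (ShiftSpec.language X) Cp G Cs →
      ShiftSpec.IsFactor X Y →
      ShiftSpec.growthRate (Cp ∪ Cs) < ShiftSpec.topEntropy Y →
        ShiftSpec.IntrinsicallyErgodic (ShiftSpec.shiftMap Y) ∧
        ((∃ t : ℕ, ShiftSpec.PerSpecification X G t) →
          ∀ μ : ProbabilityMeasure Y.carrier,
            ShiftSpec.IsMaxEntropyMeasure (ShiftSpec.shiftMap Y) μ →
              ShiftSpec.PerMeasuresTendsto (ShiftSpec.shiftMap Y) μ)) := by
  exact ⟨fun X Y Cp G Cs hD hS _ hE hXY hgr ↦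
      ShiftSpec.intrinsicallyErgodic_of_isFactor ShiftSpec.hasForwardWindows_nat
        X Y Cp G Cs hD hS hE hXY hgr,
    fun X Y Cp G Cs hD hS _ hE hXY hgr ↦
      ShiftSpec.intrinsicallyErgodic_of_isFactor ShiftSpec.hasForwardWindows_int
        X Y Cp G Cs hD hS hE hXY hgr⟩
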